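/- Let $K$ be a field of characteristic $0$. Let $\mathrm{Cat}_{\mathrm{Lie}}$ be the $K$-linear PROP freely generated by a Lie algebra: the $K$-linear symmetric strict monoidal category with objects $0,1,2,\dots$ (tensor product $m\otimes n=m+n$) generated by a morphism $[,]:2\to 1$ subject to antisymmetry and the Jacobi identity. Let $\mathrm{Cat}_{\mathrm{Lie}^C}$ be the $K$-linear PROP generated by $[,]:2\to 1$ and $c:0\to 2$ (the Casimir element) subject to antisymmetry, the Jacobi identity, the symmetry $P_{1,1}\,c=c$ (where $P_{1,1}:2\to2$ is the symmetry), and the invariance $$([,]\otimes \mathrm{id}_1)(\mathrm{id}_1\otimes c)=(\mathrm{id}_1\otimes[,])(c\otimes \mathrm{id}_1):1\to 2 .$$ For $d\ge 0$ let $\mathrm{Cat}_{\mathrm{Lie}^C}(0,n)_d$ be the span of the morphisms $0\to n$ that can be written with exactly $d$ copies of $c$. A $\mathrm{Cat}_{\mathrm{Lie}}$-module is a $K$-linear functor from $\mathrm{Cat}_{\mathrm{Lie}}$ to $K$-vector spaces. These modules form a monoidal category under the Day convolution $$(M\boxtimes N)(r)=\int^{p,q}\mathrm{Cat}_{\mathrm{Lie}}(p+q,r)\otimes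 M(p)\otimes N(q),$$ with unit $\mathrm{Cat}_{\mathrm{Lie}}(0,-)$. An algebra is a monoid object of this monoidal category; a two-sided ideal is a submodule (stable under $\mathrm{Cat}_{\mathrm{Lie}}$) which absorbs left and right multiplication. The same definitions apply to $\mathrm{Cat}_{\mathrm{Lie}^C}$. Let $U$ be the lax monoidal functor which restricts $\mathrm{Cat}_{\mathrm{Lie}^C}$-modules along the canonical functor $\mathrm{Cat}_{\mathrm{Lie}}\to\mathrm{Cat}_{\mathrm{Lie}^C}$, and let $C=U(\mathrm{Cat}_{\mathrm{Lie}^C}(0,-))$ be the algebra obtained from the unit algebra; its multiplication is $h\otimes x\otimes y\mapsto h(x\otimes y)$. Put $C_d(n)=\mathrm{Cat}_{\mathrm{Lie}^C}(0,n)_d$. Let $C_1^{\boxtimes}=\bigoplus_{d\ge0}C_1^{\boxtimes d}$ be the tensor algebra on the module $C_1$. **Theorem.** The subspaces $C_d$ make $C$ a graded algebra, the submodules $C_1^{\boxtimes d}$ make $C_1^{\boxtimes}$ a graded algebra, and there is a surjective morphism of graded algebras $$\phi:C_1^{\boxtimes}\to C$$ which extends the inclusion $C_1\hookrightarrow C$.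 The kernel of $\phi$ is the two-sided ideal of $C_1^{\boxtimes}$ generated by the two elements $$r_s=\mathrm{id}_4\otimes c\otimes c-P_{(13)(24)}\otimes c\otimes c\in C_1^{\boxtimes 2}(4),$$ $$r_c=\bigl(([,]\otimes\mathrm{id}_2)P_{(23)}\bigr)\otimes c\otimes c+(\mathrm{id}_1\otimes[,]\otimes\mathrm{id}_1)\otimes c\otimes c\in C_1^{\boxtimes2}(3),$$ where $P_\sigma:4\to4$ denotes the permutation $\sigma$ of the four tensor factors. In particular $C$ is a quadratic algebra: the canonical morphism from the tensor algebra on $C_1$ to $C$ is surjective, and its kernel is generated, as a two-sided ideal, by elements of degree $2$. -/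

import Mathlib

open CategoryTheory MonoidalCategory
open scoped TensorProduct DirectSum

universe u

noncomputable section

namespace CasimirLie


/-! ### Linear PROPs given by generators and relations -/

/-- Formal `K`-linear expressions in the morphisms `m ⟶ n` of a symmetric strict monoidal category
with objects the natural numbers, built from generating morphisms `g : G m n`.
Composition `comp f g` is written in diagrammatic order (first `f`, then `g`). -/
inductive Term (K : Type u) (G : ℕ → ℕ → Type) : ℕ → ℕ → Type u
  | gen {m n : ℕ} (g : G m n) : Term K G m n
  | id (n : ℕ) : Term K G n n
  | comp {m n p : ℕ} (f : Term K G m n) (g : Term K G n p) : Term K G m p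
  | tens {m n m' n' : ℕ} (f : Term K G m n) (g : Term K G m' n') : Term K G (m + m') (n + n')
  | swap (m n : ℕ) : Term K G (m + n) (n + m)
  | zero (m n : ℕ) : Term K G m n
  | add {m n : ℕ} (f g : Term K G m n) : Term K G m n
  | smul {m n : ℕ} (a : K) (f : Term K G m n) : Term K G m n

namespace Term

variable {K : Type u} {G G' : ℕ → ℕ → Type}

/-- The identity, regarded as a morphism between two equal objects. -/
def ofEq {m n : ℕ} (h : m = n) : Term K G m n := h ▸ Term.id m

/-- Replace the generators of an expression. -/
def map (φ : ∀ m n, G m n → G' m n) : ∀ {m n : ℕ}, Term K G m n → Term K G' m n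
  | _, _, gen g => gen (φ _ _ g)
  | _, _, id n => id n
  | _, _, comp f g => comp (map φ f) (map φ g)
  | _, _, tens f g => tens (map φ f) (map φ g)
  | _, _, swap m n => swap m n
  | _, _, zero m n => zero m n
  | _, _, add f g => add (map φ f) (map φ g)
  | _, _, smul a f => smul a (map φ f)

theorem map_ofEq (φ : ∀ m n, G m n → G' m n) {m n : ℕ} (h : m = n) :
    map φ (ofEq h : Term K G m n) = ofEq h := by
  subst h; rfl

/-- `IsMonomial w d f`: the expression `f` is built from generators, identities and symmetries by
composition and tensor product only, and the total weight of its generators is `d`. -/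
inductive IsMonomial (w : ∀ m n, G m n → ℕ) : ℕ → ∀ {m n : ℕ}, Term K G m n → Prop
  | gen {m n : ℕ} (g : G m n) : IsMonomial w (w m n g) (gen g)
  | id (n : ℕ) : IsMonomial w 0 (id n)
  | swap (m n : ℕ) : IsMonomial w 0 (swap m n)
  | comp {d e m n p : ℕ} {f : Term K G m n} {g : Term K G n p} :
      IsMonomial w d f → IsMonomial w e g → IsMonomial w (d + e) (comp f g)
  | tens {d e m n m' n' : ℕ} {f : Term K G m n} {g : Term K G m' n'} :
      IsMonomial w d f → IsMonomial w e g → IsMonomial w (d + e) (tens f g)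

end Term

open Term in
/-- The smallest congruence on expressions which contains the relations `R` and for which the
quotient is a `K`-linear symmetric strict monoidal category. -/
inductive Rel {K : Type u} [CommRing K] {G : ℕ → ℕ → Type}
    (R : ∀ m n, Term K G m n → Term K G m n → Prop) :
    ∀ {m n : ℕ}, Term K G m n → Term K G m n → Prop
  | of {m n : ℕ} {f g : Term K G m n} : R m n f g → Rel R f g
  -- congruence
  | refl {m n : ℕ} (f : Term K G m n) : Rel R f f
  | symm {m n : ℕ} {f g : Term K G m n} : Rel R f g → Rel R g f
  | trans {m n : ℕ} {f g h : Term K G m n} : Rel R f g → Rel R g h → Rel R f h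
  | comp_congr {m n p : ℕ} {f f' : Term K G m n} {g g' : Term K G n p} :
      Rel R f f' → Rel R g g' → Rel R (comp f g) (comp f' g')
  | tens_congr {m n m' n' : ℕ} {f f' : Term K G m n} {g g' : Term K G m' n'} :
      Rel R f f' → Rel R g g' → Rel R (tens f g) (tens f' g')
  | add_congr {m n : ℕ} {f f' g g' : Term K G m n} :
      Rel R f f' → Rel R g g' → Rel R (add f g) (add f' g')
  | smul_congr {m n : ℕ} (a : K) {f f' : Term K G m n} :
      Rel R f f' → Rel R (smul a f) (smul a f')
  -- module axioms
  | add_assoc {m n : ℕ} (f g h : Term K G m n) : Rel R (add (add f g) h) (add f (add g h))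
  | add_comm {m n : ℕ} (f g : Term K G m n) : Rel R (add f g) (add g f)
  | zero_add {m n : ℕ} (f : Term K G m n) : Rel R (add (zero m n) f) f
  | zero_smul {m n : ℕ} (f : Term K G m n) : Rel R (smul 0 f) (zero m n)
  | one_smul {m n : ℕ} (f : Term K G m n) : Rel R (smul 1 f) f
  | mul_smul {m n : ℕ} (a b : K) (f : Term K G m n) : Rel R (smul (a * b) f) (smul a (smul b f))
  | add_smul {m n : ℕ} (a b : K) (f : Term K G m n) :
      Rel R (smul (a + b) f) (add (smul a f) (smul b f))
  | smul_add {m n : ℕ} (a : K) (f g : Term K G m n) :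
      Rel R (smul a (add f g)) (add (smul a f) (smul a g))
  -- category axioms
  | id_comp {m n : ℕ} (f : Term K G m n) : Rel R (comp (id m) f) f
  | comp_id {m n : ℕ} (f : Term K G m n) : Rel R (comp f (id n)) f
  | assoc {m n p q : ℕ} (f : Term K G m n) (g : Term K G n p) (h : Term K G p q) :
      Rel R (comp (comp f g) h) (comp f (comp g h))
  -- bilinearity of the composition
  | add_comp {m n p : ℕ} (f f' : Term K G m n) (g : Term K G n p) :
      Rel R (comp (add f f') g) (add (comp f g) (comp f' g))
  | smul_comp {m n p : ℕ} (a : K) (f : Term K G m n) (g : Term K G n p) :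
      Rel R (comp (smul a f) g) (smul a (comp f g))
  | comp_add {m n p : ℕ} (f : Term K G m n) (g g' : Term K G n p) :
      Rel R (comp f (add g g')) (add (comp f g) (comp f g'))
  | comp_smul {m n p : ℕ} (a : K) (f : Term K G m n) (g : Term K G n p) :
      Rel R (comp f (smul a g)) (smul a (comp f g))
  -- functoriality and bilinearity of the tensor product
  | id_tens_id (m n : ℕ) : Rel R (tens (id m) (id n)) (id (m + n))
  | tens_comp_tens {m n p m' n' p' : ℕ} (f : Term K G m n) (g : Term K G n p)
      (f' : Term K G m' n') (g' : Term K G n' p') :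
      Rel R (comp (tens f f') (tens g g')) (tens (comp f g) (comp f' g'))
  | add_tens {m n m' n' : ℕ} (f f' : Term K G m n) (g : Term K G m' n') :
      Rel R (tens (add f f') g) (add (tens f g) (tens f' g))
  | smul_tens {m n m' n' : ℕ} (a : K) (f : Term K G m n) (g : Term K G m' n') :
      Rel R (tens (smul a f) g) (smul a (tens f g))
  | tens_add {m n m' n' : ℕ} (f : Term K G m n) (g g' : Term K G m' n') :
      Rel R (tens f (add g g')) (add (tens f g) (tens f g'))
  | tens_smul {m n m' n' : ℕ} (a : K) (f : Term K G m n) (g : Term K G m' n') :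
      Rel R (tens f (smul a g)) (smul a (tens f g))
  -- strict associativity and strict unit
  | tens_assoc {m n m' n' m'' n'' : ℕ} (f : Term K G m n) (g : Term K G m' n')
      (h : Term K G m'' n'') :
      Rel R (comp (tens (tens f g) h) (ofEq (Nat.add_assoc n n' n'')))
        (comp (ofEq (Nat.add_assoc m m' m'')) (tens f (tens g h)))
  | id_zero_tens {m n : ℕ} (f : Term K G m n) :
      Rel R (comp (tens (id 0) f) (ofEq (Nat.zero_add n))) (comp (ofEq (Nat.zero_add m)) f)
  | tens_id_zero {m n : ℕ} (f : Term K G m n) :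
      Rel R (comp (tens f (id 0)) (ofEq (Nat.add_zero n))) (comp (ofEq (Nat.add_zero m)) f)
  -- the symmetry: naturality, involutivity, hexagon
  | tens_swap {m n m' n' : ℕ} (f : Term K G m n) (g : Term K G m' n') :
      Rel R (comp (tens f g) (swap n n')) (comp (swap m m') (tens g f))
  | swap_swap (m n : ℕ) : Rel R (comp (swap m n) (swap n m)) (id (m + n))
  | swap_add (m n p : ℕ) :
      Rel R (swap m (n + p))
        (comp (ofEq (Nat.add_assoc m n p).symm)
          (comp (tens (swap m n) (id p))
            (comp (ofEq (Nat.add_assoc n m p))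
              (comp (tens (id n) (swap m p)) (ofEq (Nat.add_assoc n p m).symm)))))

/-- The `K`-linear PROP presented by the generators `G` and the relations `R`;
its objects are the natural numbers. -/
structure PresentedPROP (K : Type u) [CommRing K] (G : ℕ → ℕ → Type)
    (R : ∀ m n, Term K G m n → Term K G m n → Prop) : Type where
  /-- the number of tensor factors -/
  arity : ℕ

namespace PresentedPROP

variable {K : Type u} [CommRing K] {G : ℕ → ℕ → Type}
  {R : ∀ m n, Term K G m n → Term K G m n → Prop}

/-- The congruence defining the morphisms. -/
def setoid (R : ∀ m n, Term K G m n → Term K G m n → Prop) (m n : ℕ) :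
    Setoid (Term K G m n) where
  r := Rel R
  iseqv := ⟨Rel.refl, Rel.symm, Rel.trans⟩

/-- Morphisms: expressions modulo the relations. -/
instance : CategoryStruct.{u} (PresentedPROP K G R) where
  Hom X Y := Quotient (setoid R X.arity Y.arity)
  id X := Quotient.mk _ (Term.id X.arity)
  comp := Quotient.map₂ Term.comp fun _ _ h _ _ h' => Rel.comp_congr h h'

/-- The object `n`. -/
abbrev ob (R : ∀ m n, Term K G m n → Term K G m n → Prop) (n : ℕ) : PresentedPROP K G R := ⟨n⟩

/-- The morphism represented by an expression. -/
def cls (R : ∀ m n, Term K G m n → Term K G m n → Prop) {m n : ℕ} (f : Term K G m n) :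
    ob R m ⟶ ob R n :=
  Quotient.mk _ f

theorem cls_eq {m n : ℕ} {f g : Term K G m n} (h : Rel R f g) : cls R f = cls R g :=
  Quotient.sound h

theorem exists_cls {X Y : PresentedPROP K G R} (f : X ⟶ Y) :
    ∃ t : Term K G X.arity Y.arity, cls R t = f :=
  Quotient.exists_rep f

instance : Category.{u} (PresentedPROP K G R) where
  id_comp := by rintro _ _ ⟨f⟩; exact cls_eq (Rel.id_comp f)
  comp_id := by rintro _ _ ⟨f⟩; exact cls_eq (Rel.comp_id f)
  assoc := by rintro _ _ _ _ ⟨f⟩ ⟨g⟩ ⟨h⟩; exact cls_eq (Rel.assoc f g h)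

instance (X Y : PresentedPROP K G R) : Zero (X ⟶ Y) := ⟨cls R (Term.zero _ _)⟩

instance (X Y : PresentedPROP K G R) : Add (X ⟶ Y) :=
  ⟨Quotient.map₂ Term.add fun _ _ h _ _ h' => Rel.add_congr h h'⟩

instance (X Y : PresentedPROP K G R) : SMul K (X ⟶ Y) :=
  ⟨fun a => Quotient.map (Term.smul a) fun _ _ h => Rel.smul_congr a h⟩

instance (X Y : PresentedPROP K G R) : AddCommMonoid (X ⟶ Y) where
  add_assoc := by rintro ⟨f⟩ ⟨g⟩ ⟨h⟩; exact cls_eq (Rel.add_assoc f g h)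
  add_comm := by rintro ⟨f⟩ ⟨g⟩; exact cls_eq (Rel.add_comm f g)
  zero_add := by rintro ⟨f⟩; exact cls_eq (Rel.zero_add f)
  add_zero := by
    rintro ⟨f⟩; exact cls_eq (Rel.trans (Rel.add_comm _ _) (Rel.zero_add f))
  nsmul := nsmulRec

instance (X Y : PresentedPROP K G R) : Module K (X ⟶ Y) where
  one_smul := by rintro ⟨f⟩; exact cls_eq (Rel.one_smul f)
  mul_smul := by rintro a b ⟨f⟩; exact cls_eq (Rel.mul_smul a b f)
  smul_add := by rintro a ⟨f⟩ ⟨g⟩; exact cls_eq (Rel.smul_add a f g)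
  add_smul := by rintro a b ⟨f⟩; exact cls_eq (Rel.add_smul a b f)
  zero_smul := by rintro ⟨f⟩; exact cls_eq (Rel.zero_smul f)
  smul_zero := by
    intro a
    have h0 : (0 : X ⟶ Y) = (0 : K) • (0 : X ⟶ Y) := (cls_eq (Rel.zero_smul _)).symm
    rw [h0]
    have h1 : a • (0 : K) • (0 : X ⟶ Y) = (a * 0 : K) • (0 : X ⟶ Y) :=
      (cls_eq (Rel.mul_smul a 0 _)).symm
    rw [h1, mul_zero]

instance (X Y : PresentedPROP K G R) : AddCommGroup (X ⟶ Y) := Module.addCommMonoidToAddCommGroup K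

instance : Preadditive (PresentedPROP K G R) where
  add_comp := by rintro _ _ _ ⟨f⟩ ⟨f'⟩ ⟨g⟩; exact cls_eq (Rel.add_comp f f' g)
  comp_add := by rintro _ _ _ ⟨f⟩ ⟨g⟩ ⟨g'⟩; exact cls_eq (Rel.comp_add f g g')

instance : Linear K (PresentedPROP K G R) where
  smul_comp := by rintro _ _ _ a ⟨f⟩ ⟨g⟩; exact cls_eq (Rel.smul_comp a f g)
  comp_smul := by rintro _ _ _ ⟨f⟩ a ⟨g⟩; exact cls_eq (Rel.comp_smul a f g)

/-- The identity, regarded as an isomorphism between two equal objects. -/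
def eqIso {m n : ℕ} (h : m = n) : ob R m ≅ ob R n where
  hom := cls R (Term.ofEq h)
  inv := cls R (Term.ofEq h.symm)
  hom_inv_id := by subst h; exact cls_eq (Rel.id_comp _)
  inv_hom_id := by subst h; exact cls_eq (Rel.id_comp _)

/-- The tensor product of morphisms. -/
def tensHom {X Y X' Y' : PresentedPROP K G R} (f : X ⟶ Y) (g : X' ⟶ Y') :
    ob R (X.arity + X'.arity) ⟶ ob R (Y.arity + Y'.arity) :=
  Quotient.map₂ Term.tens (fun _ _ h _ _ h' => Rel.tens_congr h h') f g

/-- The tensor product is addition on objects, with identities as structure isomorphisms. -/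
instance : MonoidalCategoryStruct (PresentedPROP K G R) where
  tensorObj X Y := ob R (X.arity + Y.arity)
  tensorHom f g := tensHom f g
  whiskerLeft X _ _ f := tensHom (𝟙 X) f
  whiskerRight f Y := tensHom f (𝟙 Y)
  tensorUnit := ob R 0
  associator X Y Z := eqIso (Nat.add_assoc X.arity Y.arity Z.arity)
  leftUnitor X := eqIso (Nat.zero_add X.arity)
  rightUnitor X := eqIso (Nat.add_zero X.arity)

theorem eqIso_refl (n : ℕ) : (eqIso (rfl : n = n) : ob R n ≅ _) = Iso.refl _ := by
  ext; rfl

theorem eqIso_hom_comp {m n p : ℕ} (h : m = n) (h' : n = p) :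
    (eqIso h : ob R m ≅ _).hom ≫ (eqIso h').hom = (eqIso (h.trans h')).hom := by
  subst h; subst h'; simp [eqIso_refl]

theorem eqIso_inv {m n : ℕ} (h : m = n) :
    (eqIso h : ob R m ≅ _).inv = (eqIso h.symm).hom := rfl

theorem id_tensHom_id (X Y : PresentedPROP K G R) :
    tensHom (𝟙 X) (𝟙 Y) = 𝟙 (ob R (X.arity + Y.arity)) := cls_eq (Rel.id_tens_id _ _)

theorem tensHom_eqIso {m n m' n' : ℕ} (h : m = n) (h' : m' = n') :
    tensHom (eqIso h : ob R m ≅ _).hom (eqIso h' : ob R m' ≅ _).hom =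
      (eqIso (congrArg₂ (· + ·) h h')).hom := by
  subst h; subst h'; simp [eqIso_refl, id_tensHom_id]

instance : MonoidalCategory (PresentedPROP K G R) :=
  MonoidalCategory.ofTensorHom
    (id_tensorHom_id := id_tensHom_id)
    (id_tensorHom := fun _ _ _ _ => rfl)
    (tensorHom_id := fun _ _ => rfl)
    (tensorHom_comp_tensorHom := by
      rintro _ _ _ _ _ _ ⟨f⟩ ⟨g⟩ ⟨f'⟩ ⟨g'⟩; exact cls_eq (Rel.tens_comp_tens _ _ _ _))
    (associator_naturality := by
      rintro _ _ _ _ _ _ ⟨f⟩ ⟨g⟩ ⟨h⟩; exact cls_eq (Rel.tens_assoc f g h))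
    (leftUnitor_naturality := by rintro _ _ ⟨f⟩; exact cls_eq (Rel.id_zero_tens f))
    (rightUnitor_naturality := by rintro _ _ ⟨f⟩; exact cls_eq (Rel.tens_id_zero f))
    (pentagon := by
      intro W X Y Z
      change tensHom (eqIso _).hom (eqIso rfl).hom ≫ (eqIso _).hom ≫
        tensHom (eqIso rfl).hom (eqIso _).hom = (eqIso _).hom ≫ (eqIso _).hom
      simp only [tensHom_eqIso]
      erw [eqIso_hom_comp, eqIso_hom_comp, eqIso_hom_comp])
    (triangle := by
      intro X Y
      change (eqIso _).hom ≫ tensHom (eqIso rfl).hom (eqIso _).hom =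
        tensHom (eqIso _).hom (eqIso rfl).hom
      simp only [tensHom_eqIso]
      erw [eqIso_hom_comp])

instance : MonoidalPreadditive (PresentedPROP K G R) where
  whiskerLeft_zero := by
    intro X Y Z
    have : (0 : Y ⟶ Z) = (0 : K) • (0 : Y ⟶ Z) := (zero_smul _ _).symm
    rw [this]
    exact (cls_eq (Rel.tens_smul (0 : K) (Term.id _) (Term.zero _ _))).trans
      (cls_eq (Rel.zero_smul _))
  zero_whiskerRight := by
    intro X Y Z
    have : (0 : Y ⟶ Z) = (0 : K) • (0 : Y ⟶ Z) := (zero_smul _ _).symm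
    rw [this]
    exact (cls_eq (Rel.smul_tens (0 : K) (Term.zero _ _) (Term.id _))).trans
      (cls_eq (Rel.zero_smul _))
  whiskerLeft_add := by rintro _ _ _ ⟨f⟩ ⟨g⟩; exact cls_eq (Rel.tens_add _ f g)
  add_whiskerRight := by rintro _ _ _ ⟨f⟩ ⟨g⟩; exact cls_eq (Rel.add_tens f g _)

instance : MonoidalLinear K (PresentedPROP K G R) where
  whiskerLeft_smul := by rintro _ _ _ a ⟨f⟩; exact cls_eq (Rel.tens_smul a _ f)
  smul_whiskerRight := by rintro a _ _ ⟨f⟩ _; exact cls_eq (Rel.smul_tens a f _)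

/-- The symmetry. -/
def swapIso (X Y : PresentedPROP K G R) : X ⊗ Y ≅ Y ⊗ X where
  hom := cls R (Term.swap X.arity Y.arity)
  inv := cls R (Term.swap Y.arity X.arity)
  hom_inv_id := cls_eq (Rel.swap_swap _ _)
  inv_hom_id := cls_eq (Rel.swap_swap _ _)

theorem swapIso_natural {X Y X' Y' : PresentedPROP K G R} (f : X ⟶ Y) (g : X' ⟶ Y') :
    (f ⊗ₘ g) ≫ (swapIso Y Y').hom = (swapIso X X').hom ≫ (g ⊗ₘ f) := by
  obtain ⟨f, rfl⟩ := exists_cls f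
  obtain ⟨g, rfl⟩ := exists_cls g
  exact cls_eq (Rel.tens_swap f g)

theorem swapIso_hexagon (X Y Z : PresentedPROP K G R) :
    (α_ X Y Z).hom ≫ (swapIso X (Y ⊗ Z)).hom ≫ (α_ Y Z X).hom =
      (swapIso X Y).hom ▷ Z ≫ (α_ Y X Z).hom ≫ Y ◁ (swapIso X Z).hom := by
  have h : (swapIso X (Y ⊗ Z)).hom = (α_ X Y Z).inv ≫ (swapIso X Y).hom ▷ Z ≫
      (α_ Y X Z).hom ≫ Y ◁ (swapIso X Z).hom ≫ (α_ Y Z X).inv :=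
    cls_eq (Rel.swap_add X.arity Y.arity Z.arity)
  rw [h]; simp

instance : SymmetricCategory (PresentedPROP K G R) where
  braiding := swapIso
  braiding_naturality_left f Z := by
    simpa using swapIso_natural f (𝟙 Z)
  braiding_naturality_right Z _ _ f := by
    simpa using swapIso_natural (𝟙 Z) f
  hexagon_forward := swapIso_hexagon
  hexagon_reverse X Y Z := by
    have h := congrArg (fun e => Iso.inv e)
      (Iso.ext (α := (α_ Z X Y) ≪≫ swapIso Z (X ⊗ Y) ≪≫ (α_ X Y Z))
        (β := whiskerRightIso (swapIso Z X) Y ≪≫ (α_ X Z Y) ≪≫ whiskerLeftIso X (swapIso Z Y))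
        (by simpa using swapIso_hexagon Z X Y))
    have h' : ∀ A B : PresentedPROP K G R, (swapIso A B).inv = (swapIso B A).hom := fun _ _ => rfl
    simpa [h'] using h
  symmetry X Y := (swapIso X Y).hom_inv_id

variable (R) in
/-- The homogeneous part of weight `d` of a hom-space: the span of the classes of the monomials of
weight `d`. -/
def homog (w : ∀ m n, G m n → ℕ) (d : ℕ) (X Y : PresentedPROP K G R) : Submodule K (X ⟶ Y) :=
  Submodule.span K {f | ∃ t : Term K G X.arity Y.arity, t.IsMonomial w d ∧ f = cls R t}

theorem comp_mem_homog {w : ∀ m n, G m n → ℕ} {d e : ℕ} {X Y Z : PresentedPROP K G R}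
    {f : X ⟶ Y} {g : Y ⟶ Z} (hf : f ∈ homog R w d X Y) (hg : g ∈ homog R w e Y Z) :
    f ≫ g ∈ homog R w (d + e) X Z := by
  induction hf using Submodule.span_induction with
  | mem f hf =>
    obtain ⟨s, hs, rfl⟩ := hf
    induction hg using Submodule.span_induction with
    | mem g hg =>
      obtain ⟨t, ht, rfl⟩ := hg
      exact Submodule.subset_span ⟨_, hs.comp ht, rfl⟩
    | zero => rw [Limits.comp_zero]; exact zero_mem _
    | add _ _ _ _ h h' => rw [Preadditive.comp_add]; exact add_mem h h'
    | smul a _ _ h => rw [Linear.comp_smul]; exact Submodule.smul_mem _ a h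
  | zero => rw [Limits.zero_comp]; exact zero_mem _
  | add _ _ _ _ h h' => rw [Preadditive.add_comp]; exact add_mem h h'
  | smul a _ _ h => rw [Linear.smul_comp]; exact Submodule.smul_mem _ a h

end PresentedPROP


/-! ### Modules over a linear category -/

/-- A module over a `K`-linear category `P`: a `K`-linear functor from `P` to `K`-modules. -/
structure LinMod (K : Type u) [CommRing K] (P : Type) [Category.{u} P] [Preadditive P]
    [Linear K P] where
  /-- the underlying functor -/
  functor : P ⥤ ModuleCat.{u} K
  [additive : functor.Additive]
  [linear : functor.Linear K]

theorem modLinExt {K : Type u} [CommRing K] {A B : ModuleCat.{u} K} {f g : A ⟶ B}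
    (h : ∀ x, f.hom x = g.hom x) : f = g :=
  ModuleCat.hom_ext (LinearMap.ext h)

attribute [instance] LinMod.additive LinMod.linear

namespace LinMod

section Basic

variable {K : Type u} [CommRing K] {P : Type} [Category.{u} P] [Preadditive P] [Linear K P]

/-- The value of a module at an object. -/
abbrev obj (M : LinMod K P) (X : P) : ModuleCat.{u} K := M.functor.obj X

/-- The action of a morphism of `P` on a module. -/
def act (M : LinMod K P) {X Y : P} (f : X ⟶ Y) : M.obj X →ₗ[K] M.obj Y := (M.functor.map f).hom

variable (M : LinMod K P)

@[simp] theorem act_id (X : P) (x : M.obj X) : M.act (𝟙 X) x = x := by simp [act]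

theorem act_comp {X Y Z : P} (f : X ⟶ Y) (g : Y ⟶ Z) (x : M.obj X) :
    M.act (f ≫ g) x = M.act g (M.act f x) := by simp [act]

@[simp] theorem act_act {X Y Z : P} (f : X ⟶ Y) (g : Y ⟶ Z) (x : M.obj X) :
    M.act g (M.act f x) = M.act (f ≫ g) x := (M.act_comp f g x).symm

@[simp] theorem act_add {X Y : P} (f g : X ⟶ Y) (x : M.obj X) :
    M.act (f + g) x = M.act f x + M.act g x := by simp [act, Functor.map_add]

@[simp] theorem act_smul {X Y : P} (a : K) (f : X ⟶ Y) (x : M.obj X) :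
    M.act (a • f) x = a • M.act f x := by simp [act, Functor.map_smul]

/-- Morphisms of modules are natural transformations. -/
instance : Category.{u} (LinMod K P) where
  Hom M N := M.functor ⟶ N.functor
  id M := 𝟙 M.functor
  comp f g := NatTrans.vcomp f g
  id_comp f := Category.id_comp (obj := P ⥤ ModuleCat.{u} K) f
  comp_id f := Category.comp_id (obj := P ⥤ ModuleCat.{u} K) f
  assoc f g h := Category.assoc (obj := P ⥤ ModuleCat.{u} K) f g h

variable {M} {N Q : LinMod K P}

/-- The component of a morphism of modules at an object. -/
def ap (φ : M ⟶ N) (X : P) : M.obj X →ₗ[K] N.obj X := (NatTrans.app φ X).hom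

/-- Constructor of morphisms of modules. -/
def mkHom (φ : ∀ X, M.obj X →ₗ[K] N.obj X)
    (h : ∀ {X Y : P} (f : X ⟶ Y) (x : M.obj X), φ Y (M.act f x) = N.act f (φ X x)) : M ⟶ N :=
  (NatTrans.mk (fun X => ModuleCat.ofHom (φ X)) fun X Y f => by
    ext x; exact h f x : M.functor ⟶ N.functor)

@[simp] theorem ap_mkHom (φ : ∀ X, M.obj X →ₗ[K] N.obj X)
    (h : ∀ {X Y : P} (f : X ⟶ Y) (x : M.obj X), φ Y (M.act f x) = N.act f (φ X x)) (X : P) :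
    ap (mkHom φ h) X = φ X := rfl

@[simp] theorem ap_id (X : P) (x : M.obj X) : ap (𝟙 M) X x = x := rfl

@[simp] theorem ap_comp (φ : M ⟶ N) (ψ : N ⟶ Q) (X : P) (x : M.obj X) :
    ap (φ ≫ ψ) X x = ap ψ X (ap φ X x) := rfl

theorem ap_act (φ : M ⟶ N) {X Y : P} (f : X ⟶ Y) (x : M.obj X) :
    ap φ Y (M.act f x) = N.act f (ap φ X x) :=
  congrArg (fun t => t.hom x) (NatTrans.naturality φ f)

theorem hom_ext {φ ψ : M ⟶ N} (h : ∀ X x, ap φ X x = ap ψ X x) : φ = ψ :=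
  NatTrans.ext (funext fun X => ModuleCat.hom_ext (LinearMap.ext fun x => h X x))

/-- Constructor of isomorphisms of modules. -/
def mkIso (f : M ⟶ N) (g : ∀ X, N.obj X → M.obj X) (h₁ : ∀ X x, g X (ap f X x) = x)
    (h₂ : ∀ X y, ap f X (g X y) = y) : M ≅ N where
  hom := f
  inv := mkHom
    (fun X =>
      { toFun := g X
        map_add' y y' := by
          have h := h₁ X (g X y + g X y')
          rwa [map_add, h₂, h₂] at h
        map_smul' a y := by
          have h := h₁ X (a • g X y)
          rwa [map_smul, h₂] at h })
    (by
      intro X Y k y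
      have h := h₁ Y (M.act k (g X y))
      rwa [ap_act, h₂] at h)
  hom_inv_id := hom_ext h₁
  inv_hom_id := hom_ext h₂

@[simp] theorem mkIso_hom (f : M ⟶ N) (g : ∀ X, N.obj X → M.obj X)
    (h₁ : ∀ X x, g X (ap f X x) = x) (h₂ : ∀ X y, ap f X (g X y) = y) :
    (mkIso f g h₁ h₂).hom = f := rfl

@[simp] theorem mkIso_inv (f : M ⟶ N) (g : ∀ X, N.obj X → M.obj X)
    (h₁ : ∀ X x, g X (ap f X x) = x) (h₂ : ∀ X y, ap f X (g X y) = y) (X : P) (y : N.obj X) :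
    ap (mkIso f g h₁ h₂).inv X y = g X y := rfl

variable (M) in
/-- The submodule of `M` given by a family of subspaces stable under the action of `P`. -/
def sub (S : ∀ X, Submodule K (M.obj X))
    (hS : ∀ {X Y : P} (f : X ⟶ Y), ∀ x ∈ S X, M.act f x ∈ S Y) : LinMod K P where
  functor :=
    { obj X := ModuleCat.of K (S X)
      map f := ModuleCat.ofHom ((M.act f).restrict (hS f))
      map_id X := modLinExt fun x => Subtype.ext (M.act_id X x.1)
      map_comp f g := modLinExt fun x => Subtype.ext (M.act_comp f g x.1) }
  additive := ⟨modLinExt fun x => Subtype.ext (M.act_add _ _ x.1)⟩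
  linear := ⟨fun f a => modLinExt fun x => Subtype.ext (M.act_smul a f x.1)⟩

/-- The inclusion of a submodule. -/
def subIncl (S : ∀ X, Submodule K (M.obj X))
    (hS : ∀ {X Y : P} (f : X ⟶ Y), ∀ x ∈ S X, M.act f x ∈ S Y) : M.sub S hS ⟶ M :=
  mkHom (fun X => (S X).subtype) fun _ _ => rfl

variable (K) in
/-- The module `P(X, -)`. -/
def corep (X : P) : LinMod K P where
  functor := (linearCoyoneda K P).obj (Opposite.op X)
  linear := ⟨fun f a => by ext g; exact Linear.comp_smul _ _ _ g a f⟩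

/-- An element of `P(X, -)` at `Y` is a morphism from `X` to `Y`. -/
def toHom {X Y : P} : (corep K X).obj Y →ₗ[K] (X ⟶ Y) := LinearMap.id

/-- A morphism from `X` to `Y` is an element of `P(X, -)` at `Y`. -/
def ofHom {X Y : P} : (X ⟶ Y) →ₗ[K] (corep K X).obj Y := LinearMap.id

@[simp] theorem toHom_ofHom {X Y : P} (f : X ⟶ Y) : toHom (ofHom (K := K) f) = f := rfl

@[simp] theorem ofHom_toHom {X Y : P} (g : (corep K X).obj Y) : ofHom (toHom g) = g := rfl

@[simp] theorem toHom_act {X Y Z : P} (f : Y ⟶ Z) (g : (corep K X).obj Y) :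
    toHom ((corep K X).act f g) = toHom g ≫ f := rfl

theorem act_ofHom {X Y Z : P} (f : Y ⟶ Z) (g : X ⟶ Y) :
    (corep K X).act f (ofHom g) = ofHom (g ≫ f) := rfl

end Basic

/-! ### Day convolution -/

section Day

variable {K : Type u} [CommRing K] {P : Type} [Category.{u} P] [Preadditive P] [Linear K P]
  [MonoidalCategory P]

/-- The direct sum of the spaces `P(X ⊗ Y, Z) ⊗ M(X) ⊗ N(Y)` over all `X`, `Y`. -/
abbrev DayPre (M N : LinMod K P) (Z : P) : Type u :=
  ⨁ p : P × P, ((p.1 ⊗ p.2 ⟶ Z) ⊗[K] (M.obj p.1 ⊗[K] N.obj p.2))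

open scoped Classical in
/-- The element `h ⊗ x ⊗ y` in the summand of index `(X, Y)`. -/
def dayPre (M N : LinMod K P) {X Y Z : P} (h : X ⊗ Y ⟶ Z) (x : M.obj X) (y : N.obj Y) :
    DayPre M N Z :=
  DirectSum.lof K (P × P) (fun p => (p.1 ⊗ p.2 ⟶ Z) ⊗[K] (M.obj p.1 ⊗[K] N.obj p.2)) (X, Y)
    (h ⊗ₜ[K] (x ⊗ₜ[K] y))

/-- The relations of the coend: `h (f ⊗ g) ⊗ x ⊗ y = h ⊗ f x ⊗ g y`. -/
def dayRel (M N : LinMod K P) (Z : P) : Submodule K (DayPre M N Z) :=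
  Submodule.span K {t | ∃ (X Y X' Y' : P) (f : X ⟶ X') (g : Y ⟶ Y') (h : X' ⊗ Y' ⟶ Z)
    (x : M.obj X) (y : N.obj Y),
    t = dayPre M N ((f ⊗ₘ g) ≫ h) x y - dayPre M N h (M.act f x) (N.act g y)}

/-- The value at `Z` of the Day convolution of `M` and `N`:
the coend of `P(X ⊗ Y, Z) ⊗ M(X) ⊗ N(Y)` over `X` and `Y`. -/
abbrev DayObj (M N : LinMod K P) (Z : P) : Type u := DayPre M N Z ⧸ dayRel M N Z

/-- The class of `h ⊗ x ⊗ y` in the Day convolution. -/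
def dayMk (M N : LinMod K P) {X Y Z : P} (h : X ⊗ Y ⟶ Z) (x : M.obj X) (y : N.obj Y) :
    DayObj M N Z :=
  (dayRel M N Z).mkQ (dayPre M N h x y)

section

variable {M N : LinMod K P} {X Y Z : P}

theorem dayMk_add_hom (h h' : X ⊗ Y ⟶ Z) (x : M.obj X) (y : N.obj Y) :
    dayMk M N (h + h') x y = dayMk M N h x y + dayMk M N h' x y := by
  simp [dayMk, dayPre, TensorProduct.add_tmul]

theorem dayMk_smul_hom (a : K) (h : X ⊗ Y ⟶ Z) (x : M.obj X) (y : N.obj Y) :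
    dayMk M N (a • h) x y = a • dayMk M N h x y := by
  rw [dayMk, dayMk, dayPre, dayPre, ← map_smul, ← map_smul]
  congr 2

@[simp] theorem dayMk_add_left (h : X ⊗ Y ⟶ Z) (x x' : M.obj X) (y : N.obj Y) :
    dayMk M N h (x + x') y = dayMk M N h x y + dayMk M N h x' y := by
  simp [dayMk, dayPre, TensorProduct.add_tmul, TensorProduct.tmul_add]

@[simp] theorem dayMk_smul_left (a : K) (h : X ⊗ Y ⟶ Z) (x : M.obj X) (y : N.obj Y) :
    dayMk M N h (a • x) y = a • dayMk M N h x y := by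
  rw [dayMk, dayMk, dayPre, dayPre, ← map_smul, ← map_smul, ← TensorProduct.smul_tmul',
    TensorProduct.tmul_smul]

@[simp] theorem dayMk_add_right (h : X ⊗ Y ⟶ Z) (x : M.obj X) (y y' : N.obj Y) :
    dayMk M N h x (y + y') = dayMk M N h x y + dayMk M N h x y' := by
  simp [dayMk, dayPre, TensorProduct.tmul_add]

@[simp] theorem dayMk_smul_right (a : K) (h : X ⊗ Y ⟶ Z) (x : M.obj X) (y : N.obj Y) :
    dayMk M N h x (a • y) = a • dayMk M N h x y := by
  simp [dayMk, dayPre]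

@[simp] theorem dayMk_zero_left (h : X ⊗ Y ⟶ Z) (y : N.obj Y) :
    dayMk M N h 0 y = 0 := by
  simp [dayMk, dayPre]

@[simp] theorem dayMk_zero_right (h : X ⊗ Y ⟶ Z) (x : M.obj X) :
    dayMk M N h x 0 = 0 := by
  simp [dayMk, dayPre]

theorem dayMk_act {X' Y' : P} (f : X ⟶ X') (g : Y ⟶ Y') (h : X' ⊗ Y' ⟶ Z) (x : M.obj X)
    (y : N.obj Y) : dayMk M N h (M.act f x) (N.act g y) = dayMk M N ((f ⊗ₘ g) ≫ h) x y := by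
  symm
  rw [dayMk, dayMk, ← sub_eq_zero, ← map_sub, Submodule.mkQ_apply, Submodule.Quotient.mk_eq_zero]
  exact Submodule.subset_span ⟨X, Y, X', Y', f, g, h, x, y, rfl⟩

theorem dayMk_act_left {X' : P} (f : X ⟶ X') (h : X' ⊗ Y ⟶ Z) (x : M.obj X)
    (y : N.obj Y) : dayMk M N h (M.act f x) y = dayMk M N (f ▷ Y ≫ h) x y := by
  have := dayMk_act (M := M) (N := N) f (𝟙 Y) h x y
  simpa using this

theorem dayMk_act_right {Y' : P} (g : Y ⟶ Y') (h : X ⊗ Y' ⟶ Z) (x : M.obj X)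
    (y : N.obj Y) : dayMk M N h x (N.act g y) = dayMk M N (X ◁ g ≫ h) x y := by
  have := dayMk_act (M := M) (N := N) (𝟙 X) g h x y
  simpa using this

theorem day_induction {p : DayObj M N Z → Prop} (t : DayObj M N Z) (zero : p 0)
    (mk : ∀ (X Y : P) (h : X ⊗ Y ⟶ Z) (x : M.obj X) (y : N.obj Y), p (dayMk M N h x y))
    (add : ∀ s t, p s → p t → p (s + t)) : p t := by
  classical
  obtain ⟨t, rfl⟩ := (dayRel M N Z).mkQ_surjective t
  induction t using DirectSum.induction_on with
  | zero => simpa using zero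
  | add s t hs ht => rw [map_add]; exact add _ _ hs ht
  | of i t =>
    induction t using TensorProduct.induction_on with
    | zero => simpa using zero
    | add s t hs ht => rw [map_add, map_add]; exact add _ _ hs ht
    | tmul h t =>
      induction t using TensorProduct.induction_on with
      | zero => simpa using zero
      | add s t hs ht => rw [TensorProduct.tmul_add, map_add, map_add]; exact add _ _ hs ht
      | tmul x y =>
        have key := mk i.1 i.2 h x y
        rw [dayMk, dayPre, DirectSum.lof_eq_of] at key
        convert key

end

/-- Balanced trilinear families of maps `P(X ⊗ Y, Z) × M(X) × N(Y) → W`. -/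
structure DayBalanced (M N : LinMod K P) (Z : P) (W : Type u) [AddCommGroup W] [Module K W] where
  /-- the maps -/
  toFun : ∀ {X Y : P}, (X ⊗ Y ⟶ Z) → M.obj X → N.obj Y → W
  add_hom : ∀ {X Y : P} (h h' : X ⊗ Y ⟶ Z) (x : M.obj X) (y : N.obj Y),
    toFun (h + h') x y = toFun h x y + toFun h' x y
  smul_hom : ∀ {X Y : P} (a : K) (h : X ⊗ Y ⟶ Z) (x : M.obj X) (y : N.obj Y),
    toFun (a • h) x y = a • toFun h x y
  add_left : ∀ {X Y : P} (h : X ⊗ Y ⟶ Z) (x x' : M.obj X) (y : N.obj Y),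
    toFun h (x + x') y = toFun h x y + toFun h x' y
  smul_left : ∀ {X Y : P} (a : K) (h : X ⊗ Y ⟶ Z) (x : M.obj X) (y : N.obj Y),
    toFun h (a • x) y = a • toFun h x y
  add_right : ∀ {X Y : P} (h : X ⊗ Y ⟶ Z) (x : M.obj X) (y y' : N.obj Y),
    toFun h x (y + y') = toFun h x y + toFun h x y'
  smul_right : ∀ {X Y : P} (a : K) (h : X ⊗ Y ⟶ Z) (x : M.obj X) (y : N.obj Y),
    toFun h x (a • y) = a • toFun h x y
  balanced : ∀ {X Y X' Y' : P} (f : X ⟶ X') (g : Y ⟶ Y') (h : X' ⊗ Y' ⟶ Z) (x : M.obj X)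
    (y : N.obj Y), toFun ((f ⊗ₘ g) ≫ h) x y = toFun h (M.act f x) (N.act g y)

section

variable {M N : LinMod K P} {Z : P} {W : Type u} [AddCommGroup W] [Module K W]

open scoped Classical in
/-- The linear map on the direct sum induced by a balanced family. -/
def dayPreLift (φ : DayBalanced M N Z W) : DayPre M N Z →ₗ[K] W :=
  DirectSum.toModule K (P × P) W fun p =>
    TensorProduct.lift (LinearMap.mk₂ K
      (fun h t => TensorProduct.lift (LinearMap.mk₂ K (fun x y => φ.toFun h x y)
        (φ.add_left h) (fun a => φ.smul_left a h) (φ.add_right h)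
        (fun a => φ.smul_right a h)) t)
      (by
        intro h h' t
        induction t using TensorProduct.induction_on with
        | zero => simp
        | tmul x y => simp [φ.add_hom]
        | add s t hs ht => rw [map_add, map_add, map_add, hs, ht]; abel)
      (by
        intro a h t
        induction t using TensorProduct.induction_on with
        | zero => simp
        | tmul x y => simp [φ.smul_hom]
        | add s t hs ht => rw [map_add, map_add, hs, ht, smul_add])
      (by intro h s t; rw [map_add])
      (by intro a h t; rw [map_smul]))

theorem dayPreLift_dayPre (φ : DayBalanced M N Z W) {X Y : P} (h : X ⊗ Y ⟶ Z) (x : M.obj X)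
    (y : N.obj Y) : dayPreLift φ (dayPre M N h x y) = φ.toFun h x y := by
  simp [dayPreLift, dayPre]

/-- The universal property of the Day convolution. -/
def dayLift (φ : DayBalanced M N Z W) : DayObj M N Z →ₗ[K] W :=
  (dayRel M N Z).liftQ (dayPreLift φ) (by
    rw [dayRel, Submodule.span_le]
    rintro _ ⟨X, Y, X', Y', f, g, h, x, y, rfl⟩
    simp [dayPreLift_dayPre, φ.balanced])

@[simp] theorem dayLift_dayMk (φ : DayBalanced M N Z W) {X Y : P} (h : X ⊗ Y ⟶ Z) (x : M.obj X)
    (y : N.obj Y) : dayLift φ (dayMk M N h x y) = φ.toFun h x y := by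
  simp [dayLift, dayMk, dayPreLift_dayPre]

end

/-- Postcomposition on the Day convolution. -/
def dayMap (M N : LinMod K P) {Z Z' : P} (k : Z ⟶ Z') : DayObj M N Z →ₗ[K] DayObj M N Z' :=
  dayLift
    { toFun h x y := dayMk M N (h ≫ k) x y
      add_hom h h' x y := by rw [Preadditive.add_comp, dayMk_add_hom]
      smul_hom a h x y := by rw [Linear.smul_comp, dayMk_smul_hom]
      add_left := by simp
      smul_left := by simp
      add_right := by simp
      smul_right := by simp
      balanced f g h x y := by rw [dayMk_act, Category.assoc] }

@[simp] theorem dayMap_dayMk (M N : LinMod K P) {X Y Z Z' : P} (k : Z ⟶ Z') (h : X ⊗ Y ⟶ Z)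
    (x : M.obj X) (y : N.obj Y) : dayMap M N k (dayMk M N h x y) = dayMk M N (h ≫ k) x y := by
  simp [dayMap]

/-- The Day convolution of two modules. -/
def day (M N : LinMod K P) : LinMod K P where
  functor :=
    { obj Z := ModuleCat.of K (DayObj M N Z)
      map k := ModuleCat.ofHom (dayMap M N k)
      map_id Z := by
        refine modLinExt fun t => ?_
        change dayMap M N (𝟙 Z) t = t
        induction t using day_induction with
        | zero => simp
        | mk => simp
        | add s t hs ht => rw [map_add, hs, ht]
      map_comp k l := by
        refine modLinExt fun t => ?_
        change dayMap M N (k ≫ l) t = dayMap M N l (dayMap M N k t)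
        induction t using day_induction with
        | zero => simp
        | mk => simp
        | add s t hs ht => simp only [map_add, hs, ht] }
  additive := ⟨fun {Z Z' k l} => by
    refine modLinExt fun t => ?_
    change dayMap M N (k + l) t = dayMap M N k t + dayMap M N l t
    induction t using day_induction with
    | zero => simp
    | mk => simp [Preadditive.comp_add, dayMk_add_hom]
    | add s t hs ht => simp only [map_add, hs, ht]; abel⟩
  linear := ⟨fun {Z Z'} k a => by
    refine modLinExt fun t => ?_
    change dayMap M N (a • k) t = a • dayMap M N k t
    induction t using day_induction with
    | zero => simp
    | mk => simp [Linear.comp_smul, dayMk_smul_hom]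
    | add s t hs ht => simp only [map_add, hs, ht, smul_add]⟩

end Day

end LinMod
namespace LinMod

section Monoidal

variable {K : Type u} [CommRing K] {P : Type} [Category.{u} P] [Preadditive P] [Linear K P]
  [MonoidalCategory P]

section

variable {M N Q : LinMod K P} {X Y Z : P}

/-- The element `h ⊗ x ⊗ y` of the Day convolution. -/
def dmk (h : X ⊗ Y ⟶ Z) (x : M.obj X) (y : N.obj Y) : (day M N).obj Z := dayMk M N h x y

/-- The linear map out of the Day convolution given by a balanced family. -/
def dlift {W : Type u} [AddCommGroup W] [Module K W] (φ : DayBalanced M N Z W) :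
    (day M N).obj Z →ₗ[K] W := dayLift φ

theorem dmk_add_hom (h h' : X ⊗ Y ⟶ Z) (x : M.obj X) (y : N.obj Y) :
    dmk (h + h') x y = dmk h x y + dmk h' x y := dayMk_add_hom h h' x y

theorem dmk_smul_hom (a : K) (h : X ⊗ Y ⟶ Z) (x : M.obj X) (y : N.obj Y) :
    dmk (a • h) x y = a • dmk h x y := dayMk_smul_hom a h x y

@[simp] theorem dmk_add_left (h : X ⊗ Y ⟶ Z) (x x' : M.obj X) (y : N.obj Y) :
    dmk h (x + x') y = dmk h x y + dmk h x' y := dayMk_add_left h x x' y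

@[simp] theorem dmk_smul_left (a : K) (h : X ⊗ Y ⟶ Z) (x : M.obj X) (y : N.obj Y) :
    dmk h (a • x) y = a • dmk h x y := dayMk_smul_left a h x y

@[simp] theorem dmk_add_right (h : X ⊗ Y ⟶ Z) (x : M.obj X) (y y' : N.obj Y) :
    dmk h x (y + y') = dmk h x y + dmk h x y' := dayMk_add_right h x y y'

@[simp] theorem dmk_smul_right (a : K) (h : X ⊗ Y ⟶ Z) (x : M.obj X) (y : N.obj Y) :
    dmk h x (a • y) = a • dmk h x y := dayMk_smul_right a h x y

@[simp] theorem dmk_zero_left (h : X ⊗ Y ⟶ Z) (y : N.obj Y) :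
    dmk h (0 : M.obj X) y = 0 := dayMk_zero_left h y

@[simp] theorem dmk_zero_right (h : X ⊗ Y ⟶ Z) (x : M.obj X) :
    dmk h x (0 : N.obj Y) = 0 := dayMk_zero_right h x

theorem dmk_act {X' Y' : P} (f : X ⟶ X') (g : Y ⟶ Y') (h : X' ⊗ Y' ⟶ Z) (x : M.obj X)
    (y : N.obj Y) : dmk h (M.act f x) (N.act g y) = dmk ((f ⊗ₘ g) ≫ h) x y :=
  dayMk_act f g h x y

theorem dmk_act_left {X' : P} (f : X ⟶ X') (h : X' ⊗ Y ⟶ Z) (x : M.obj X)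
    (y : N.obj Y) : dmk h (M.act f x) y = dmk (f ▷ Y ≫ h) x y :=
  dayMk_act_left f h x y

theorem dmk_act_right {Y' : P} (g : Y ⟶ Y') (h : X ⊗ Y' ⟶ Z) (x : M.obj X)
    (y : N.obj Y) : dmk h x (N.act g y) = dmk (X ◁ g ≫ h) x y :=
  dayMk_act_right g h x y

@[simp] theorem act_dmk {Z' : P} (k : Z ⟶ Z') (h : X ⊗ Y ⟶ Z)
    (x : M.obj X) (y : N.obj Y) : (day M N).act k (dmk h x y) = dmk (h ≫ k) x y :=
  dayMap_dayMk M N k h x y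

@[simp] theorem dlift_dmk {W : Type u} [AddCommGroup W] [Module K W] (φ : DayBalanced M N Z W)
    (h : X ⊗ Y ⟶ Z) (x : M.obj X) (y : N.obj Y) : dlift φ (dmk h x y) = φ.toFun h x y :=
  dayLift_dayMk φ h x y

theorem dinduction {p : (day M N).obj Z → Prop}
    (t : (day M N).obj Z) (zero : p 0)
    (mk : ∀ (X Y : P) (h : X ⊗ Y ⟶ Z) (x : M.obj X) (y : N.obj Y), p (dmk h x y))
    (add : ∀ s t, p s → p t → p (s + t)) : p t :=
  day_induction t zero mk add

theorem dlinear_ext {W : Type u} [AddCommGroup W] [Module K W] {φ ψ : (day M N).obj Z →ₗ[K] W}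
    (h : ∀ (X Y : P) (k : X ⊗ Y ⟶ Z) (x : M.obj X) (y : N.obj Y),
      φ (dmk k x y) = ψ (dmk k x y)) : φ = ψ :=
  LinearMap.ext fun t => by
    induction t using dinduction with
    | zero => rw [map_zero, map_zero]
    | mk X Y k x y => exact h X Y k x y
    | add s t hs ht => rw [map_add, map_add, hs, ht]

theorem dhom_ext {φ ψ : day M N ⟶ Q}
    (h : ∀ (X Y Z : P) (k : X ⊗ Y ⟶ Z) (x : M.obj X) (y : N.obj Y),
      ap φ Z (dmk k x y) = ap ψ Z (dmk k x y)) : φ = ψ :=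
  hom_ext fun Z t => LinearMap.congr_fun (dlinear_ext fun X Y k x y => h X Y Z k x y) t

/-- The linear map `x ↦ h ⊗ x ⊗ y`. -/
def dmkL (h : X ⊗ Y ⟶ Z) (y : N.obj Y) : M.obj X →ₗ[K] (day M N).obj Z where
  toFun x := dmk h x y
  map_add' x x' := dmk_add_left h x x' y
  map_smul' a x := dmk_smul_left a h x y

@[simp] theorem dmkL_apply (h : X ⊗ Y ⟶ Z) (x : M.obj X) (y : N.obj Y) :
    dmkL h y x = dmk h x y := rfl

/-- The linear map `y ↦ h ⊗ x ⊗ y`. -/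
def dmkR (h : X ⊗ Y ⟶ Z) (x : M.obj X) : N.obj Y →ₗ[K] (day M N).obj Z where
  toFun y := dmk h x y
  map_add' y y' := dmk_add_right h x y y'
  map_smul' a y := dmk_smul_right a h x y

@[simp] theorem dmkR_apply (h : X ⊗ Y ⟶ Z) (x : M.obj X) (y : N.obj Y) :
    dmkR h x y = dmk h x y := rfl

theorem dlinear_ext_left {W : Type u} [AddCommGroup W] [Module K W]
    {φ ψ : (day (day M N) Q).obj Z →ₗ[K] W}
    (h : ∀ (A B X Y : P) (k : A ⊗ B ⟶ Z) (g : X ⊗ Y ⟶ A) (x : M.obj X) (y : N.obj Y)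
      (z : Q.obj B), φ (dmk k (dmk g x y) z) = ψ (dmk k (dmk g x y) z)) : φ = ψ :=
  dlinear_ext fun A B k t z => LinearMap.congr_fun
    (dlinear_ext (φ := φ.comp (dmkL k z)) (ψ := ψ.comp (dmkL k z))
      fun X Y g x y => h A B X Y k g x y z) t

theorem dlinear_ext_right {W : Type u} [AddCommGroup W] [Module K W]
    {φ ψ : (day M (day N Q)).obj Z →ₗ[K] W}
    (h : ∀ (A B X Y : P) (k : A ⊗ B ⟶ Z) (g : X ⊗ Y ⟶ B) (x : M.obj A) (y : N.obj X)
      (z : Q.obj Y), φ (dmk k x (dmk g y z)) = ψ (dmk k x (dmk g y z))) : φ = ψ :=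
  dlinear_ext fun A B k x t => LinearMap.congr_fun
    (dlinear_ext (φ := φ.comp (dmkR k x)) (ψ := ψ.comp (dmkR k x))
      fun X Y g y z => h A B X Y k g x y z) t

theorem dhom_ext_left {R : LinMod K P} {φ ψ : day (day M N) Q ⟶ R}
    (h : ∀ (A B X Y Z : P) (k : A ⊗ B ⟶ Z) (g : X ⊗ Y ⟶ A) (x : M.obj X) (y : N.obj Y)
      (z : Q.obj B), ap φ Z (dmk k (dmk g x y) z) = ap ψ Z (dmk k (dmk g x y) z)) : φ = ψ :=
  hom_ext fun Z t => LinearMap.congr_fun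
    (dlinear_ext_left fun A B X Y k g x y z => h A B X Y Z k g x y z) t

/-- Constructor of morphisms out of a Day convolution. -/
def dayHom (φ : ∀ Z, DayBalanced M N Z (Q.obj Z))
    (hφ : ∀ {X Y Z Z' : P} (h : X ⊗ Y ⟶ Z) (k : Z ⟶ Z') (x : M.obj X) (y : N.obj Y),
      (φ Z').toFun (h ≫ k) x y = Q.act k ((φ Z).toFun h x y)) : day M N ⟶ Q :=
  mkHom (fun Z => dlift (φ Z)) fun {Z Z'} k t => by
    induction t using dinduction with
    | zero => simp only [map_zero]
    | mk X Y h x y => rw [act_dmk, dlift_dmk, dlift_dmk]; exact hφ h k x y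
    | add s t hs ht => simp only [map_add, hs, ht]

@[simp] theorem dayHom_dmk (φ : ∀ Z, DayBalanced M N Z (Q.obj Z))
    (hφ : ∀ {X Y Z Z' : P} (h : X ⊗ Y ⟶ Z) (k : Z ⟶ Z') (x : M.obj X) (y : N.obj Y),
      (φ Z').toFun (h ≫ k) x y = Q.act k ((φ Z).toFun h x y))
    (h : X ⊗ Y ⟶ Z) (x : M.obj X) (y : N.obj Y) :
    ap (dayHom φ hφ) Z (dmk h x y) = (φ Z).toFun h x y :=
  dlift_dmk (φ Z) h x y

end

/-- The balanced family defining the Day convolution of two morphisms. -/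
def dayTensorAux {M M' N N' : LinMod K P} (φ : M ⟶ M') (ψ : N ⟶ N') (Z : P) :
    DayBalanced M N Z ((day M' N').obj Z) where
  toFun {X Y} h x y := dmk h (ap φ X x) (ap ψ Y y)
  add_hom _ _ _ _ := dmk_add_hom _ _ _ _
  smul_hom _ _ _ _ := dmk_smul_hom _ _ _ _
  add_left _ _ _ _ := by rw [map_add, dmk_add_left]
  smul_left _ _ _ _ := by rw [map_smul, dmk_smul_left]
  add_right _ _ _ _ := by rw [map_add, dmk_add_right]
  smul_right _ _ _ _ := by rw [map_smul, dmk_smul_right]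
  balanced f g h x y := by rw [ap_act, ap_act, dmk_act]

/-- The Day convolution of two morphisms. -/
def dayTensor {M M' N N' : LinMod K P} (φ : M ⟶ M') (ψ : N ⟶ N') : day M N ⟶ day M' N' :=
  dayHom (dayTensorAux φ ψ) (by intros; exact (act_dmk _ _ _ _).symm)

@[simp] theorem dayTensor_dmk {M M' N N' : LinMod K P} (φ : M ⟶ M') (ψ : N ⟶ N')
    {X Y Z : P} (h : X ⊗ Y ⟶ Z) (x : M.obj X) (y : N.obj Y) :
    ap (dayTensor φ ψ) Z (dmk h x y) = dmk h (ap φ X x) (ap ψ Y y) :=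
  dlift_dmk (dayTensorAux φ ψ Z) h x y

/-- `h ⊗ x ⊗ (y ⊗ z)` depends only on `x` and on `(id ⊗ y ⊗ z)`. -/
theorem dmk_id {N Q : LinMod K P} {Y Y' B B' : P} (f : Y ⟶ Y') (g : B ⟶ B') (y : N.obj Y)
    (z : Q.obj B) : dmk (𝟙 (Y' ⊗ B')) (N.act f y) (Q.act g z) =
      (day N Q).act (f ⊗ₘ g) (dmk (𝟙 (Y ⊗ B)) y z) := by
  rw [dmk_act, act_dmk, Category.comp_id, Category.id_comp]

theorem dmk_eq_act {N Q : LinMod K P} {Y B Z : P} (k : Y ⊗ B ⟶ Z) (y : N.obj Y)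
    (z : Q.obj B) : dmk k y z = (day N Q).act k (dmk (𝟙 (Y ⊗ B)) y z) := by
  rw [act_dmk, Category.id_comp]

variable [MonoidalPreadditive P] [MonoidalLinear K P]

/-- The balanced family defining `assocInner`. -/
def assocInnerAux (M N Q : LinMod K P) {A B Z : P} (h : A ⊗ B ⟶ Z) (z : Q.obj B) :
    DayBalanced M N A ((day M (day N Q)).obj Z) where
  toFun {X Y} g x y := dmk ((α_ X Y B).inv ≫ g ▷ B ≫ h) x (dmk (𝟙 (Y ⊗ B)) y z)
  add_hom g g' x y := by
    rw [MonoidalPreadditive.add_whiskerRight, Preadditive.add_comp, Preadditive.comp_add,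
      dmk_add_hom]
  smul_hom a g x y := by
    rw [MonoidalLinear.smul_whiskerRight, Linear.smul_comp, Linear.comp_smul, dmk_smul_hom]
  add_left g x x' y := dmk_add_left _ _ _ _
  smul_left a g x y := dmk_smul_left _ _ _ _
  add_right g x y y' := by rw [dmk_add_left, dmk_add_right]
  smul_right a g x y := by rw [dmk_smul_left, dmk_smul_right]
  balanced {X Y X' Y'} f k g x y := by
    have := dmk_id k (𝟙 B) y z
    rw [act_id] at this
    rw [this, dmk_act]
    congr 1
    simp [MonoidalCategory.tensorHom_def]

/-- The inner part of the associator: for fixed `h` and `z`, the map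
`g ⊗ x ⊗ y ↦ h (g ⊗ id) ⊗ x ⊗ (id ⊗ y ⊗ z)`. -/
def assocInner (M N Q : LinMod K P) {A B Z : P} (h : A ⊗ B ⟶ Z) (z : Q.obj B) :
    (day M N).obj A →ₗ[K] (day M (day N Q)).obj Z :=
  dlift (assocInnerAux M N Q h z)

theorem assocInner_dmk (M N Q : LinMod K P) {A B Z X Y : P} (h : A ⊗ B ⟶ Z) (z : Q.obj B)
    (g : X ⊗ Y ⟶ A) (x : M.obj X) (y : N.obj Y) :
    assocInner M N Q h z (dmk g x y) =
      dmk ((α_ X Y B).inv ≫ g ▷ B ≫ h) x (dmk (𝟙 (Y ⊗ B)) y z) :=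
  dlift_dmk (assocInnerAux M N Q h z) g x y

/-- The balanced family defining the associator. -/
def assocAux (M N Q : LinMod K P) (Z : P) :
    DayBalanced (day M N) Q Z ((day M (day N Q)).obj Z) where
  toFun {A B} h t z := assocInner M N Q h z t
  add_hom h h' t z := by
    rw [← LinearMap.add_apply]
    refine LinearMap.congr_fun (dlinear_ext fun X Y g x y => ?_) t
    rw [LinearMap.add_apply, assocInner_dmk, assocInner_dmk, assocInner_dmk,
      Preadditive.comp_add, Preadditive.comp_add, dmk_add_hom]
  smul_hom a h t z := by
    rw [← LinearMap.smul_apply]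
    refine LinearMap.congr_fun (dlinear_ext fun X Y g x y => ?_) t
    rw [LinearMap.smul_apply, assocInner_dmk, assocInner_dmk,
      Linear.comp_smul, Linear.comp_smul, dmk_smul_hom]
  add_left h t t' z := map_add _ _ _
  smul_left a h t z := map_smul _ _ _
  add_right h t z z' := by
    rw [← LinearMap.add_apply]
    refine LinearMap.congr_fun (dlinear_ext fun X Y g x y => ?_) t
    rw [LinearMap.add_apply, assocInner_dmk, assocInner_dmk, assocInner_dmk,
      dmk_add_right, dmk_add_right]
  smul_right a h t z := by
    rw [← LinearMap.smul_apply]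
    refine LinearMap.congr_fun (dlinear_ext fun X Y g x y => ?_) t
    rw [LinearMap.smul_apply, assocInner_dmk, assocInner_dmk, dmk_smul_right, dmk_smul_right]
  balanced {A B A' B'} f k h t z := by
    rw [← LinearMap.comp_apply]
    refine LinearMap.congr_fun (dlinear_ext fun X Y g x y => ?_) t
    rw [LinearMap.comp_apply, act_dmk, assocInner_dmk, assocInner_dmk]
    have := dmk_id (𝟙 Y) k y z
    rw [act_id] at this
    rw [this, dmk_act_right]
    congr 1
    simp only [MonoidalCategory.tensorHom_def, comp_whiskerRight, id_whiskerRight,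
      Category.id_comp, Category.assoc]
    rw [associator_inv_naturality_right_assoc, whisker_exchange_assoc, whisker_exchange_assoc]

/-- The associator, `h ⊗ (g ⊗ x ⊗ y) ⊗ z ↦ h (g ⊗ id) ⊗ x ⊗ (id ⊗ y ⊗ z)`. -/
def assocHom (M N Q : LinMod K P) : day (day M N) Q ⟶ day M (day N Q) :=
  dayHom (assocAux M N Q) (by
    intro A B Z Z' h k t z
    change assocInner M N Q (h ≫ k) z t = (day M (day N Q)).act k (assocInner M N Q h z t)
    rw [← LinearMap.comp_apply]
    refine LinearMap.congr_fun (dlinear_ext fun X Y g x y => ?_) t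
    rw [LinearMap.comp_apply, assocInner_dmk, assocInner_dmk, act_dmk]
    simp only [Category.assoc])

@[simp] theorem assocHom_dmk (M N Q : LinMod K P) {A B Z X Y : P} (h : A ⊗ B ⟶ Z) (z : Q.obj B)
    (g : X ⊗ Y ⟶ A) (x : M.obj X) (y : N.obj Y) :
    ap (assocHom M N Q) Z (dmk h (dmk g x y) z) =
      dmk ((α_ X Y B).inv ≫ g ▷ B ≫ h) x (dmk (𝟙 (Y ⊗ B)) y z) :=
  (dlift_dmk (assocAux M N Q Z) h _ z).trans (assocInner_dmk M N Q h z g x y)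

/-- The balanced family defining `assocInvInner`. -/
def assocInvInnerAux (M N Q : LinMod K P) {A B Z : P} (h : A ⊗ B ⟶ Z) (x : M.obj A) :
    DayBalanced N Q B ((day (day M N) Q).obj Z) where
  toFun {X Y} g y z := dmk ((α_ A X Y).hom ≫ A ◁ g ≫ h) (dmk (𝟙 (A ⊗ X)) x y) z
  add_hom g g' x y := by
    rw [MonoidalPreadditive.whiskerLeft_add, Preadditive.add_comp, Preadditive.comp_add,
      dmk_add_hom]
  smul_hom a g x y := by
    rw [MonoidalLinear.whiskerLeft_smul, Linear.smul_comp, Linear.comp_smul, dmk_smul_hom]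
  add_right g x y y' := dmk_add_right _ _ _ _
  smul_right a g x y := dmk_smul_right _ _ _ _
  add_left g y y' z := by rw [dmk_add_right, dmk_add_left]
  smul_left a g y z := by rw [dmk_smul_right, dmk_smul_left]
  balanced {X Y X' Y'} f k g y z := by
    have := dmk_id (𝟙 A) f x y
    rw [act_id] at this
    rw [this, dmk_act]
    congr 1
    simp [MonoidalCategory.tensorHom_def]

/-- The inner part of the inverse of the associator. -/
def assocInvInner (M N Q : LinMod K P) {A B Z : P} (h : A ⊗ B ⟶ Z) (x : M.obj A) :
    (day N Q).obj B →ₗ[K] (day (day M N) Q).obj Z :=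
  dlift (assocInvInnerAux M N Q h x)

theorem assocInvInner_dmk (M N Q : LinMod K P) {A B Z X Y : P} (h : A ⊗ B ⟶ Z) (x : M.obj A)
    (g : X ⊗ Y ⟶ B) (y : N.obj X) (z : Q.obj Y) :
    assocInvInner M N Q h x (dmk g y z) =
      dmk ((α_ A X Y).hom ≫ A ◁ g ≫ h) (dmk (𝟙 (A ⊗ X)) x y) z :=
  dlift_dmk (assocInvInnerAux M N Q h x) g y z

/-- The balanced family defining the inverse of the associator. -/
def assocInvAux (M N Q : LinMod K P) (Z : P) :
    DayBalanced M (day N Q) Z ((day (day M N) Q).obj Z) where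
  toFun {A B} h x t := assocInvInner M N Q h x t
  add_hom h h' x t := by
    rw [← LinearMap.add_apply]
    refine LinearMap.congr_fun (dlinear_ext fun X Y g y z => ?_) t
    rw [LinearMap.add_apply, assocInvInner_dmk, assocInvInner_dmk, assocInvInner_dmk,
      Preadditive.comp_add, Preadditive.comp_add, dmk_add_hom]
  smul_hom a h x t := by
    rw [← LinearMap.smul_apply]
    refine LinearMap.congr_fun (dlinear_ext fun X Y g y z => ?_) t
    rw [LinearMap.smul_apply, assocInvInner_dmk, assocInvInner_dmk,
      Linear.comp_smul, Linear.comp_smul, dmk_smul_hom]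
  add_right h x t t' := map_add _ _ _
  smul_right a h x t := map_smul _ _ _
  add_left h x x' t := by
    rw [← LinearMap.add_apply]
    refine LinearMap.congr_fun (dlinear_ext fun X Y g y z => ?_) t
    rw [LinearMap.add_apply, assocInvInner_dmk, assocInvInner_dmk, assocInvInner_dmk,
      dmk_add_left, dmk_add_left]
  smul_left a h x t := by
    rw [← LinearMap.smul_apply]
    refine LinearMap.congr_fun (dlinear_ext fun X Y g y z => ?_) t
    rw [LinearMap.smul_apply, assocInvInner_dmk, assocInvInner_dmk, dmk_smul_left, dmk_smul_left]
  balanced {A B A' B'} f k h x t := by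
    rw [← LinearMap.comp_apply]
    refine LinearMap.congr_fun (dlinear_ext fun X Y g y z => ?_) t
    rw [LinearMap.comp_apply, act_dmk, assocInvInner_dmk, assocInvInner_dmk]
    have := dmk_id f (𝟙 X) x y
    rw [act_id] at this
    rw [this, dmk_act_left]
    congr 1
    simp [MonoidalCategory.tensorHom_def, whisker_exchange_assoc]

/-- The associator isomorphism. -/
def assocIso (M N Q : LinMod K P) : day (day M N) Q ≅ day M (day N Q) :=
  mkIso (assocHom M N Q) (fun Z => dlift (assocInvAux M N Q Z))
    (fun Z => LinearMap.congr_fun (f := (dlift (assocInvAux M N Q Z)).comp (ap (assocHom M N Q) Z))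
      (g := LinearMap.id) (dlinear_ext_left fun A B X Y h g x y z => by
        rw [LinearMap.comp_apply, assocHom_dmk, dlift_dmk]
        change assocInvInner M N Q _ _ _ = dmk h (dmk g x y) z
        rw [assocInvInner_dmk, dmk_eq_act g, dmk_act_left]
        congr 1
        simp))
    (fun Z => LinearMap.congr_fun (f := (ap (assocHom M N Q) Z).comp (dlift (assocInvAux M N Q Z)))
      (g := LinearMap.id) (dlinear_ext_right fun A B X Y h g x y z => by
        rw [LinearMap.comp_apply, dlift_dmk]
        change ap (assocHom M N Q) Z (assocInvInner M N Q _ _ _) = dmk h x (dmk g y z)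
        rw [assocInvInner_dmk, assocHom_dmk, dmk_eq_act g, dmk_act_right]
        congr 1
        simp))

/-- The balanced family defining the left unitor. -/
def leftUnitAux (M : LinMod K P) (Z : P) :
    DayBalanced (corep K (𝟙_ P)) M Z (M.obj Z) where
  toFun {X Y} h g x := M.act ((λ_ Y).inv ≫ toHom g ▷ Y ≫ h) x
  add_hom h h' g x := by simp only [Preadditive.comp_add, act_add]
  smul_hom a h g x := by simp only [Linear.comp_smul, act_smul]
  add_left h g g' x := by
    simp only [map_add, MonoidalPreadditive.add_whiskerRight, Preadditive.add_comp, Preadditive.comp_add,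
      act_add]
  smul_left a h g x := by
    simp only [map_smul, MonoidalLinear.smul_whiskerRight, Linear.smul_comp, Linear.comp_smul, act_smul]
  add_right h g x x' := map_add _ _ _
  smul_right a h g x := map_smul _ _ _
  balanced f k h g x := by
    rw [toHom_act, act_act]
    congr 2
    simp only [MonoidalCategory.tensorHom_def, comp_whiskerRight, Category.assoc]
    rw [leftUnitor_inv_naturality_assoc, whisker_exchange_assoc, whisker_exchange_assoc]

/-- The left unitor, `h ⊗ g ⊗ x ↦ h (g ⊗ id) x`. -/
def leftUnitHom (M : LinMod K P) : day (corep K (𝟙_ P)) M ⟶ M :=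
  dayHom (leftUnitAux M) (by
    intro X Y Z Z' h k g x
    change M.act _ x = M.act k (M.act _ x)
    simp only [act_act, Category.assoc])

@[simp] theorem leftUnitHom_dmk (M : LinMod K P) {X Y Z : P} (h : X ⊗ Y ⟶ Z)
    (g : (corep K (𝟙_ P)).obj X) (x : M.obj Y) :
    ap (leftUnitHom M) Z (dmk h g x) =
      M.act ((λ_ Y).inv ≫ toHom g ▷ Y ≫ h) x :=
  dlift_dmk (leftUnitAux M Z) h g x

/-- The balanced family defining the right unitor. -/
def rightUnitAux (M : LinMod K P) (Z : P) :
    DayBalanced M (corep K (𝟙_ P)) Z (M.obj Z) where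
  toFun {X Y} h x g := M.act ((ρ_ X).inv ≫ X ◁ toHom g ≫ h) x
  add_hom h h' x g := by simp only [Preadditive.comp_add, act_add]
  smul_hom a h x g := by simp only [Linear.comp_smul, act_smul]
  add_right h x g g' := by
    simp only [map_add, MonoidalPreadditive.whiskerLeft_add, Preadditive.add_comp, Preadditive.comp_add,
      act_add]
  smul_right a h x g := by
    simp only [map_smul, MonoidalLinear.whiskerLeft_smul, Linear.smul_comp, Linear.comp_smul, act_smul]
  add_left h x x' g := map_add _ _ _
  smul_left a h x g := map_smul _ _ _
  balanced f k h x g := by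
    rw [toHom_act, act_act]
    congr 2
    simp [MonoidalCategory.tensorHom_def, whisker_exchange_assoc]

/-- The right unitor, `h ⊗ x ⊗ g ↦ h (id ⊗ g) x`. -/
def rightUnitHom (M : LinMod K P) : day M (corep K (𝟙_ P)) ⟶ M :=
  dayHom (rightUnitAux M) (by
    intro X Y Z Z' h k x g
    change M.act _ x = M.act k (M.act _ x)
    simp only [act_act, Category.assoc])

@[simp] theorem rightUnitHom_dmk (M : LinMod K P) {X Y Z : P} (h : X ⊗ Y ⟶ Z)
    (x : M.obj X) (g : (corep K (𝟙_ P)).obj Y) :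
    ap (rightUnitHom M) Z (dmk h x g) =
      M.act ((ρ_ X).inv ≫ X ◁ toHom g ≫ h) x :=
  dlift_dmk (rightUnitAux M Z) h x g

/-- The left unitor isomorphism. -/
def leftUnitIso (M : LinMod K P) : day (corep K (𝟙_ P)) M ≅ M :=
  mkIso (leftUnitHom M) (fun Z => dmkR (λ_ Z).hom (ofHom (K := K) (𝟙 (𝟙_ P))))
    (fun Z => LinearMap.congr_fun
      (f := (dmkR (λ_ Z).hom (ofHom (K := K) (𝟙 (𝟙_ P)))).comp
        (ap (leftUnitHom M) Z)) (g := LinearMap.id) (dlinear_ext fun X Y h g x => by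
        rw [LinearMap.comp_apply, leftUnitHom_dmk, dmkR_apply, LinearMap.id_apply,
          dmk_act_right]
        have hg : g = (corep K (𝟙_ P)).act (toHom g) (ofHom (𝟙 (𝟙_ P))) := by
          rw [act_ofHom, Category.id_comp, ofHom_toHom]
        conv_rhs => rw [hg, dmk_act_left]
        congr 1
        simp))
    (fun Z y => by
      rw [dmkR_apply, leftUnitHom_dmk]
      simp)

/-- The right unitor isomorphism. -/
def rightUnitIso (M : LinMod K P) : day M (corep K (𝟙_ P)) ≅ M :=
  mkIso (rightUnitHom M) (fun Z => dmkL (ρ_ Z).hom (ofHom (K := K) (𝟙 (𝟙_ P))))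
    (fun Z => LinearMap.congr_fun
      (f := (dmkL (ρ_ Z).hom (ofHom (K := K) (𝟙 (𝟙_ P)))).comp
        (ap (rightUnitHom M) Z)) (g := LinearMap.id) (dlinear_ext fun X Y h x g => by
        rw [LinearMap.comp_apply, rightUnitHom_dmk, dmkL_apply, LinearMap.id_apply,
          dmk_act_left]
        have hg : g = (corep K (𝟙_ P)).act (toHom g) (ofHom (𝟙 (𝟙_ P))) := by
          rw [act_ofHom, Category.id_comp, ofHom_toHom]
        conv_rhs => rw [hg, dmk_act_right]
        congr 1
        simp))
    (fun Z y => by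
      rw [dmkL_apply, rightUnitHom_dmk]
      simp)

/-- The monoidal structure given by the Day convolution, with unit `P(I, -)`. -/
instance : MonoidalCategoryStruct (LinMod K P) where
  tensorObj := day
  tensorHom := dayTensor
  whiskerLeft M _ _ ψ := dayTensor (𝟙 M) ψ
  whiskerRight φ N := dayTensor φ (𝟙 N)
  tensorUnit := corep K (𝟙_ P)
  associator := assocIso
  leftUnitor := leftUnitIso
  rightUnitor := rightUnitIso

instance : MonoidalCategory (LinMod K P) :=
  MonoidalCategory.ofTensorHom
    (id_tensorHom_id := fun M N => dhom_ext fun X Y Z k x y => dayTensor_dmk _ _ _ _ _)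
    (id_tensorHom := fun _ _ _ _ => rfl)
    (tensorHom_id := fun _ _ => rfl)
    (tensorHom_comp_tensorHom := fun f₁ f₂ g₁ g₂ => dhom_ext fun X Y Z k x y => by
      change ap (dayTensor g₁ g₂) Z (ap (dayTensor f₁ f₂) Z (dmk k x y)) =
        ap (dayTensor (f₁ ≫ g₁) (f₂ ≫ g₂)) Z (dmk k x y)
      simp)
    (associator_naturality := fun f₁ f₂ f₃ => dhom_ext_left fun A B X Y Z k g x y z => by
      change ap (assocHom _ _ _) Z (ap (dayTensor (dayTensor f₁ f₂) f₃) Z _) =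
        ap (dayTensor f₁ (dayTensor f₂ f₃)) Z (ap (assocHom _ _ _) Z _)
      simp)
    (leftUnitor_naturality := fun f => dhom_ext fun X Y Z k g x => by
      change ap (leftUnitHom _) Z (ap (dayTensor (𝟙 _) f) Z _) = ap f Z (ap (leftUnitHom _) Z _)
      simp [ap_act])
    (rightUnitor_naturality := fun f => dhom_ext fun X Y Z k x g => by
      change ap (rightUnitHom _) Z (ap (dayTensor f (𝟙 _)) Z _) = ap f Z (ap (rightUnitHom _) Z _)
      simp [ap_act])
    (pentagon := fun M₁ M₂ M₃ M₄ => hom_ext fun Z t => by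
      change ap (dayTensor (𝟙 M₁) (assocHom M₂ M₃ M₄)) Z (ap (assocHom M₁ (day M₂ M₃) M₄) Z
        (ap (dayTensor (assocHom M₁ M₂ M₃) (𝟙 M₄)) Z t)) =
        ap (assocHom M₁ M₂ (day M₃ M₄)) Z (ap (assocHom (day M₁ M₂) M₃ M₄) Z t)
      induction t using dinduction with
      | zero => simp only [map_zero]
      | add s t hs ht => simp only [map_add, hs, ht]
      | mk A B h t z =>
      induction t using dinduction with
      | zero => simp only [map_zero, dmk_zero_left]
      | add s t hs ht => simp only [map_add, dmk_add_left, hs, ht]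
      | mk C D g t y =>
      induction t using dinduction with
      | zero => simp only [map_zero, dmk_zero_left]
      | add s t hs ht => simp only [map_add, dmk_add_left, hs, ht]
      | mk E F k w x =>
        simp only [dayTensor_dmk, assocHom_dmk, ap_id]
        rw [dmk_eq_act ((α_ F D B).inv ≫ _), dmk_act_right]
        congr 1
        simp)
    (triangle := fun M N => dhom_ext_left fun A B X Y Z k h x g y => by
      change ap (dayTensor (𝟙 M) (leftUnitHom N)) Z (ap (assocHom M _ N) Z _) =
        ap (dayTensor (rightUnitHom M) (𝟙 N)) Z _
      simp only [dayTensor_dmk, assocHom_dmk, ap_id, leftUnitHom_dmk, rightUnitHom_dmk]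
      rw [dmk_act_left, dmk_act_right]
      congr 1
      simp)

end Monoidal
end LinMod

/-! ### Tensor powers -/

section Powers

universe v w

variable {C : Type w} [Category.{v} C] [MonoidalCategory C]

/-- The `d`-fold tensor power of an object. -/
def tpow (X : C) : ℕ → C
  | 0 => 𝟙_ C
  | d + 1 => tpow X d ⊗ X

/-- The canonical morphism from the product of two tensor powers to a tensor power. -/
def tpowMul (X : C) (i : ℕ) : ∀ j : ℕ, tpow X i ⊗ tpow X j ⟶ tpow X (i + j)
  | 0 => (ρ_ (tpow X i)).hom
  | j + 1 => (α_ (tpow X i) (tpow X j) X).inv ≫ tpowMul X i j ▷ X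

theorem tpowMul_zero_left (X : C) (k : ℕ) :
    tpowMul X 0 k = (λ_ (tpow X k)).hom ≫ eqToHom (congrArg (tpow X) (Nat.zero_add k).symm) := by
  induction k with
  | zero => simpa [tpowMul, tpow] using (unitors_equal (C := C)).symm
  | succ k ih =>
    have h : eqToHom (congrArg (tpow X) (Nat.zero_add (k + 1)).symm) =
        eqToHom (congrArg (tpow X) (Nat.zero_add k).symm) ▷ X := by
      rw [eqToHom_whiskerRight]; rfl
    rw [h, tpowMul, ih]
    change (α_ (𝟙_ C) (tpow X k) X).inv ≫ ((λ_ (tpow X k)).hom ≫ eqToHom _) ▷ X =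
      (λ_ (tpow X k ⊗ X)).hom ≫ eqToHom _ ▷ X
    rw [comp_whiskerRight, ← Category.assoc]
    congr 1
    simp

theorem tpowMul_assoc (X : C) (i j k : ℕ) :
    tpowMul X i j ▷ tpow X k ≫ tpowMul X (i + j) k =
      (α_ _ _ _).hom ≫ tpow X i ◁ tpowMul X j k ≫ tpowMul X i (j + k) ≫
        eqToHom (congrArg (tpow X) (Nat.add_assoc i j k).symm) := by
  induction k with
  | zero => simp [tpowMul, tpow]
  | succ k ih =>
    have h : eqToHom (congrArg (tpow X) (Nat.add_assoc i j (k + 1)).symm) =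
        eqToHom (congrArg (tpow X) (Nat.add_assoc i j k).symm) ▷ X := by
      rw [eqToHom_whiskerRight]; rfl
    have h1 : tpowMul X i (j + (k + 1)) =
      (α_ (tpow X i) (tpow X (j + k)) X).inv ≫ tpowMul X i (j + k) ▷ X := rfl
    rw [h, h1, tpowMul, tpowMul]
    have := congrArg (fun f => f ▷ X) ih
    simp only [comp_whiskerRight] at this
    simp only [tpow, MonoidalCategory.whiskerLeft_comp, Category.assoc]
    rw [associator_inv_naturality_left_assoc, this]
    simp

end Powers

namespace LinMod

section Sum

variable {K : Type u} [CommRing K] {P : Type} [Category.{u} P] [Preadditive P] [Linear K P]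

/-- The direct sum of a sequence of modules. -/
def dsum (M : ℕ → LinMod K P) : LinMod K P where
  functor :=
    { obj Z := ModuleCat.of K (⨁ d, (M d).obj Z)
      map k := ModuleCat.ofHom (DirectSum.lmap fun d => (M d).act k)
      map_id Z := modLinExt fun t => by
        refine DFinsupp.ext fun d => ?_
        exact (M d).act_id Z (t d)
      map_comp k l := modLinExt fun t => by
        refine DFinsupp.ext fun d => ?_
        exact (M d).act_comp k l (t d) }
  additive := ⟨modLinExt fun t => DFinsupp.ext fun d => (M d).act_add _ _ (t d)⟩
  linear := ⟨fun _ a => modLinExt fun t => DFinsupp.ext fun d => (M d).act_smul a _ (t d)⟩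

/-- The inclusion of a summand. -/
def incl (M : ℕ → LinMod K P) (d : ℕ) : M d ⟶ dsum M :=
  mkHom (fun Z => DirectSum.lof K ℕ (fun d => (M d).obj Z) d) fun k x =>
    (DirectSum.lmap_lof (fun d => (M d).act k) d x).symm

/-- The linear map out of a direct sum given by its restrictions to the summands. -/
def dsumLift {M : ℕ → LinMod K P} {Z : P} {W : Type u} [AddCommGroup W] [Module K W]
    (φ : ∀ d, (M d).obj Z →ₗ[K] W) : (dsum M).obj Z →ₗ[K] W :=
  DirectSum.toModule K ℕ W φ

@[simp] theorem dsumLift_incl {M : ℕ → LinMod K P} {Z : P} {W : Type u} [AddCommGroup W]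
    [Module K W] (φ : ∀ d, (M d).obj Z →ₗ[K] W) (d : ℕ) (x : (M d).obj Z) :
    dsumLift φ (ap (incl M d) Z x) = φ d x :=
  DirectSum.toModule_lof K (M := fun d => (M d).obj Z) (φ := φ) d x

theorem dsum_induction {M : ℕ → LinMod K P} {Z : P} {p : (dsum M).obj Z → Prop}
    (t : (dsum M).obj Z) (zero : p 0) (incl : ∀ d x, p (ap (incl M d) Z x))
    (add : ∀ s t, p s → p t → p (s + t)) : p t :=
  DirectSum.induction_on t zero incl add

theorem dsum_linear_ext {M : ℕ → LinMod K P} {Z : P} {W : Type u} [AddCommGroup W] [Module K W]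
    {φ ψ : (dsum M).obj Z →ₗ[K] W}
    (h : ∀ d x, φ (ap (incl M d) Z x) = ψ (ap (incl M d) Z x)) : φ = ψ :=
  LinearMap.ext fun t => by
    induction t using dsum_induction with
    | zero => rw [map_zero, map_zero]
    | incl d x => exact h d x
    | add s t hs ht => rw [map_add, map_add, hs, ht]

theorem dsum_bilin_ext {M N : ℕ → LinMod K P} {X Y : P} {W : Type u} [AddCommGroup W]
    [Module K W] {φ ψ : (dsum M).obj X →ₗ[K] (dsum N).obj Y →ₗ[K] W}
    (h : ∀ i j x y, φ (ap (incl M i) X x) (ap (incl N j) Y y) =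
      ψ (ap (incl M i) X x) (ap (incl N j) Y y)) : φ = ψ :=
  dsum_linear_ext fun i x => dsum_linear_ext fun j y => h i j x y

variable [MonoidalCategory P]

/-- The bilinear map on direct sums, for a fixed `h : X ⊗ Y ⟶ Z`, induced by a family of morphisms
out of the Day convolutions of the summands. -/
def dsumBilin {M N : ℕ → LinMod K P} {Q : LinMod K P} (φ : ∀ i j, day (M i) (N j) ⟶ Q)
    {X Y Z : P} (h : X ⊗ Y ⟶ Z) : (dsum M).obj X →ₗ[K] (dsum N).obj Y →ₗ[K] Q.obj Z :=
  dsumLift fun i => LinearMap.flip (dsumLift fun j =>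
      LinearMap.mk₂ K (fun y x => ap (φ i j) Z (dmk h x y))
        (fun y y' x => by rw [dmk_add_right, map_add])
        (fun a y x => by rw [dmk_smul_right, map_smul])
        (fun y x x' => by rw [dmk_add_left, map_add])
        (fun a y x => by rw [dmk_smul_left, map_smul]))

@[simp] theorem dsumBilin_incl {M N : ℕ → LinMod K P} {Q : LinMod K P}
    (φ : ∀ i j, day (M i) (N j) ⟶ Q) {X Y Z : P} (h : X ⊗ Y ⟶ Z) {i j : ℕ}
    (x : (M i).obj X) (y : (N j).obj Y) :
    dsumBilin φ h (ap (incl M i) X x) (ap (incl N j) Y y) = ap (φ i j) Z (dmk h x y) := by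
  rw [dsumBilin, dsumLift_incl, LinearMap.flip_apply, dsumLift_incl, LinearMap.mk₂_apply]

/-- The balanced family defining `dsumDesc`. -/
def dsumDescAux {M N : ℕ → LinMod K P} {Q : LinMod K P} (φ : ∀ i j, day (M i) (N j) ⟶ Q) (Z : P) :
    DayBalanced (dsum M) (dsum N) Z (Q.obj Z) where
  toFun h x y := dsumBilin φ h x y
  add_hom h h' x y := LinearMap.congr_fun₂ (f := dsumBilin φ (h + h'))
    (g := dsumBilin φ h + dsumBilin φ h') (dsum_bilin_ext fun i j x y => by
      simp only [LinearMap.add_apply, dsumBilin_incl, dmk_add_hom, map_add]) x y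
  smul_hom a h x y := LinearMap.congr_fun₂ (f := dsumBilin φ (a • h))
    (g := a • dsumBilin φ h) (dsum_bilin_ext fun i j x y => by
      simp only [LinearMap.smul_apply, dsumBilin_incl, dmk_smul_hom, map_smul]) x y
  add_left h x x' y := by rw [map_add, LinearMap.add_apply]
  smul_left a h x y := by rw [map_smul, LinearMap.smul_apply]
  add_right h x y y' := map_add _ _ _
  smul_right a h x y := map_smul _ _ _
  balanced f g h x y := LinearMap.congr_fun₂ (f := dsumBilin φ ((f ⊗ₘ g) ≫ h))
    (g := (dsumBilin φ h).compl₁₂ ((dsum M).act f) ((dsum N).act g))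
    (dsum_bilin_ext fun i j x y => by
      rw [LinearMap.compl₁₂_apply, ← ap_act, ← ap_act, dsumBilin_incl, dsumBilin_incl,
        dmk_act]) x y

/-- The morphism out of the Day convolution of two direct sums induced by a family of morphisms
out of the Day convolutions of the summands. -/
def dsumDesc {M N : ℕ → LinMod K P} {Q : LinMod K P} (φ : ∀ i j, day (M i) (N j) ⟶ Q) :
    day (dsum M) (dsum N) ⟶ Q :=
  dayHom (dsumDescAux φ)
    (fun h k x y => LinearMap.congr_fun₂ (f := dsumBilin φ (h ≫ k))
      (g := (dsumBilin φ h).compr₂ (Q.act k)) (dsum_bilin_ext fun i j x y => by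
        rw [LinearMap.compr₂_apply, dsumBilin_incl, dsumBilin_incl, ← ap_act, act_dmk]) x y)

theorem dsumDesc_dmk {M N : ℕ → LinMod K P} {Q : LinMod K P} (φ : ∀ i j, day (M i) (N j) ⟶ Q)
    {X Y Z : P} (h : X ⊗ Y ⟶ Z) {i j : ℕ} (x : (M i).obj X) (y : (N j).obj Y) :
    ap (dsumDesc φ) Z (dmk h (ap (incl M i) X x) (ap (incl N j) Y y)) =
      ap (φ i j) Z (dmk h x y) :=
  (dlift_dmk (dsumDescAux φ Z) h _ _).trans (dsumBilin_incl φ h x y)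

end Sum

/-! ### Algebras for the Day convolution -/

section Algebra

variable {K : Type u} [CommRing K] {P : Type} [Category.{u} P] [Preadditive P] [Linear K P]
  [MonoidalCategory P] [MonoidalPreadditive P] [MonoidalLinear K P]

theorem day_dsum_ext_right {M Q : LinMod K P} {N : ℕ → LinMod K P} {φ ψ : M ⊗ dsum N ⟶ Q}
    (h : ∀ k, (M ◁ incl N k) ≫ φ = (M ◁ incl N k) ≫ ψ) : φ = ψ :=
  dhom_ext (φ := φ) (ψ := ψ) fun X Y Z k x y => LinearMap.congr_fun
    (f := (ap φ Z).comp (dmkR k x)) (g := (ap ψ Z).comp (dmkR k x))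
    (dsum_linear_ext fun d y => by
        have := congrArg (fun f => ap f Z (dmk k x y)) (h d)
        change ap φ Z (ap (dayTensor (𝟙 M) (incl N d)) Z (dmk k x y)) =
          ap ψ Z (ap (dayTensor (𝟙 M) (incl N d)) Z (dmk k x y)) at this
        rw [dayTensor_dmk] at this
        exact this) y

theorem day_dsum_ext_left {N Q : LinMod K P} {M : ℕ → LinMod K P} {φ ψ : dsum M ⊗ N ⟶ Q}
    (h : ∀ k, (incl M k ▷ N) ≫ φ = (incl M k ▷ N) ≫ ψ) : φ = ψ :=
  dhom_ext (φ := φ) (ψ := ψ) fun X Y Z k x y => LinearMap.congr_fun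
    (f := (ap φ Z).comp (dmkL k y)) (g := (ap ψ Z).comp (dmkL k y))
    (dsum_linear_ext fun d x => by
        have := congrArg (fun f => ap f Z (dmk k x y)) (h d)
        change ap φ Z (ap (dayTensor (incl M d) (𝟙 N)) Z (dmk k x y)) =
          ap ψ Z (ap (dayTensor (incl M d) (𝟙 N)) Z (dmk k x y)) at this
        rw [dayTensor_dmk] at this
        exact this) x

theorem day_dsum_ext₃ {L M N : ℕ → LinMod K P} {Q : LinMod K P}
    {φ ψ : (dsum L ⊗ dsum M) ⊗ dsum N ⟶ Q}
    (h : ∀ i j k, ((incl L i ⊗ₘ incl M j) ⊗ₘ incl N k) ≫ φ =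
      ((incl L i ⊗ₘ incl M j) ⊗ₘ incl N k) ≫ ψ) : φ = ψ := by
  refine day_dsum_ext_right fun k => ?_
  refine dhom_ext_left (φ := (dsum L ⊗ dsum M) ◁ incl N k ≫ φ)
    (ψ := (dsum L ⊗ dsum M) ◁ incl N k ≫ ψ)
    fun A B X Y Z l g x y z => ?_
  have e : ∀ χ : (dsum L ⊗ dsum M) ⊗ dsum N ⟶ Q,
      ap ((dsum L ⊗ dsum M) ◁ incl N k ≫ χ) Z (dmk l (dmk g x y) z) =
        ap χ Z (dmk l (dmk g x y) (ap (incl N k) B z)) := fun χ =>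
    congrArg (ap χ Z) (dayTensor_dmk (𝟙 _) (incl N k) l (dmk g x y) z)
  rw [e, e]
  refine LinearMap.congr_fun₂
    (f := LinearMap.mk₂ K (fun x y => ap φ Z (dmk l (dmk g x y) (ap (incl N k) B z)))
      (by intros; rw [dmk_add_left, dmk_add_left, map_add])
      (by intros; rw [dmk_smul_left, dmk_smul_left, map_smul])
      (by intros; rw [dmk_add_right, dmk_add_left, map_add])
      (by intros; rw [dmk_smul_right, dmk_smul_left, map_smul]))
    (g := LinearMap.mk₂ K (fun x y => ap ψ Z (dmk l (dmk g x y) (ap (incl N k) B z)))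
      (by intros; rw [dmk_add_left, dmk_add_left, map_add])
      (by intros; rw [dmk_smul_left, dmk_smul_left, map_smul])
      (by intros; rw [dmk_add_right, dmk_add_left, map_add])
      (by intros; rw [dmk_smul_right, dmk_smul_left, map_smul]))
    (dsum_bilin_ext fun i j x y => ?_) x y
  rw [LinearMap.mk₂_apply, LinearMap.mk₂_apply]
  have := congrArg (fun f => ap f Z (dmk l (dmk g x y) z)) (h i j k)
  change ap φ Z (ap (dayTensor (dayTensor (incl L i) (incl M j)) (incl N k)) Z _) =
    ap ψ Z (ap (dayTensor (dayTensor (incl L i) (incl M j)) (incl N k)) Z _) at this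
  rw [dayTensor_dmk, dayTensor_dmk] at this
  exact this

/-- The underlying module of the tensor algebra on `X`: the direct sum of the tensor powers. -/
def tensorAlgObj (X : LinMod K P) : LinMod K P := dsum (tpow X)

/-- The multiplication of the tensor algebra. -/
def tensorAlgMul (X : LinMod K P) : tensorAlgObj X ⊗ tensorAlgObj X ⟶ tensorAlgObj X :=
  dsumDesc fun i j => tpowMul X i j ≫ incl (tpow X) (i + j)

/-- The inclusion of a tensor power in the tensor algebra. -/
def tincl (X : LinMod K P) (d : ℕ) : tpow X d ⟶ tensorAlgObj X := incl (tpow X) d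

/-- The unit of the tensor algebra. -/
def tone (X : LinMod K P) : 𝟙_ (LinMod K P) ⟶ tensorAlgObj X := incl (tpow X) 0

theorem tincl_mul (X : LinMod K P) (i j : ℕ) :
    (tincl X i ⊗ₘ tincl X j) ≫ tensorAlgMul X = tpowMul X i j ≫ tincl X (i + j) :=
  dhom_ext fun A B Z h x y => by
    change ap (dsumDesc _) Z (ap (dayTensor (incl (tpow X) i) (incl (tpow X) j)) Z _) = _
    rw [dayTensor_dmk]
    exact dsumDesc_dmk _ h x y

theorem eqToHom_tincl (X : LinMod K P) {i j : ℕ} (h : i = j) :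
    eqToHom (congrArg (tpow X) h) ≫ tincl X j = tincl X i := by
  subst h; simp

theorem tone_mul (X : LinMod K P) (k : ℕ) :
    (tone X ⊗ₘ tincl X k) ≫ tensorAlgMul X = (λ_ (tpow X k)).hom ≫ tincl X k := by
  refine (tincl_mul X 0 k).trans ?_
  refine (congrArg (fun f => f ≫ tincl X (0 + k)) (tpowMul_zero_left X k)).trans ?_
  exact (Category.assoc _ _ _).trans
    (congrArg (fun f => (λ_ (tpow X k)).hom ≫ f) (eqToHom_tincl X (Nat.zero_add k).symm))

theorem mul_tone (X : LinMod K P) (k : ℕ) :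
    (tincl X k ⊗ₘ tone X) ≫ tensorAlgMul X = (ρ_ (tpow X k)).hom ≫ tincl X k :=
  tincl_mul X k 0

theorem tincl_mul_left (X : LinMod K P) (i j k : ℕ) :
    ((tincl X i ⊗ₘ tincl X j) ⊗ₘ tincl X k) ≫ tensorAlgMul X ▷ tensorAlgObj X =
      (tpowMul X i j ▷ tpow X k) ≫ (tincl X (i + j) ⊗ₘ tincl X k) := by
  rw [← tensorHom_id, ← tensorHom_id, tensorHom_comp_tensorHom, tensorHom_comp_tensorHom,
    tincl_mul, Category.comp_id, Category.id_comp]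

theorem tincl_mul_right (X : LinMod K P) (i j k : ℕ) :
    (tincl X i ⊗ₘ (tincl X j ⊗ₘ tincl X k)) ≫ tensorAlgObj X ◁ tensorAlgMul X =
      (tpow X i ◁ tpowMul X j k) ≫ (tincl X i ⊗ₘ tincl X (j + k)) := by
  rw [← id_tensorHom, ← id_tensorHom, tensorHom_comp_tensorHom, tensorHom_comp_tensorHom,
    tincl_mul, Category.comp_id, Category.id_comp]

/-- The tensor algebra on `X`, as an algebra for the Day convolution. -/
instance (X : LinMod K P) : MonObj (tensorAlgObj X) where
  one := tone X
  mul := tensorAlgMul X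
  one_mul := day_dsum_ext_right fun k => by
    have h := tone_mul X k
    rw [MonoidalCategory.tensorHom_def', Category.assoc] at h
    exact h.trans (leftUnitor_naturality (tincl X k)).symm
  mul_one := day_dsum_ext_left fun k => by
    have h := mul_tone X k
    rw [MonoidalCategory.tensorHom_def, Category.assoc] at h
    exact h.trans (rightUnitor_naturality (tincl X k)).symm
  mul_assoc := day_dsum_ext₃ fun i j k => by
    have h1 : ((tincl X i ⊗ₘ tincl X j) ⊗ₘ tincl X k) ≫
        tensorAlgMul X ▷ tensorAlgObj X ≫ tensorAlgMul X =
        (tpowMul X i j ▷ tpow X k) ≫ tpowMul X (i + j) k ≫ tincl X (i + j + k) := by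
      rw [← tincl_mul X (i + j) k, ← Category.assoc, tincl_mul_left, Category.assoc]
    have h2 : ((tincl X i ⊗ₘ tincl X j) ⊗ₘ tincl X k) ≫
        (α_ _ _ _).hom ≫ tensorAlgObj X ◁ tensorAlgMul X ≫ tensorAlgMul X =
        (α_ _ _ _).hom ≫ (tpow X i ◁ tpowMul X j k) ≫ tpowMul X i (j + k) ≫
          tincl X (i + (j + k)) := by
      rw [← tincl_mul X i (j + k), associator_naturality_assoc,
        ← Category.assoc (tpow X i ◁ tpowMul X j k), ← tincl_mul_right, Category.assoc]
    refine h1.trans (Eq.trans ?_ h2.symm)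
    rw [← Category.assoc, tpowMul_assoc]
    simp only [Category.assoc]
    rw [eqToHom_tincl X (Nat.add_assoc i j k).symm]

end Algebra

end LinMod

namespace LinMod

/-! ### Restriction of modules -/

section Restriction

variable {K : Type u} [CommRing K] {P Q : Type} [Category.{u} P] [Preadditive P] [Linear K P]
  [Category.{u} Q] [Preadditive Q] [Linear K Q]
  (F : P ⥤ Q) [F.Additive] [F.Linear K]

/-- The restriction of a module along a linear functor `F`. -/
def resObj (M : LinMod K Q) : LinMod K P where
  functor := F ⋙ M.functor

/-- An element of the restriction at `Z` is an element of `M` at `F Z`. -/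
def toRes {M : LinMod K Q} {Z : P} : M.obj (F.obj Z) →ₗ[K] (resObj F M).obj Z := LinearMap.id

/-- An element of the restriction at `Z` is an element of `M` at `F Z`. -/
def ofRes {M : LinMod K Q} {Z : P} : (resObj F M).obj Z →ₗ[K] M.obj (F.obj Z) := LinearMap.id

@[simp] theorem ofRes_toRes {M : LinMod K Q} {Z : P} (x : M.obj (F.obj Z)) :
    ofRes F (toRes F x) = x := rfl

@[simp] theorem toRes_ofRes {M : LinMod K Q} {Z : P} (x : (resObj F M).obj Z) :
    toRes F (ofRes F x) = x := rfl

theorem act_toRes {M : LinMod K Q} {Z Z' : P} (f : Z ⟶ Z') (x : M.obj (F.obj Z)) :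
    (resObj F M).act f (toRes F x) = toRes F (M.act (F.map f) x) := rfl

theorem ofRes_act {M : LinMod K Q} {Z Z' : P} (f : Z ⟶ Z') (x : (resObj F M).obj Z) :
    ofRes F ((resObj F M).act f x) = M.act (F.map f) (ofRes F x) := rfl

/-- The restriction of a morphism of modules. -/
def resMap {M N : LinMod K Q} (φ : M ⟶ N) : resObj F M ⟶ resObj F N :=
  mkHom (fun Z => (toRes F).comp ((ap φ (F.obj Z)).comp (ofRes F)))
    fun f x => by
      simp only [LinearMap.comp_apply, ofRes_act, ap_act, act_toRes]

theorem resMap_ap {M N : LinMod K Q} (φ : M ⟶ N) (Z : P) (x : M.obj (F.obj Z)) :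
    ap (resMap F φ) Z (toRes F x) = toRes F (ap φ (F.obj Z) x) := rfl

/-- The restriction functor along a linear functor `F`. -/
def res : LinMod K Q ⥤ LinMod K P where
  obj M := resObj F M
  map φ := resMap F φ
  map_id _ := hom_ext fun _ _ => rfl
  map_comp _ _ := hom_ext fun _ _ => rfl

variable [MonoidalCategory P] [MonoidalCategory Q] [F.LaxMonoidal]

open Functor.LaxMonoidal

/-- The unit constraint of the restriction functor. -/
def resUnit : corep K (𝟙_ P) ⟶ resObj F (corep K (𝟙_ Q)) :=
  mkHom
    (fun Z =>
      { toFun g := toRes F (ofHom (ε F ≫ F.map (toHom g)))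
        map_add' g g' := by rw [map_add, F.map_add, Preadditive.comp_add, map_add, map_add]
        map_smul' a g := by
          rw [map_smul, F.map_smul, Linear.comp_smul, map_smul, map_smul, RingHom.id_apply] })
    fun f g => by
      change toRes F (ofHom (ε F ≫ F.map (toHom g ≫ f))) = _
      rw [F.map_comp, ← Category.assoc]
      rfl

theorem resUnit_ap {Z : P} (g : (corep K (𝟙_ P)).obj Z) :
    ap (resUnit F) Z g = toRes F (ofHom (ε F ≫ F.map (toHom g))) := rfl

/-- The balanced family defining the tensor constraint of the restriction functor. -/
def resTensorAux (M N : LinMod K Q) (Z : P) :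
    DayBalanced (resObj F M) (resObj F N) Z ((resObj F (day M N)).obj Z) where
  toFun {X Y} h x y := toRes F (dmk (μ F X Y ≫ F.map h) (ofRes F x) (ofRes F y))
  add_hom h h' x y := by rw [F.map_add, Preadditive.comp_add, dmk_add_hom, map_add]
  smul_hom a h x y := by rw [F.map_smul, Linear.comp_smul, dmk_smul_hom, map_smul]
  add_left h x x' y := by rw [map_add, dmk_add_left, map_add]
  smul_left a h x y := by rw [map_smul, dmk_smul_left, map_smul]
  add_right h x y y' := by rw [map_add, dmk_add_right, map_add]
  smul_right a h x y := by rw [map_smul, dmk_smul_right, map_smul]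
  balanced f g h x y := by
    rw [ofRes_act, ofRes_act, dmk_act, F.map_comp, μ_natural_assoc]

/-- The tensor constraint of the restriction functor. -/
def resTensor (M N : LinMod K Q) : day (resObj F M) (resObj F N) ⟶ resObj F (day M N) :=
  dayHom (resTensorAux F M N) (by
    intro X Y Z Z' h k x y
    change toRes F (dmk (μ F X Y ≫ F.map (h ≫ k)) _ _) = (resObj F (day M N)).act k (toRes F _)
    rw [act_toRes, act_dmk, F.map_comp, Category.assoc])

theorem resTensor_dmk (M N : LinMod K Q) {X Y Z : P} (h : X ⊗ Y ⟶ Z) (x : M.obj (F.obj X))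
    (y : N.obj (F.obj Y)) : ap (resTensor F M N) Z (dmk h (toRes F x) (toRes F y)) =
      toRes F (dmk (μ F X Y ≫ F.map h) x y) :=
  dlift_dmk (resTensorAux F M N Z) h (toRes F x) (toRes F y)

variable [MonoidalPreadditive P] [MonoidalLinear K P] [MonoidalPreadditive Q] [MonoidalLinear K Q]

/-- The restriction functor along a lax monoidal functor is lax monoidal for the Day
convolution. -/
instance : (res (K := K) F).LaxMonoidal where
  ε := resUnit F
  μ := resTensor F
  μ_natural_left {M M'} φ N := dhom_ext fun X Y Z h (x : (resObj F M).obj X)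
      (y : (resObj F N).obj Y) => by
    change ap (resTensor F M' N) Z (ap (dayTensor (resMap F φ) (𝟙 (resObj F N))) Z
      (dmk (M := resObj F M) (N := resObj F N) h (toRes F (ofRes F x)) (toRes F (ofRes F y)))) =
      ap (resMap F (dayTensor φ (𝟙 N))) Z (ap (resTensor F M N) Z
        (dmk h (toRes F (ofRes F x)) (toRes F (ofRes F y))))
    rw [dayTensor_dmk, resTensor_dmk, resMap_ap, resMap_ap, dayTensor_dmk, ap_id, ap_id,
      resTensor_dmk]
  μ_natural_right {N N'} M φ := dhom_ext fun X Y Z h (x : (resObj F M).obj X)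
      (y : (resObj F N).obj Y) => by
    change ap (resTensor F M N') Z (ap (dayTensor (𝟙 (resObj F M)) (resMap F φ)) Z
      (dmk (M := resObj F M) (N := resObj F N) h (toRes F (ofRes F x)) (toRes F (ofRes F y)))) =
      ap (resMap F (dayTensor (𝟙 M) φ)) Z (ap (resTensor F M N) Z
        (dmk h (toRes F (ofRes F x)) (toRes F (ofRes F y))))
    rw [dayTensor_dmk, resTensor_dmk, resMap_ap, resMap_ap, dayTensor_dmk, ap_id, ap_id,
      resTensor_dmk]
  associativity L M N := dhom_ext_left fun A B X Y Z k g x y z => by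
    change ap (resMap F (assocHom L M N)) Z (ap (resTensor F (day L M) N) Z
      (ap (dayTensor (resTensor F L M) (𝟙 _)) Z
        (dmk k (dmk g (toRes F (ofRes F x)) (toRes F (ofRes F y))) (toRes F (ofRes F z))))) =
      ap (resTensor F L (day M N)) Z (ap (dayTensor (𝟙 _) (resTensor F M N)) Z
        (ap (assocHom _ _ _) Z
          (dmk k (dmk g (toRes F (ofRes F x)) (toRes F (ofRes F y))) (toRes F (ofRes F z)))))
    rw [dayTensor_dmk, ap_id, resTensor_dmk, resTensor_dmk, resMap_ap, assocHom_dmk,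
      assocHom_dmk, dayTensor_dmk, ap_id, resTensor_dmk, resTensor_dmk,
      dmk_eq_act (μ F Y B ≫ _), dmk_act_right]
    congr 2
    simp
  left_unitality M := dhom_ext fun X Y Z h g x => by
    change ap (leftUnitHom (resObj F M)) Z (dmk h g (toRes F (ofRes F x))) =
      ap (resMap F (leftUnitHom M)) Z (ap (resTensor F _ M) Z
        (ap (dayTensor (resUnit F) (𝟙 _)) Z (dmk h g (toRes F (ofRes F x)))))
    rw [dayTensor_dmk, ap_id, resUnit_ap, resTensor_dmk, resMap_ap, leftUnitHom_dmk,
      leftUnitHom_dmk, act_toRes, toHom_ofHom]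
    congr 2
    simp
  right_unitality M := dhom_ext fun X Y Z h x g => by
    change ap (rightUnitHom (resObj F M)) Z (dmk h (toRes F (ofRes F x)) g) =
      ap (resMap F (rightUnitHom M)) Z (ap (resTensor F M _) Z
        (ap (dayTensor (𝟙 _) (resUnit F)) Z (dmk h (toRes F (ofRes F x)) g)))
    rw [dayTensor_dmk, ap_id, resUnit_ap, resTensor_dmk, resMap_ap, rightUnitHom_dmk,
      rightUnitHom_dmk, act_toRes, toHom_ofHom]
    congr 2
    simp

end Restriction

end LinMod


/-! ### Functors between presented PROPs -/

namespace PresentedPROP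

section Functors

variable {K : Type u} [CommRing K] {G G' : ℕ → ℕ → Type}
  {R : ∀ m n, Term K G m n → Term K G m n → Prop}
  {R' : ∀ m n, Term K G' m n → Term K G' m n → Prop}

theorem rel_map (φ : ∀ m n, G m n → G' m n)
    (hφ : ∀ m n f g, R m n f g → Rel R' (Term.map φ f) (Term.map φ g))
    {m n : ℕ} {f g : Term K G m n} (h : Rel R f g) : Rel R' (Term.map φ f) (Term.map φ g) := by
  induction h with
  | of h => exact hφ _ _ _ _ h
  | symm _ ih => exact ih.symm
  | trans _ _ ih ih' => exact ih.trans ih'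
  | comp_congr _ _ ih ih' => exact Rel.comp_congr ih ih'
  | tens_congr _ _ ih ih' => exact Rel.tens_congr ih ih'
  | add_congr _ _ ih ih' => exact Rel.add_congr ih ih'
  | smul_congr a _ ih => exact Rel.smul_congr a ih
  | tens_assoc => simp only [Term.map, Term.map_ofEq]; apply Rel.tens_assoc
  | id_zero_tens => simp only [Term.map, Term.map_ofEq]; apply Rel.id_zero_tens
  | tens_id_zero => simp only [Term.map, Term.map_ofEq]; apply Rel.tens_id_zero
  | swap_add => simp only [Term.map, Term.map_ofEq]; apply Rel.swap_add
  | refl f => exact Rel.refl _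
  | add_assoc => exact Rel.add_assoc _ _ _
  | add_comm => exact Rel.add_comm _ _
  | zero_add => exact Rel.zero_add _
  | zero_smul => exact Rel.zero_smul _
  | one_smul => exact Rel.one_smul _
  | mul_smul a b => exact Rel.mul_smul a b _
  | add_smul a b => exact Rel.add_smul a b _
  | smul_add a => exact Rel.smul_add a _ _
  | id_comp => exact Rel.id_comp _
  | comp_id => exact Rel.comp_id _
  | assoc => exact Rel.assoc _ _ _
  | add_comp => exact Rel.add_comp _ _ _
  | smul_comp a => exact Rel.smul_comp a _ _
  | comp_add => exact Rel.comp_add _ _ _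
  | comp_smul a => exact Rel.comp_smul a _ _
  | id_tens_id => exact Rel.id_tens_id _ _
  | tens_comp_tens => exact Rel.tens_comp_tens _ _ _ _
  | add_tens => exact Rel.add_tens _ _ _
  | smul_tens a => exact Rel.smul_tens a _ _
  | tens_add => exact Rel.tens_add _ _ _
  | tens_smul a => exact Rel.tens_smul a _ _
  | tens_swap => exact Rel.tens_swap _ _
  | swap_swap => exact Rel.swap_swap _ _

/-- The functor between presented PROPs, identity on objects, given by a map of generators which
respects the relations. -/
def lift (φ : ∀ m n, G m n → G' m n)
    (hφ : ∀ m n f g, R m n f g → Rel R' (Term.map φ f) (Term.map φ g)) :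
    PresentedPROP K G R ⥤ PresentedPROP K G' R' where
  obj X := ob R' X.arity
  map f := Quotient.map (Term.map φ) (fun _ _ h => rel_map φ hφ h) f
  map_comp := by rintro _ _ _ ⟨f⟩ ⟨g⟩; rfl

variable (φ : ∀ m n, G m n → G' m n)
  (hφ : ∀ m n f g, R m n f g → Rel R' (Term.map φ f) (Term.map φ g))

theorem lift_map_cls {m n : ℕ} (f : Term K G m n) :
    (lift φ hφ).map (cls R f) = cls R' (Term.map φ f) := rfl

instance : (lift φ hφ).Additive := ⟨by rintro _ _ ⟨f⟩ ⟨g⟩; rfl⟩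

instance : (lift φ hφ).Linear K := ⟨by rintro _ _ ⟨f⟩ a; rfl⟩

theorem lift_map_eqIso {m n : ℕ} (h : m = n) :
    (lift φ hφ).map (eqIso h : ob R m ≅ ob R n).hom = (eqIso h).hom :=
  congrArg (cls R') (Term.map_ofEq φ h)

/-- The functor `lift` is strict monoidal. -/
def liftCore : (lift φ hφ).CoreMonoidal where
  εIso := Iso.refl _
  μIso _ _ := Iso.refl _
  μIso_hom_natural_left := by
    rintro _ _ ⟨f⟩ Y
    exact (Category.comp_id _).trans (Category.id_comp _).symm
  μIso_hom_natural_right := by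
    rintro _ _ X ⟨f⟩
    exact (Category.comp_id _).trans (Category.id_comp _).symm
  associativity X Y Z := by
    have h : (lift φ hφ).map (α_ X Y Z).hom =
        (α_ ((lift φ hφ).obj X) ((lift φ hφ).obj Y) ((lift φ hφ).obj Z)).hom :=
      lift_map_eqIso φ hφ _
    rw [h, Iso.refl_hom, Iso.refl_hom, Iso.refl_hom, Iso.refl_hom]
    erw [id_whiskerRight, whiskerLeft_id]
    exact (Category.id_comp _).trans ((Category.id_comp _).trans
      (((congrArg _ (Category.id_comp _)).trans (Category.comp_id _)).symm))
  left_unitality X := by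
    have h : (lift φ hφ).map (λ_ X).hom = (λ_ ((lift φ hφ).obj X)).hom := lift_map_eqIso φ hφ _
    rw [h, Iso.refl_hom, Iso.refl_hom]
    erw [id_whiskerRight]
    exact ((Category.id_comp _).trans (Category.id_comp _)).symm
  right_unitality X := by
    have h : (lift φ hφ).map (ρ_ X).hom = (ρ_ ((lift φ hφ).obj X)).hom := lift_map_eqIso φ hφ _
    rw [h, Iso.refl_hom, Iso.refl_hom]
    erw [whiskerLeft_id]
    exact ((Category.id_comp _).trans (Category.id_comp _)).symm

instance : (lift φ hφ).Monoidal := (liftCore φ hφ).toMonoidal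

end Functors

theorem tensHom_mem_homog {K : Type u} [CommRing K] {G : ℕ → ℕ → Type}
    {R : ∀ m n, Term K G m n → Term K G m n → Prop}
    {w : ∀ m n, G m n → ℕ} {d e : ℕ} {X Y X' Y' : PresentedPROP K G R}
    {f : X ⟶ Y} {g : X' ⟶ Y'} (hf : f ∈ homog R w d X Y) (hg : g ∈ homog R w e X' Y') :
    f ⊗ₘ g ∈ homog R w (d + e) (X ⊗ X') (Y ⊗ Y') := by
  induction hf using Submodule.span_induction with
  | mem f hf =>
    obtain ⟨s, hs, rfl⟩ := hf
    induction hg using Submodule.span_induction with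
    | mem g hg =>
      obtain ⟨t, ht, rfl⟩ := hg
      exact Submodule.subset_span ⟨_, hs.tens ht, rfl⟩
    | zero => rw [MonoidalPreadditive.tensor_zero]; exact zero_mem _
    | add _ _ _ _ h h' => rw [MonoidalPreadditive.tensor_add]; exact add_mem h h'
    | smul a g _ h =>
      have e : cls R s ⊗ₘ (a • g) = a • (cls R s ⊗ₘ g) := by
        rw [MonoidalCategory.tensorHom_def, MonoidalCategory.tensorHom_def,
          MonoidalLinear.whiskerLeft_smul, Linear.comp_smul]
      rw [e]; exact Submodule.smul_mem _ a h
  | zero => rw [MonoidalPreadditive.zero_tensor]; exact zero_mem _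
  | add _ _ _ _ h h' => rw [MonoidalPreadditive.add_tensor]; exact add_mem h h'
  | smul a f _ h =>
    have e : (a • f) ⊗ₘ g = a • (f ⊗ₘ g) := by
      rw [MonoidalCategory.tensorHom_def, MonoidalCategory.tensorHom_def,
        MonoidalLinear.smul_whiskerRight, Linear.smul_comp]
    rw [e]; exact Submodule.smul_mem _ a h

theorem cls_mem_homog_zero {K : Type u} [CommRing K] {G : ℕ → ℕ → Type}
    {R : ∀ m n, Term K G m n → Term K G m n → Prop}
    {w : ∀ m n, G m n → ℕ} {H : ℕ → ℕ → Type} (φ : ∀ m n, H m n → G m n)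
    (hw : ∀ m n g, w m n (φ m n g) = 0) {m n : ℕ} (t : Term K H m n) :
    cls R (Term.map φ t) ∈ homog R w 0 (ob R m) (ob R n) := by
  induction t with
  | gen g =>
    refine Submodule.subset_span ⟨_, ?_, rfl⟩
    have h := Term.IsMonomial.gen (K := K) (w := w) (φ _ _ g)
    rwa [hw] at h
  | id n => exact Submodule.subset_span ⟨_, .id n, rfl⟩
  | swap m n => exact Submodule.subset_span ⟨_, .swap m n, rfl⟩
  | @comp m n p f g hf hg =>
    have h := comp_mem_homog (X := ob R m) (Y := ob R n) (Z := ob R p)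
      (f := cls R (Term.map φ f)) (g := cls R (Term.map φ g)) hf hg
    exact h
  | @tens m n m' n' f g hf hg =>
    have h := tensHom_mem_homog (X := ob R m) (Y := ob R n) (X' := ob R m') (Y' := ob R n')
      (f := cls R (Term.map φ f)) (g := cls R (Term.map φ g)) hf hg
    exact h
  | zero m n => exact (homog R w 0 (ob R m) (ob R n)).zero_mem
  | @add m n f g hf hg => exact (homog R w 0 (ob R m) (ob R n)).add_mem hf hg
  | @smul m n a f hf => exact (homog R w 0 (ob R m) (ob R n)).smul_mem a hf

end PresentedPROP


/-! ### Graded algebras, ideals, quadratic algebras -/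

namespace LinMod

section GradedAlgebra

variable {K : Type u} [CommRing K] {P : Type} [Category.{u} P] [Preadditive P] [Linear K P]
  [MonoidalCategory P] [MonoidalPreadditive P] [MonoidalLinear K P]

/-- The product of `x` and `y` along `h : X ⊗ Y ⟶ Z` in an algebra for the Day convolution:
the image of `h ⊗ x ⊗ y` under the multiplication. -/
def mulAlong (A : Mon (LinMod K P)) {X Y Z : P} (h : X ⊗ Y ⟶ Z) (x : A.X.obj X) (y : A.X.obj Y) :
    A.X.obj Z :=
  ap (MonObj.mul (X := A.X)) Z (dmk h x y)

/-- The family `gr` of subspaces is a grading of the algebra `A`. -/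
structure IsGrading (A : Mon (LinMod K P)) (gr : ℕ → ∀ Z : P, Submodule K (A.X.obj Z)) :
    Prop where
  act_mem : ∀ (d : ℕ) {Z Z' : P} (f : Z ⟶ Z'), ∀ x ∈ gr d Z, A.X.act f x ∈ gr d Z'
  isInternal : ∀ Z : P, DirectSum.IsInternal fun d => gr d Z
  one_mem : ∀ (Z : P) (g : (𝟙_ (LinMod K P)).obj Z), ap (MonObj.one (X := A.X)) Z g ∈ gr 0 Z
  mul_mem : ∀ (d e : ℕ) {X Y Z : P} (h : X ⊗ Y ⟶ Z), ∀ x ∈ gr d X, ∀ y ∈ gr e Y,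
    mulAlong A h x y ∈ gr (d + e) Z

/-- The family `I` of subspaces is a two-sided ideal of the algebra `A`. -/
structure IsTwoSidedIdeal (A : Mon (LinMod K P)) (I : ∀ Z : P, Submodule K (A.X.obj Z)) :
    Prop where
  act_mem : ∀ {Z Z' : P} (f : Z ⟶ Z'), ∀ x ∈ I Z, A.X.act f x ∈ I Z'
  mul_mem_left : ∀ {X Y Z : P} (h : X ⊗ Y ⟶ Z) (a : A.X.obj X), ∀ x ∈ I Y,
    mulAlong A h a x ∈ I Z
  mul_mem_right : ∀ {X Y Z : P} (h : X ⊗ Y ⟶ Z), ∀ x ∈ I X, ∀ a : A.X.obj Y,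
    mulAlong A h x a ∈ I Z

/-- The value at `Z` of the two-sided ideal of `A` generated by a set `S` of elements. -/
def idealSpan (A : Mon (LinMod K P)) (S : Set (Σ Z : P, A.X.obj Z)) (Z : P) :
    Submodule K (A.X.obj Z) :=
  sInf {J | ∃ I : ∀ Z : P, Submodule K (A.X.obj Z),
    IsTwoSidedIdeal A I ∧ (∀ s ∈ S, s.2 ∈ I s.1) ∧ J = I Z}

/-- The tensor algebra on a module. -/
def tensorAlg (X : LinMod K P) : Mon (LinMod K P) := ⟨tensorAlgObj X⟩

/-- The inclusion of the `d`-th tensor power in the tensor algebra. -/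
def ofTpow (X : LinMod K P) (d : ℕ) : tpow X d ⟶ (tensorAlg X).X := tincl X d

/-- The inclusion of the generators in the tensor algebra. -/
def ofGen (X : LinMod K P) : X ⟶ (tensorAlg X).X := (λ_ X).inv ≫ ofTpow X 1

/-- The homogeneous part of degree `d` of the tensor algebra. -/
def tensorAlgDeg (X : LinMod K P) (d : ℕ) (Z : P) : Submodule K ((tensorAlg X).X.obj Z) :=
  LinearMap.range (ap (ofTpow X d) Z)

/-- The element `f ⊗ x ⊗ y` of the second tensor power of `X`. -/
def tensorTriple {X : LinMod K P} {A B Z : P} (f : A ⊗ B ⟶ Z) (x : X.obj A) (y : X.obj B) :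
    (tpow X 2).obj Z :=
  dmk (M := tpow X 1) (N := X) f
    (dmk (M := corep K (𝟙_ P)) (N := X) (λ_ A).hom (ofHom (𝟙 (𝟙_ P))) x) y

/-- The algebra `A` is quadratic with space of generators `X`, where `i` is the inclusion of the
generators: the morphism from the tensor algebra on `X` to `A` which extends `i` is surjective, and
its kernel is the two-sided ideal generated by a set of elements of degree `2`. -/
def IsQuadratic (A : Mon (LinMod K P)) {X : LinMod K P} (i : X ⟶ A.X) : Prop :=
  ∃ φ : tensorAlg X ⟶ A, ofGen X ≫ φ.hom = i ∧
    (∀ Z, Function.Surjective (ap φ.hom Z)) ∧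
    ∃ S : Set (Σ Z : P, (tensorAlg X).X.obj Z), (∀ s ∈ S, s.2 ∈ tensorAlgDeg X 2 s.1) ∧
      ∀ Z, LinearMap.ker (ap φ.hom Z) = idealSpan (tensorAlg X) S Z

end GradedAlgebra

end LinMod

/-! ### The PROPs of Lie algebras and of Casimir Lie algebras -/

/-- The generator of the PROP of Lie algebras: the bracket. -/
inductive LieGen : ℕ → ℕ → Type
  | br : LieGen 2 1

/-- The generators of the PROP of Casimir Lie algebras: the bracket and the Casimir element. -/
inductive LieCGen : ℕ → ℕ → Type
  | br : LieCGen 2 1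
  | cas : LieCGen 0 2

/-- The inclusion of the generators. -/
def lieGenIncl : ∀ m n, LieGen m n → LieCGen m n
  | _, _, .br => .br

/-- The weight of a generator: the number of Casimir elements. -/
def casWeight : ∀ m n, LieCGen m n → ℕ
  | _, _, .br => 0
  | _, _, .cas => 1

section Relations

variable (K : Type u) [CommRing K]

/-- The bracket of a Lie algebra. -/
def brLie : Term K LieGen 2 1 := .gen LieGen.br

/-- The bracket of a Casimir Lie algebra. -/
def brLieC : Term K LieCGen 2 1 := .gen LieCGen.br

/-- The Casimir element. -/
def casLieC : Term K LieCGen 0 2 := .gen LieCGen.cas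

/-- The iterated bracket `x ⊗ y ⊗ z ↦ [[x, y], z]`. -/
def brBr : Term K LieGen 3 1 :=
  .comp (.tens (brLie K) (.id 1) : Term K LieGen 3 2) (brLie K)

/-- The cyclic permutation `x ⊗ y ⊗ z ↦ z ⊗ x ⊗ y`. -/
def cyc : Term K LieGen 3 3 := .swap 2 1

/-- The relations of a Lie algebra: antisymmetry and the Jacobi identity. -/
inductive LieRel : ∀ m n, Term K LieGen m n → Term K LieGen m n → Prop
  | antisymm : LieRel 2 1 (.comp (.swap 1 1 : Term K LieGen 2 2) (brLie K)) (.smul (-1) (brLie K))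
  | jacobi : LieRel 3 1
      (.add (brBr K) (.add (.comp (cyc K) (brBr K)) (.comp (cyc K) (.comp (cyc K) (brBr K)))))
      (.zero 3 1)

/-- The relations of a Casimir Lie algebra: those of a Lie algebra, the symmetry of the Casimir
element `c = ∑ a ⊗ b`, and its invariance `∑ [x, a] ⊗ b = ∑ a ⊗ [b, x]`. -/
inductive LieCRel : ∀ m n, Term K LieCGen m n → Term K LieCGen m n → Prop
  | of_lie {m n : ℕ} {f g : Term K LieGen m n} : LieRel K m n f g →
      LieCRel m n (f.map lieGenIncl) (g.map lieGenIncl)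
  | symm : LieCRel 0 2 (.comp (casLieC K) (.swap 1 1 : Term K LieCGen 2 2)) (casLieC K)
  | invariant : LieCRel 1 2
      (.comp (.tens (.id 1) (casLieC K) : Term K LieCGen 1 3)
        (.tens (brLieC K) (.id 1) : Term K LieCGen 3 2))
      (.comp (.tens (casLieC K) (.id 1) : Term K LieCGen 1 3)
        (.tens (.id 1) (brLieC K) : Term K LieCGen 3 2))

/-- The linear PROP freely generated by a Lie algebra. -/
abbrev CatLie : Type := PresentedPROP K LieGen (LieRel K)

/-- The linear PROP freely generated by a Casimir Lie algebra. -/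
abbrev CatLieC : Type := PresentedPROP K LieCGen (LieCRel K)

/-- The canonical functor. -/
def lieIncl : CatLie K ⥤ CatLieC K :=
  PresentedPROP.lift lieGenIncl fun _ _ _ _ h => Rel.of (LieCRel.of_lie h)

instance : (lieIncl K).Additive := inferInstanceAs (PresentedPROP.lift _ _).Additive

instance : (lieIncl K).Linear K := inferInstanceAs ((PresentedPROP.lift _ _).Linear K)

instance : (lieIncl K).Monoidal := inferInstanceAs (PresentedPROP.lift _ _).Monoidal

end Relations

/-! ### The algebra `C` -/

section AlgebraC

open PresentedPROP LinMod

variable (K : Type u) [CommRing K]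

/-- The algebra `C`: the restriction to `CatLie K` of the unit algebra `CatLieC K (0, -)`. -/
def algC : Mon (LinMod K (CatLie K)) :=
  (res (K := K) (lieIncl K)).mapMon.obj (Mon.trivial (LinMod K (CatLieC K)))

/-- A morphism from `0` to `n` in `CatLieC K` is an element of `C` at `n`. -/
def toC {Z : CatLie K} : (𝟙_ (CatLieC K) ⟶ (lieIncl K).obj Z) →ₗ[K] (algC K).X.obj Z :=
  (toRes (M := corep K (𝟙_ (CatLieC K))) (lieIncl K)).comp ofHom

/-- The homogeneous part of degree `d` of `C`, where the degree is the number of copies of the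
Casimir element. -/
def degC (d : ℕ) (Z : CatLie K) : Submodule K ((algC K).X.obj Z) :=
  (homog (LieCRel K) casWeight d (𝟙_ (CatLieC K)) ((lieIncl K).obj Z)).map (toC K)

theorem degC_act {d : ℕ} {Z Z' : CatLie K} (f : Z ⟶ Z') :
    ∀ x ∈ degC K d Z, (algC K).X.act f x ∈ degC K d Z' := by
  rintro _ ⟨g, hg, rfl⟩
  obtain ⟨t, rfl⟩ := exists_cls f
  have h := comp_mem_homog hg (cls_mem_homog_zero (R := LieCRel K) (w := casWeight) lieGenIncl
    (by rintro _ _ ⟨⟩; rfl) t)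
  exact ⟨_, h, rfl⟩

/-- The module of elements of degree `1` of `C`. -/
def modC₁ : LinMod K (CatLie K) := (algC K).X.sub (degC K 1) (degC_act K)

/-- The inclusion of the elements of degree `1` in `C`. -/
def inclC₁ : modC₁ K ⟶ (algC K).X := subIncl (degC K 1) (degC_act K)

/-- The Casimir element, as an element of degree `1` of `C`. -/
def casimir : (modC₁ K).obj (ob (LieRel K) 2) :=
  (⟨toC K (cls (LieCRel K) (casLieC K)),
    ⟨_, Submodule.subset_span ⟨_, .gen LieCGen.cas, rfl⟩, rfl⟩⟩ : degC K 1 (ob (LieRel K) 2))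

/-- The element `f ⊗ c ⊗ c` of the second tensor power of `C₁`. -/
def casCas {n : ℕ} (f : ob (LieRel K) 4 ⟶ ob (LieRel K) n) :
    (tpow (modC₁ K) 2).obj (ob (LieRel K) n) :=
  tensorTriple (A := ob (LieRel K) 2) (B := ob (LieRel K) 2) f (casimir K) (casimir K)

/-- The permutation `(13)(24)` of the four tensor factors. -/
def perm1324 : ob (LieRel K) 4 ⟶ ob (LieRel K) 4 :=
  cls (LieRel K) (.swap 2 2 : Term K LieGen 4 4)

/-- The permutation `(23)` of the four tensor factors. -/
def perm23 : ob (LieRel K) 4 ⟶ ob (LieRel K) 4 :=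
  cls (LieRel K) (.tens (.id 1) (.tens (.swap 1 1) (.id 1)) : Term K LieGen 4 4)

/-- The morphism `[,] ⊗ id₂`. -/
def brId : ob (LieRel K) 4 ⟶ ob (LieRel K) 3 :=
  cls (LieRel K) (.tens (brLie K) (.id 2) : Term K LieGen 4 3)

/-- The morphism `id₁ ⊗ [,] ⊗ id₁`. -/
def idBrId : ob (LieRel K) 4 ⟶ ob (LieRel K) 3 :=
  cls (LieRel K) (.tens (.id 1) (.tens (brLie K) (.id 1)) : Term K LieGen 4 3)

/-- The element `id₄ ⊗ c ⊗ c - P₍₁₃₎₍₂₄₎ ⊗ c ⊗ c`. -/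
def relS : (tpow (modC₁ K) 2).obj (ob (LieRel K) 4) :=
  casCas K (𝟙 (ob (LieRel K) 4)) - casCas K (perm1324 K)

/-- The element `([,] ⊗ id₂) P₍₂₃₎ ⊗ c ⊗ c + (id₁ ⊗ [,] ⊗ id₁) ⊗ c ⊗ c`. -/
def relC : (tpow (modC₁ K) 2).obj (ob (LieRel K) 3) :=
  casCas K (perm23 K ≫ brId K) + casCas K (idBrId K)

/-- The two relations, as elements of the tensor algebra on `C₁`. -/
def relSet : Set (Σ Z : CatLie K, (tensorAlg (modC₁ K)).X.obj Z) :=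
  {⟨ob (LieRel K) 4, ap (ofTpow (modC₁ K) 2) _ (relS K)⟩,
    ⟨ob (LieRel K) 3, ap (ofTpow (modC₁ K) 2) _ (relC K)⟩}

end AlgebraC

end CasimirLie

end

open CasimirLie CasimirLie.LinMod

noncomputable section

namespace CasimirLie

/-! ### Morphisms acting on a block of tensor factors -/

namespace PresentedPROP

variable {K : Type u} [CommRing K] {G : ℕ → ℕ → Type}
  {R : ∀ m n, Term K G m n → Term K G m n → Prop}

/-! Write `T` for the tensor algebra on `C₁`, `I` for the ideal generated by the two relations and
`Q = T / I`. The map `φ` is the one given by the universal property of `T` (`tensorToC`).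

Surjectivity. Since `c` has no inputs, all copies of `c` in a monomial `0 ⟶ n` can be created first:
naturality of the symmetry and the interchange law rewrite it as `c ⊗ ⋯ ⊗ c` followed by a morphism
of the Lie PROP (`exists_casPow_comp_pos`). In degree 1 this says that `C₁` is generated by `c`.
Hence `T` is generated from its unit by the Lie action and by right multiplication by `c`
(`tensorAlgC₁_generated`), an induction principle used throughout.

The relations hold in `C`. For `r_s` this is naturality of the symmetry applied to `c ⊗ c`
(`mulCas_casC_sw`). For `r_c` it is invariance of one copy of `c` against a factor of the other
copy, with a sign from antisymmetry (`mulCas_casC_relation`).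

The kernel is no larger. No basis of `C` is needed; a left inverse of `Q ⟶ C` is obtained by making
the whole Casimir PROP act on `Q`. An element of `Q` at `N` is thought of as having `N` tensor
factors, and an expression `m ⟶ n` acts on each block of `m` consecutive factors (`den`,
`CasimirModule.op`). The bracket and the symmetries act through the Lie module structure; `c` acts
by being appended on the right and then moved into place (`CasimirModule.ins`). To see that
congruent expressions act equally (`IsRep.den_eq`), the axioms of a symmetric strict monoidal
category are reduced to two facts about generators and symmetries: operations on disjoint blocks
commute, and they can be moved past symmetries. The only case of these which is not formal is the
commutation of two insertions of `c`, and that is `r_s`. The Lie relations and the symmetry of `c`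
are inherited from the module.

The invariance relation is the heart of the matter, because `r_c` yields it only against a factor of
another copy of `c`, whereas it is required against every factor of every element. Consider the
elements `x` such that `c` is invariant against each factor of `x` (`CasimirModule.Inv`). The unit
is one of them, having no factors. The property passes through permutations, through brackets by the
Jacobi identity (`Inv.brOp`), and through insertion of `c` by `r_c` (`Inv.ins`). As `Q` is generated
from the unit by these operations, every element has it (`CasimirModule.inv`).

So a morphism `0 ⟶ n` of the Casimir PROP can be applied to the unit of `Q`. This gives linear maps
from `C` to `Q` (`ofCasC`) whose composite with `φ` is the projection of `T` onto `Q`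
(`ofCasC_tensorToC`), and therefore `ker φ` lies in `I`.

Gradings. That of `T` is the direct sum decomposition. For `C`, the defining relations are
homogeneous in `c`, so `c ↦ 2c` induces an endomorphism of each hom-space acting on degree `d` as `2
^ d`; eigenspaces of distinct eigenvalues are independent (`iSupIndep_homog`). -/

theorem eqIso_comp_heq {m n p : ℕ} (h : m = n) (f : ob R n ⟶ ob R p) :
    HEq ((eqIso h).hom ≫ f) f := by
  subst h; rw [eqIso_refl, Iso.refl_hom, Category.id_comp]

theorem comp_eqIso_heq {m n p : ℕ} (h : n = p) (f : ob R m ⟶ ob R n) :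
    HEq (f ≫ (eqIso h).hom) f := by
  subst h; rw [eqIso_refl, Iso.refl_hom, Category.comp_id]

theorem tensHom_heq {m n p q m' n' p' q' : ℕ} {f : ob R m ⟶ ob R n} {g : ob R p ⟶ ob R q}
    {f' : ob R m' ⟶ ob R n'} {g' : ob R p' ⟶ ob R q'} (hm : m = m') (hn : n = n') (hp : p = p')
    (hq : q = q') (hf : HEq f f') (hg : HEq g g') : HEq (f ⊗ₘ g) (f' ⊗ₘ g') := by
  subst hm hn hp hq; rw [eq_of_heq hf, eq_of_heq hg]

/-- Associators and unitors are `eqIso`s, which heterogeneous equality cannot see. This lemma and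
the next ones turn strictness into plain rewriting rules without casts. -/
theorem tensor_assoc_heq {m n m' n' m'' n'' : ℕ} (f : ob R m ⟶ ob R n) (g : ob R m' ⟶ ob R n')
    (h : ob R m'' ⟶ ob R n'') : HEq ((f ⊗ₘ g) ⊗ₘ h) (f ⊗ₘ (g ⊗ₘ h)) := by
  have e : ((f ⊗ₘ g) ⊗ₘ h) ≫ (eqIso (Nat.add_assoc n n' n'')).hom =
      (eqIso (Nat.add_assoc m m' m'')).hom ≫ (f ⊗ₘ (g ⊗ₘ h)) :=
    associator_naturality f g h
  exact (comp_eqIso_heq (R := R) (Nat.add_assoc n n' n'') ((f ⊗ₘ g) ⊗ₘ h)).symm.trans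
    ((heq_of_eq e).trans (eqIso_comp_heq (R := R) (Nat.add_assoc m m' m'') (f ⊗ₘ (g ⊗ₘ h))))

theorem id_tensor_heq {m n : ℕ} (f : ob R m ⟶ ob R n) : HEq (𝟙 (ob R 0) ⊗ₘ f) f := by
  have e : (𝟙 (ob R 0) ⊗ₘ f) ≫ (eqIso (Nat.zero_add n)).hom = (eqIso (Nat.zero_add m)).hom ≫ f :=
    (congrArg (· ≫ (eqIso (Nat.zero_add n)).hom) (id_tensorHom (ob R 0) f)).trans
      (leftUnitor_naturality f)
  exact (comp_eqIso_heq (R := R) (Nat.zero_add n) (𝟙 (ob R 0) ⊗ₘ f)).symm.trans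
    ((heq_of_eq e).trans (eqIso_comp_heq (R := R) (Nat.zero_add m) f))

theorem tensor_id_heq {m n : ℕ} (f : ob R m ⟶ ob R n) : HEq (f ⊗ₘ 𝟙 (ob R 0)) f :=
  heq_of_eq ((Category.comp_id _).symm.trans
    ((congrArg (· ≫ (eqIso (Nat.add_zero n)).hom) (tensorHom_id f (ob R 0))).trans
      ((rightUnitor_naturality f).trans (Category.id_comp _))))

theorem id_tensor_id_heq (m n : ℕ) : HEq (𝟙 (ob R m) ⊗ₘ 𝟙 (ob R n)) (𝟙 (ob R (m + n))) :=
  heq_of_eq (id_tensHom_id _ _)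

/-- The morphism `id_a ⊗ f ⊗ id_b`. -/
def pos (a b : ℕ) {m n : ℕ} (f : ob R m ⟶ ob R n) {N N' : ℕ} (h : N = a + m + b)
    (h' : N' = a + n + b) : ob R N ⟶ ob R N' :=
  (eqIso h).hom ≫ ((𝟙 (ob R a) ⊗ₘ f) ⊗ₘ 𝟙 (ob R b)) ≫ (eqIso h'.symm).hom

theorem pos_heq (a b : ℕ) {m n : ℕ} (f : ob R m ⟶ ob R n) {N N' : ℕ} (h : N = a + m + b)
    (h' : N' = a + n + b) :
    HEq (pos a b f h h') ((𝟙 (ob R a) ⊗ₘ f) ⊗ₘ 𝟙 (ob R b)) :=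
  (eqIso_comp_heq h _).trans (comp_eqIso_heq h'.symm _)

theorem pos_heq' (a b : ℕ) {m n : ℕ} (f : ob R m ⟶ ob R n) {N N' : ℕ} (h : N = a + m + b)
    (h' : N' = a + n + b) :
    HEq (pos a b f h h') (𝟙 (ob R a) ⊗ₘ (f ⊗ₘ 𝟙 (ob R b))) :=
  (pos_heq a b f h h').trans (tensor_assoc_heq _ _ _)

theorem pos_id (a b m : ℕ) {N N' : ℕ} (h : N = a + m + b) (h' : N' = a + m + b) :
    pos a b (𝟙 (ob R m)) h h' = (eqIso (h.trans h'.symm)).hom := by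
  have e : (𝟙 (ob R a) ⊗ₘ 𝟙 (ob R m)) ⊗ₘ 𝟙 (ob R b) = 𝟙 (ob R (a + m + b)) := by
    exact (congrArg (· ⊗ₘ 𝟙 (ob R b)) (id_tensHom_id (ob R a) (ob R m))).trans (id_tensHom_id _ _)
  rw [pos]
  erw [e, Category.id_comp]
  exact eqIso_hom_comp h h'.symm

theorem pos_comp (a b : ℕ) {m n p : ℕ} (f : ob R m ⟶ ob R n) (g : ob R n ⟶ ob R p)
    {N N' N'' : ℕ} (h : N = a + m + b) (h' : N' = a + n + b) (h'' : N'' = a + p + b) :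
    pos a b (f ≫ g) h h'' = pos a b f h h' ≫ pos a b g h' h'' := by
  subst h h' h''
  have e : ∀ (m n : ℕ) (f : ob R m ⟶ ob R n), pos a b f rfl rfl =
      (𝟙 (ob R a) ⊗ₘ f) ⊗ₘ 𝟙 (ob R b) := fun m n f => eq_of_heq (pos_heq a b f rfl rfl)
  rw [e, e, e]
  have e1 := tensorHom_comp_tensorHom (𝟙 (ob R a)) f (𝟙 (ob R a)) g
  have e2 := tensorHom_comp_tensorHom (𝟙 (ob R a) ⊗ₘ f) (𝟙 (ob R b)) (𝟙 (ob R a) ⊗ₘ g)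
    (𝟙 (ob R b))
  rw [e1, Category.id_comp, Category.id_comp] at e2
  exact e2.symm

theorem pos_add (a b : ℕ) {m n : ℕ} (f g : ob R m ⟶ ob R n) {N N' : ℕ} (h : N = a + m + b)
    (h' : N' = a + n + b) : pos a b (f + g) h h' = pos a b f h h' + pos a b g h h' := by
  rw [pos, pos, pos, MonoidalPreadditive.tensor_add, MonoidalPreadditive.add_tensor]
  erw [Preadditive.add_comp, Preadditive.comp_add]

theorem pos_smul (a b : ℕ) {m n : ℕ} (r : K) (f : ob R m ⟶ ob R n) {N N' : ℕ}
    (h : N = a + m + b) (h' : N' = a + n + b) :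
    pos a b (r • f) h h' = r • pos a b f h h' := by
  have e1 : 𝟙 (ob R a) ⊗ₘ (r • f) = r • (𝟙 (ob R a) ⊗ₘ f) := by
    rw [id_tensorHom, id_tensorHom, MonoidalLinear.whiskerLeft_smul]
  have e2 : ((r • (𝟙 (ob R a) ⊗ₘ f)) ⊗ₘ 𝟙 (ob R b)) =
      r • ((𝟙 (ob R a) ⊗ₘ f) ⊗ₘ 𝟙 (ob R b)) := by
    rw [tensorHom_id, tensorHom_id, MonoidalLinear.smul_whiskerRight]
  rw [pos, pos, e1, e2]
  erw [Linear.smul_comp, Linear.comp_smul]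

theorem pos_neg (a b : ℕ) {m n : ℕ} (f : ob R m ⟶ ob R n) {N N' : ℕ}
    (h : N = a + m + b) (h' : N' = a + n + b) :
    pos a b (-f) h h' = -pos a b f h h' := by
  rw [← neg_one_smul K f, pos_smul, neg_one_smul]

theorem pos_zero_zero {m n : ℕ} (f : ob R m ⟶ ob R n) (h : m = 0 + m + 0) (h' : n = 0 + n + 0) :
    pos 0 0 f h h' = f :=
  eq_of_heq ((pos_heq 0 0 f h h').trans ((tensor_id_heq _).trans (id_tensor_heq f)))

/-- A block inside a block is a block: strict associativity merges the paddings, and `id ⊗ id = id`.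
-/
theorem pos_pos (a b c d : ℕ) {m n : ℕ} (f : ob R m ⟶ ob R n) {M M' N N' a' b' : ℕ}
    (g : M = c + m + d) (g' : M' = c + n + d) (h : N = a + M + b) (h' : N' = a + M' + b)
    (ha : a' = a + c) (hb : b' = d + b) (k : N = a' + m + b') (k' : N' = a' + n + b') :
    pos a b (pos c d f g g') h h' = pos a' b' f k k' := by
  subst g g' ha hb
  have e : pos c d f rfl rfl = (𝟙 (ob R c) ⊗ₘ f) ⊗ₘ 𝟙 (ob R d) :=
    eq_of_heq (pos_heq c d f rfl rfl)
  rw [e]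
  refine eq_of_heq ((pos_heq _ _ _ _ _).trans (HEq.trans ?_ (pos_heq _ _ _ _ _).symm))
  have h1 : HEq (𝟙 (ob R a) ⊗ₘ ((𝟙 (ob R c) ⊗ₘ f) ⊗ₘ 𝟙 (ob R d)))
      ((𝟙 (ob R (a + c)) ⊗ₘ f) ⊗ₘ 𝟙 (ob R d)) := by
    refine (tensor_assoc_heq (𝟙 (ob R a)) (𝟙 (ob R c) ⊗ₘ f) (𝟙 (ob R d))).symm.trans ?_
    refine tensHom_heq (Nat.add_assoc a c m).symm (Nat.add_assoc a c n).symm rfl rfl ?_ HEq.rfl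
    refine (tensor_assoc_heq (𝟙 (ob R a)) (𝟙 (ob R c)) f).symm.trans ?_
    exact tensHom_heq rfl rfl rfl rfl (id_tensor_id_heq a c) HEq.rfl
  have h2 : ∀ m : ℕ, a + ((c + m) + d) = a + c + m + d := by omega
  refine (tensHom_heq (h2 m) (h2 n) rfl rfl h1 HEq.rfl).trans ?_
  refine (tensor_assoc_heq _ _ _).trans ?_
  exact tensHom_heq rfl rfl rfl rfl HEq.rfl (id_tensor_id_heq d b)

/-- The left factor is applied first. It turns `m` factors into `n`, so the block of the right
factor then starts at `a + n`. All sizes are free variables subject to equations, so that the lemma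
rewrites at any prescribed arity. -/
theorem pos_tens (a b : ℕ) {m n m' n' : ℕ} (f : ob R m ⟶ ob R n) (g : ob R m' ⟶ ob R n')
    {N N' N'' a' b' : ℕ} (ha : a' = a + n) (hb : b' = m' + b) (h : N = a + (m + m') + b)
    (h' : N' = a + (n + n') + b)
    (k : N = a + m + b') (l : N'' = a + n + b') (l' : N'' = a' + m' + b) (k' : N' = a' + n' + b) :
    pos a b (m := m + m') (n := n + n') (f ⊗ₘ g) h h' = pos a b' f k l ≫ pos a' b g l' k' := by
  have e : f ⊗ₘ g = pos 0 m' f (N := m + m') (N' := n + m') (by omega) (by omega) ≫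
      pos n 0 g (N := n + m') (N' := n + n') (by omega) (by omega) := by
    have e1 : pos 0 m' f (N := m + m') (N' := n + m') (by omega) (by omega) =
        f ⊗ₘ 𝟙 (ob R m') :=
      eq_of_heq ((pos_heq' _ _ _ _ _).trans (id_tensor_heq (f ⊗ₘ 𝟙 (ob R m'))))
    have e2 : pos n 0 g (N := n + m') (N' := n + n') (by omega) (by omega) = 𝟙 (ob R n) ⊗ₘ g :=
      eq_of_heq ((pos_heq _ _ _ _ _).trans (tensor_id_heq (𝟙 (ob R n) ⊗ₘ g)))
    rw [e1, e2]
    have := tensorHom_comp_tensorHom f (𝟙 (ob R m')) (𝟙 (ob R n)) g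
    rw [Category.comp_id, Category.id_comp] at this
    exact this.symm
  rw [e, pos_comp a b _ _ h (N' := N'') (by omega) h']
  congr 1
  · exact pos_pos _ _ _ _ _ _ _ _ _ (by omega) (by omega) _ _
  · exact pos_pos _ _ _ _ _ _ _ _ _ (by omega) (by omega) _ _

/-- With `c` the size of the gap between the two blocks, both sides equal `id_a ⊗ f ⊗ id_c ⊗ g ⊗
id_b`. -/
theorem pos_interchange {a b a₁ a₂ b₁ b₂ m n m' n' N N₁ N₂ N' : ℕ} (f : ob R m ⟶ ob R n)
    (g : ob R m' ⟶ ob R n') (h1 : N = a + m + b₁) (h1' : N₁ = a + n + b₁)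
    (h2 : N₁ = a₂ + m' + b) (h2' : N' = a₂ + n' + b) (k1 : N = a₁ + m' + b)
    (k1' : N₂ = a₁ + n' + b) (k2 : N₂ = a + m + b₂) (k2' : N' = a + n + b₂) (hle : a + m ≤ a₁) :
    pos a b₁ f h1 h1' ≫ pos a₂ b g h2 h2' = pos a₁ b g k1 k1' ≫ pos a b₂ f k2 k2' := by
  obtain ⟨c, rfl⟩ := Nat.exists_eq_add_of_le hle
  obtain rfl : b₁ = (c + m') + b := by omega
  obtain rfl : a₂ = a + n + c := by omega
  obtain rfl : b₂ = (c + n') + b := by omega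
  have e1 := pos_tens (R := R) a b f (pos c 0 g (N := c + m') (N' := c + n') rfl rfl)
    (N := N) (N' := N') (N'' := N₁) rfl rfl (by omega) (by omega) (by omega) (by omega) (by omega)
    (by omega)
  rw [pos_pos _ _ _ _ g _ _ _ _ rfl (by omega) h2 h2'] at e1
  rw [← e1]
  have e2 : f ⊗ₘ pos c 0 g (N := c + m') (N' := c + n') rfl rfl =
      (𝟙 (ob R m) ⊗ₘ pos c 0 g (N := c + m') (N' := c + n') rfl rfl) ≫
        (f ⊗ₘ 𝟙 (ob R (c + n'))) := by
    rw [tensorHom_comp_tensorHom, Category.id_comp, Category.comp_id]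
  have e3 := pos_tens (R := R) a b (𝟙 (ob R m)) (pos c 0 g (N := c + m') (N' := c + n') rfl rfl)
    (N := N) (N' := N₂) (N'' := N) rfl rfl (by omega) (by omega) (by omega) (by omega) (by omega)
    (by omega)
  rw [pos_pos _ _ _ _ g _ _ _ _ rfl (by omega) k1 k1', pos_id, eqIso_refl, Iso.refl_hom,
    Category.id_comp] at e3
  have e4 := pos_tens (R := R) a b f (𝟙 (ob R (c + n')))
    (N := N₂) (N' := N') (N'' := N') rfl rfl (by omega) (by omega) (by omega) (by omega) (by omega)
    (by omega)
  rw [pos_id, eqIso_refl, Iso.refl_hom, Category.comp_id] at e4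
  rw [← e3, ← e4, ← pos_comp]
  exact congrArg (fun t => pos a b t _ _) e2

/-- The symmetry `m + n ⟶ n + m`. -/
def sw (m n : ℕ) : ob R (m + n) ⟶ ob R (n + m) := cls R (Term.swap m n)

theorem sw_sw (m n : ℕ) : (sw m n : ob R (m + n) ⟶ _) ≫ sw n m = 𝟙 _ :=
  cls_eq (Rel.swap_swap m n)

/-- Padding of the naturality square of the symmetry at `f` and `id_k`; tensoring `f` with `id_k`
only moves its block. -/
theorem pos_sw_natural {a b a' b' k m n N N₁ N₂ N' : ℕ} (f : ob R m ⟶ ob R n)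
    (ha : a' = a + k) (hb : b' = k + b) (h1 : N = a + m + b') (h1' : N₁ = a + n + b')
    (h2 : N₁ = a + (n + k) + b) (h2' : N' = a + (k + n) + b) (k1 : N = a + (m + k) + b)
    (k1' : N₂ = a + (k + m) + b) (k2 : N₂ = a' + m + b) (k2' : N' = a' + n + b) :
    pos a b' f h1 h1' ≫ pos a b (sw n k) h2 h2' = pos a b (sw m k) k1 k1' ≫ pos a' b f k2 k2' := by
  have e1 := pos_tens (R := R) a b f (𝟙 (ob R k)) (N := N) (N' := N₁) (N'' := N₁) rfl hb
    (by omega) (by omega) (by omega) (by omega) (by omega) (by omega)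
  rw [pos_id, eqIso_refl, Iso.refl_hom, Category.comp_id] at e1
  have e2 := pos_tens (R := R) a b (𝟙 (ob R k)) f (N := N₂) (N' := N') (N'' := N₂) ha rfl
    (by omega) (by omega) (by omega) (by omega) (by omega) (by omega)
  rw [pos_id, eqIso_refl, Iso.refl_hom, Category.id_comp] at e2
  rw [← e1, ← e2, ← pos_comp, ← pos_comp]
  exact congrArg (fun t => pos a b t _ _) (swapIso_natural f (𝟙 (ob R k)))

/-- The padded hexagon: moving a block past `n + p` factors is moving it past `n` and then past `p`.
-/
theorem pos_sw_add {a b a' b' m n p N N₁ N' : ℕ} (ha : a' = a + n) (hb : b' = p + b)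
    (h : N = a + (m + (n + p)) + b) (h' : N' = a + (n + p + m) + b) (k : N = a + (m + n) + b')
    (k' : N₁ = a + (n + m) + b') (l : N₁ = a' + (m + p) + b) (l' : N' = a' + (p + m) + b) :
    pos a b (sw m (n + p) : ob R (m + (n + p)) ⟶ _) h h' =
      pos a b' (sw m n) k k' ≫ pos a' b (sw m p) l l' := by
  have e : (sw m (n + p) : ob R (m + (n + p)) ⟶ _) =
      (eqIso (Nat.add_assoc m n p).symm).hom ≫ (sw m n ⊗ₘ 𝟙 (ob R p)) ≫
        (eqIso (Nat.add_assoc n m p)).hom ≫ (𝟙 (ob R n) ⊗ₘ sw m p) ≫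
          (eqIso (Nat.add_assoc n p m).symm).hom :=
    cls_eq (Rel.swap_add m n p)
  have e1 : pos 0 p (sw m n : ob R (m + n) ⟶ _) (N := m + (n + p)) (N' := n + m + p) (by omega)
      (by omega) = (eqIso (Nat.add_assoc m n p).symm).hom ≫ (sw m n ⊗ₘ 𝟙 (ob R p)) :=
    eq_of_heq ((pos_heq' _ _ _ _ _).trans ((id_tensor_heq (sw m n ⊗ₘ 𝟙 (ob R p))).trans
      (eqIso_comp_heq (R := R) (Nat.add_assoc m n p).symm (sw m n ⊗ₘ 𝟙 (ob R p))).symm))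
  have e2 : pos n 0 (sw m p : ob R (m + p) ⟶ _) (N := n + m + p) (N' := n + p + m) (by omega)
      (by omega) = (eqIso (Nat.add_assoc n m p)).hom ≫ (𝟙 (ob R n) ⊗ₘ sw m p) ≫
          (eqIso (Nat.add_assoc n p m).symm).hom :=
    eq_of_heq ((pos_heq _ _ _ _ _).trans ((tensor_id_heq (𝟙 (ob R n) ⊗ₘ sw m p)).trans
      ((comp_eqIso_heq (R := R) (Nat.add_assoc n p m).symm (𝟙 (ob R n) ⊗ₘ sw m p)).symm.trans
      (eqIso_comp_heq (R := R) (Nat.add_assoc n m p) ((𝟙 (ob R n) ⊗ₘ sw m p) ≫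
        (eqIso (Nat.add_assoc n p m).symm).hom)).symm)))
  have e3 : (sw m (n + p) : ob R (m + (n + p)) ⟶ _) =
      pos 0 p (sw m n : ob R (m + n) ⟶ _) (N := m + (n + p)) (N' := n + m + p) (by omega)
      (by omega) ≫ pos n 0 (sw m p : ob R (m + p) ⟶ _) (N := n + m + p) (N' := n + p + m) (by omega)
      (by omega) := by
    rw [e1, e2, e, Category.assoc]
  rw [e3, pos_comp a b _ _ h (N' := N₁) (by omega) h']
  congr 1
  · exact pos_pos _ _ _ _ _ _ _ _ _ (by omega) (by omega) _ _
  · exact pos_pos _ _ _ _ _ _ _ _ _ (by omega) (by omega) _ _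

/-- Not among the defining congruences: in any braided category the braiding with the unit is a
composite of unitors, and here these are `eqIso`s. -/
theorem sw_zero_right (m : ℕ) :
    (sw m 0 : ob R (m + 0) ⟶ _) = (eqIso (by omega)).hom := by
  have h := braiding_tensorUnit_right (ob R m)
  exact h.trans ((eqIso_hom_comp _ _))

theorem sw_zero_left (m : ℕ) :
    (sw 0 m : ob R (0 + m) ⟶ _) = (eqIso (by omega)).hom := by
  have h := braiding_tensorUnit_left (ob R m)
  exact h.trans ((eqIso_hom_comp _ _))

theorem pos_eqIso (a b : ℕ) {m n : ℕ} (e : m = n) {N N' : ℕ} (h : N = a + m + b)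
    (h' : N' = a + n + b) : pos a b (eqIso e : ob R m ≅ _).hom h h' =
      (eqIso (by omega)).hom := by
  subst e
  exact pos_id a b m h h'

end PresentedPROP

/-! ### Positional actions of expressions -/

section Representation

variable {K : Type u} [CommRing K] {G : ℕ → ℕ → Type}

section

variable (K) (V : ℕ → Type u) [∀ n, AddCommGroup (V n)] [∀ n, Module K (V n)]

/-- An operation with `m` inputs and `n` outputs on a sequence of modules: it may be applied to
every block of `m` consecutive factors. -/
abbrev Op (m n : ℕ) : Type u :=
  ∀ (a b : ℕ) {N N' : ℕ}, N = a + m + b → N' = a + n + b → V N →ₗ[K] V N'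

/-- The identity, regarded as a map between two equal modules. -/
def castLin {N N' : ℕ} (h : N = N') : V N →ₗ[K] V N' := h ▸ LinearMap.id

end

variable {V : ℕ → Type u} [∀ n, AddCommGroup (V n)] [∀ n, Module K (V n)]

/-- The right padding is determined by the arity and the left padding, so only the latter has to be
compared. -/
theorem Op.congr {m n : ℕ} (U : Op K V m n) {a b a' b' N N' : ℕ} (h : N = a + m + b)
    (h' : N' = a + n + b) (ha : a = a') (k : N = a' + m + b') (k' : N' = a' + n + b')
    (x : V N) : U a b h h' x = U a' b' k k' x := by
  subst ha
  obtain rfl : b = b' := by omega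
  rfl

/-- Two operations commute when applied to disjoint blocks, the first one to the left. -/
def Op.Comm {m n m' n' : ℕ} (U : Op K V m n) (W : Op K V m' n') : Prop :=
  ∀ ⦃a b a₁ a₂ b₁ b₂ N N₁ N₂ N' : ℕ⦄ (h1 : N = a + m + b₁) (h1' : N₁ = a + n + b₁)
    (h2 : N₁ = a₂ + m' + b) (h2' : N' = a₂ + n' + b) (k1 : N = a₁ + m' + b)
    (k1' : N₂ = a₁ + n' + b) (k2 : N₂ = a + m + b₂) (k2' : N' = a + n + b₂) (_ : a + m ≤ a₁)
    (x : V N), W a₂ b h2 h2' (U a b₁ h1 h1' x) = U a b₂ k2 k2' (W a₁ b k1 k1' x)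

/-- The operation can be moved past the symmetries `s`. -/
def Op.SwapNat {m n : ℕ} (s : ∀ m n, Op K V (m + n) (n + m)) (U : Op K V m n) : Prop :=
  ∀ ⦃k a b a' b' N N₁ N₂ N' : ℕ⦄ (_ : a' = a + k) (h1 : N = a + m + b') (h1' : N₁ = a + n + b')
    (h2 : N₁ = a + (n + k) + b) (h2' : N' = a + (k + n) + b) (k1 : N = a + (m + k) + b)
    (k1' : N₂ = a + (k + m) + b) (k2 : N₂ = a' + m + b) (k2' : N' = a' + n + b) (x : V N),
    s n k a b h2 h2' (U a b' h1 h1' x) = U a' b k2 k2' (s m k a b k1 k1' x)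

/-- The operation given by an expression, for given operations of the generators and of the
symmetries. -/
def den (g : ∀ m n, G m n → Op K V m n) (s : ∀ m n, Op K V (m + n) (n + m)) :
    ∀ {m n : ℕ}, Term K G m n → Op K V m n
  | _, _, .gen x => g _ _ x
  | _, _, .id _ => fun _ _ _ _ h h' => castLin K V (h.trans h'.symm)
  | _, _, .comp t t' => fun a b _ _ h h' => (den g s t' a b rfl h').comp (den g s t a b h rfl)
  | _, _, @Term.tens _ _ m n m' n' t t' => fun a b N N' h h' =>
      (den g s t' (a + n) b (N := a + n + (m' + b)) (N' := N') (by omega) (by omega)).comp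
        (den g s t a (m' + b) (N := N) (N' := a + n + (m' + b)) (by omega) rfl)
  | _, _, .swap m n => s m n
  | _, _, .zero _ _ => fun _ _ _ _ _ _ => 0
  | _, _, .add t t' => fun a b _ _ h h' => den g s t a b h h' + den g s t' a b h h'
  | _, _, .smul r t => fun a b _ _ h h' => r • den g s t a b h h'

variable {g : ∀ m n, G m n → Op K V m n} {s : ∀ m n, Op K V (m + n) (n + m)}

/-- The definition of `den` fixes the intermediate arity as a literal sum. Any `N₁` with the right
value is admitted here and in `den_tens`, which makes rewriting possible. -/
theorem den_comp {m n p : ℕ} (t : Term K G m n) (t' : Term K G n p) {a b N N₁ N' : ℕ}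
    (h : N = a + m + b) (k : N₁ = a + n + b) (h' : N' = a + p + b) (x : V N) :
    den g s (.comp t t') a b h h' x = den g s t' a b k h' (den g s t a b h k x) := by
  subst k; rfl

theorem den_tens {m n m' n' : ℕ} (t : Term K G m n) (t' : Term K G m' n')
    {a b a' b' N N₁ N' : ℕ} (ha : a' = a + n) (h : N = a + (m + m') + b)
    (h' : N' = a + (n + n') + b) (k : N = a + m + b') (k' : N₁ = a + n + b')
    (l : N₁ = a' + m' + b) (l' : N' = a' + n' + b) (x : V N) :
    den g s (.tens t t') a b h h' x = den g s t' a' b l l' (den g s t a b' k k' x) := by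
  subst ha
  obtain rfl : b' = m' + b := by omega
  subst k'
  rfl

theorem den_add {m n : ℕ} (t t' : Term K G m n) {a b N N' : ℕ} (h : N = a + m + b)
    (h' : N' = a + n + b) (x : V N) :
    den g s (.add t t') a b h h' x = den g s t a b h h' x + den g s t' a b h h' x := rfl

theorem den_smul {m n : ℕ} (r : K) (t : Term K G m n) {a b N N' : ℕ} (h : N = a + m + b)
    (h' : N' = a + n + b) (x : V N) :
    den g s (.smul r t) a b h h' x = r • den g s t a b h h' x := rfl

theorem den_id {m : ℕ} {a b N : ℕ} (h : N = a + m + b) (h' : N = a + m + b) (x : V N) :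
    den g s (.id m) a b h h' x = x := rfl

theorem den_ofEq {m n : ℕ} (e : m = n) {a b N : ℕ} (h : N = a + m + b) (h' : N = a + n + b)
    (x : V N) : den g s (.ofEq e) a b h h' x = x := by
  subst e; rfl

/-- The operations of the generators and of the symmetries define an action of the free
symmetric strict monoidal category on the generators. -/
structure IsRep (g : ∀ m n, G m n → Op K V m n) (s : ∀ m n, Op K V (m + n) (n + m)) : Prop where
  comm_gen_gen : ∀ {m n m' n' : ℕ} (x : G m n) (y : G m' n'), Op.Comm (g m n x) (g m' n' y)
  comm_gen_swap : ∀ {m n : ℕ} (x : G m n) (p q : ℕ), Op.Comm (g m n x) (s p q)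
  comm_swap_gen : ∀ {m n : ℕ} (x : G m n) (p q : ℕ), Op.Comm (s p q) (g m n x)
  comm_swap_swap : ∀ m n p q : ℕ, Op.Comm (s m n) (s p q)
  swapNat_gen : ∀ {m n : ℕ} (x : G m n), Op.SwapNat s (g m n x)
  swapNat_swap : ∀ m n : ℕ, Op.SwapNat s (s m n)
  swap_swap : ∀ {m n a b N N₁ : ℕ} (h : N = a + (m + n) + b) (h' : N₁ = a + (n + m) + b)
    (x : V N), s n m a b h' h (s m n a b h h' x) = x
  swap_add : ∀ {m n p a b a' b' N N₁ N' : ℕ} (_ : a' = a + n) (h : N = a + (m + (n + p)) + b)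
    (h' : N' = a + (n + p + m) + b) (k : N = a + (m + n) + b') (k' : N₁ = a + (n + m) + b')
    (l : N₁ = a' + (m + p) + b) (l' : N' = a' + (p + m) + b) (x : V N),
    s m (n + p) a b h h' x = s m p a' b l l' (s m n a b' k k' x)

namespace IsRep

/-- Induction on the expression: if all generators and symmetries commute with an operation to their
right, so does everything built from them. -/
theorem comm_of_left {m n m' n' : ℕ} {W : Op K V m' n'}
    (hg : ∀ {m n : ℕ} (y : G m n), Op.Comm (g m n y) W) (hs : ∀ p q, Op.Comm (s p q) W)
    (t : Term K G m n) : Op.Comm (den g s t) W := by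
  induction t with
  | gen x => exact hg x
  | swap p q => exact hs p q
  | id n =>
    intro a b a₁ a₂ b₁ b₂ N N₁ N₂ N' h1 h1' h2 h2' k1 k1' k2 k2' hle x
    obtain rfl : N = N₁ := by omega
    obtain rfl : N' = N₂ := by omega
    exact Op.congr W _ _ (by omega) _ _ _
  | zero m n =>
    intro a b a₁ a₂ b₁ b₂ N N₁ N₂ N' h1 h1' h2 h2' k1 k1' k2 k2' hle x
    exact map_zero (W _ _ _ _)
  | add t t' ih ih' =>
    intro a b a₁ a₂ b₁ b₂ N N₁ N₂ N' h1 h1' h2 h2' k1 k1' k2 k2' hle x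
    rw [den_add, den_add, map_add, ih h1 h1' h2 h2' k1 k1' k2 k2' hle,
      ih' h1 h1' h2 h2' k1 k1' k2 k2' hle]
  | smul r t ih =>
    intro a b a₁ a₂ b₁ b₂ N N₁ N₂ N' h1 h1' h2 h2' k1 k1' k2 k2' hle x
    rw [den_smul, den_smul, map_smul, ih h1 h1' h2 h2' k1 k1' k2 k2' hle]
  | @comp m n p t t' ih ih' =>
    intro a b a₁ a₂ b₁ b₂ N N₁ N₂ N' h1 h1' h2 h2' k1 k1' k2 k2' hle x
    -- Once `t` has acted, the block of `W` starts at `a + n + (a₁ - (a + m))`: the gap between the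
    -- two blocks is unchanged, and `hle` makes the subtraction exact.
    rw [den_comp t t' h1 (N₁ := a + n + b₁) rfl,
      den_comp t t' k2 (N₁ := a + n + b₂) rfl,
      ih' rfl h1' h2 h2' (a₁ := a + n + (a₁ - (a + m))) (N₂ := a + n + b₂) (by omega) (by omega)
        rfl k2' (by omega),
      ih h1 rfl (by omega) (by omega) k1 k1' k2 rfl hle]
  | @tens m n p q t t' ih ih' =>
    intro a b a₁ a₂ b₁ b₂ N N₁ N₂ N' h1 h1' h2 h2' k1 k1' k2 k2' hle x
    rw [den_tens t t' rfl h1 h1' (b' := p + b₁) (N₁ := a + n + (p + b₁)) (by omega) rfl (by omega)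
        (by omega),
      den_tens t t' rfl k2 k2' (b' := p + b₂) (N₁ := a + n + (p + b₂)) (by omega) rfl (by omega)
        (by omega),
      ih' _ (by omega) h2 h2' (a₁ := a + n + (a₁ - (a + m))) (N₂ := a + n + (p + b₂)) (b₂ := b₂)
        (by omega) (by omega) (by omega) (by omega) (by omega),
      ih (a₁ := a₁) (a₂ := a + n + (a₁ - (a + m))) (b₁ := p + b₁) (N₂ := N₂) (b₂ := p + b₂) _ _ _ _
        k1 k1' (by omega) (by omega) (by omega)]

theorem comm_of_right {m n m' n' : ℕ} {W : Op K V m' n'}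
    (hg : ∀ {m n : ℕ} (y : G m n), Op.Comm W (g m n y)) (hs : ∀ p q, Op.Comm W (s p q))
    (t : Term K G m n) : Op.Comm W (den g s t) := by
  induction t with
  | gen x => exact hg x
  | swap p q => exact hs p q
  | id n =>
    intro a b a₁ a₂ b₁ b₂ N N₁ N₂ N' h1 h1' h2 h2' k1 k1' k2 k2' hle x
    obtain rfl : N' = N₁ := by omega
    obtain rfl : N = N₂ := by omega
    exact Op.congr W _ _ (by omega) _ _ _
  | zero m n =>
    intro a b a₁ a₂ b₁ b₂ N N₁ N₂ N' h1 h1' h2 h2' k1 k1' k2 k2' hle x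
    exact (map_zero (W _ _ _ _)).symm
  | add t t' ih ih' =>
    intro a b a₁ a₂ b₁ b₂ N N₁ N₂ N' h1 h1' h2 h2' k1 k1' k2 k2' hle x
    rw [den_add, den_add, map_add, ih h1 h1' h2 h2' k1 k1' k2 k2' hle,
      ih' h1 h1' h2 h2' k1 k1' k2 k2' hle]
  | smul r t ih =>
    intro a b a₁ a₂ b₁ b₂ N N₁ N₂ N' h1 h1' h2 h2' k1 k1' k2 k2' hle x
    rw [den_smul, den_smul, map_smul, ih h1 h1' h2 h2' k1 k1' k2 k2' hle]
  | @comp m n p t t' ih ih' =>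
    intro a b a₁ a₂ b₁ b₂ N N₁ N₂ N' h1 h1' h2 h2' k1 k1' k2 k2' hle x
    -- The right padding of `W` contains the block of the expression, so between `t` and `t'` it is
    -- `b₂ + n - p`, with `n` in place of `p` factors; this subtraction is exact.
    rw [den_comp t t' k1 (N₁ := a₁ + n + b) rfl,
      den_comp t t' h2 (N₁ := a₂ + n + b) rfl,
      ih h1 h1' h2 rfl k1 rfl (b₂ := b₂ + n - p) (by omega) (by omega) (by omega),
      ih' (a₁ := a₁) (N₂ := N₂) (b₂ := b₂) _ _ _ _ rfl k1' k2 k2' (by omega)]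
  | @tens m n p q t t' ih ih' =>
    intro a b a₁ a₂ b₁ b₂ N N₁ N₂ N' h1 h1' h2 h2' k1 k1' k2 k2' hle x
    rw [den_tens t t' rfl k1 k1' (b' := p + b) (N₁ := a₁ + n + (p + b)) (by omega) rfl (by omega)
        (by omega),
      den_tens t t' rfl h2 h2' (b' := p + b) (N₁ := a₂ + n + (p + b)) (by omega) rfl (by omega)
        (by omega),
      ih h1 h1' _ rfl (a₁ := a₁) (N₂ := a₁ + n + (p + b)) _ rfl (b₂ := b₂ + p - q) (by omega)
        (by omega) (by omega),
      ih' (a₁ := a₁ + n) (N₂ := N₂) (b₂ := b₂) _ _ _ _ _ (by omega) k2 k2' (by omega)]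

variable (hr : IsRep g s)
include hr

/-- The interchange law for arbitrary expressions, by one induction in each variable. -/
theorem comm {m n m' n' : ℕ} (t : Term K G m n) (t' : Term K G m' n') :
    Op.Comm (den g s t) (den g s t') :=
  comm_of_left (fun x => comm_of_right (fun y => hr.comm_gen_gen x y) (hr.comm_gen_swap x) t')
    (fun p q => comm_of_right (fun y => hr.comm_swap_gen y p q) (hr.comm_swap_swap p q) t') t

/-- The second hexagon follows from the first one by taking inverses, since the symmetries are
involutive. -/
theorem add_swap {m n p a b a' b' N N₁ N' : ℕ} (ha : a' = a + m) (h : N = a + (m + n + p) + b)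
    (h' : N' = a + (p + (m + n)) + b) (k : N = a' + (n + p) + b) (k' : N₁ = a' + (p + n) + b)
    (l : N₁ = a + (m + p) + b') (l' : N' = a + (p + m) + b') (x : V N) :
    s (m + n) p a b h h' x = s m p a b' l l' (s n p a' b k k' x) := by
  have e : x = s p (m + n) a b h' h (s m p a b' l l' (s n p a' b k k' x)) := by
    rw [hr.swap_add ha h' h l' l k' k, hr.swap_swap, hr.swap_swap]
  conv_lhs => rw [e]
  rw [hr.swap_swap]

/-- Naturality of the symmetries, by induction. For a tensor product the hexagon splits the symmetry
in two, and each factor is moved past its own half. -/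
theorem swapNat {m n : ℕ} (t : Term K G m n) : Op.SwapNat s (den g s t) := by
  induction t with
  | gen x => exact hr.swapNat_gen x
  | swap p q => exact hr.swapNat_swap p q
  | id n =>
    intro k a b a' b' N N₁ N₂ N' ha h1 h1' h2 h2' k1 k1' k2 k2' x
    obtain rfl : N = N₁ := by omega
    obtain rfl : N' = N₂ := by omega
    rfl
  | zero m n =>
    intro k a b a' b' N N₁ N₂ N' ha h1 h1' h2 h2' k1 k1' k2 k2' x
    exact map_zero (s _ _ _ _ _ _)
  | add t t' ih ih' =>
    intro k a b a' b' N N₁ N₂ N' ha h1 h1' h2 h2' k1 k1' k2 k2' x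
    rw [den_add, den_add, map_add, ih ha h1 h1' h2 h2' k1 k1' k2 k2',
      ih' ha h1 h1' h2 h2' k1 k1' k2 k2']
  | smul r t ih =>
    intro k a b a' b' N N₁ N₂ N' ha h1 h1' h2 h2' k1 k1' k2 k2' x
    rw [den_smul, den_smul, map_smul, ih ha h1 h1' h2 h2' k1 k1' k2 k2']
  | @comp m n p t t' ih ih' =>
    intro k a b a' b' N N₁ N₂ N' ha h1 h1' h2 h2' k1 k1' k2 k2' x
    rw [den_comp t t' h1 (N₁ := a + n + b') rfl,
      den_comp t t' k2 (N₁ := a' + n + b) rfl,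
      ih' ha rfl h1' h2 h2' (N₂ := a' + n + b) (by omega) (by omega) rfl k2',
      ih ha h1 rfl _ _ k1 k1' k2 rfl]
  | @tens m n p q t t' ih ih' =>
    intro k a b a' b' N N₁ N₂ N' ha h1 h1' h2 h2' k1 k1' k2 k2' x
    rw [den_tens t t' rfl h1 h1' (b' := p + b') (N₁ := a + n + (p + b')) (by omega) rfl (by omega)
        (by omega),
      den_tens t t' rfl k2 k2' (b' := p + b) (N₁ := a' + n + (p + b)) (by omega) rfl (by omega)
        (by omega),
      hr.add_swap (a' := a + n) (b' := q + b) (N₁ := a + n + k + q + b) rfl _ _ (by omega)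
        (by omega) (by omega) (by omega),
      ih' (a := a + n) (b := b) (a' := a + n + k) (N₂ := a + n + k + p + b) rfl _ _ _ _
        (by omega) (by omega) (by omega) (by omega),
      hr.add_swap (a' := a + m) (b' := p + b) (N₁ := a + m + k + p + b) rfl k1 k1' (by omega)
        (by omega) (by omega) (by omega),
      ← ih (a := a) (b := p + b) (a' := a') (b' := k + (p + b)) (N := a + m + k + p + b)
        (N₁ := a + n + k + p + b) ha (by omega) (by omega) (by omega) (by omega) (by omega)
        (by omega) (by omega) (by omega)]
    -- The two sides now differ only in the order of operations on disjoint blocks: `swap n k` with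
    -- `t'`, and `t` with `swap p k`.
    have c1 := hr.comm (.swap n k) t'
    have e1 := c1 (a := a) (b := b) (a₁ := a + n + k) (a₂ := a' + n)
      (b₁ := p + b) (b₂ := q + b) (N := a + n + k + p + b) (N₁ := a' + n + (p + b))
      (N₂ := a + n + k + q + b) (N' := N') (by omega) (by omega) (by omega) (by omega) (by omega)
      (by omega) (by omega) (by omega) (by omega)
    have c2 := hr.comm t (.swap p k)
    have e2 := c2 (a := a) (b := b) (a₁ := a + m) (a₂ := a + n)
      (b₁ := p + b') (b₂ := k + (p + b)) (N := N) (N₁ := a + n + (p + b'))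
      (N₂ := a + m + k + p + b) (N' := a + n + k + p + b) (by omega) (by omega) (by omega)
      (by omega) (by omega) (by omega) (by omega) (by omega) (by omega) x
    simp only [den] at e1 e2
    rw [e1, e2]

/-- The operations of two congruent expressions agree. -/
theorem den_eq {R : ∀ m n, Term K G m n → Term K G m n → Prop}
    (hR : ∀ (m n : ℕ) (t t' : Term K G m n), R m n t t' → ∀ {a b N N' : ℕ} (h : N = a + m + b)
      (h' : N' = a + n + b) (x : V N), den g s t a b h h' x = den g s t' a b h h' x)
    {m n : ℕ} {t t' : Term K G m n} (hrel : Rel R t t') {a b N N' : ℕ} (h : N = a + m + b)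
    (h' : N' = a + n + b) (x : V N) : den g s t a b h h' x = den g s t' a b h h' x := by
  induction hrel generalizing a b N N' with
  | of hh => exact hR _ _ _ _ hh h h' x
  | refl => rfl
  | symm _ ih => exact (ih h h' x).symm
  | trans _ _ ih ih' => exact (ih h h' x).trans (ih' h h' x)
  | comp_congr _ _ ih ih' =>
    rw [den_comp _ _ h rfl h', den_comp _ _ h rfl h', ih, ih']
  | @tens_congr m n m' n' _ _ _ _ _ _ ih ih' =>
    rw [den_tens _ _ rfl h h' (b' := m' + b) (N₁ := a + n + (m' + b)) (by omega) rfl (by omega)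
        (by omega),
      den_tens _ _ rfl h h' (b' := m' + b) (N₁ := a + n + (m' + b)) (by omega) rfl (by omega)
        (by omega), ih, ih']
  | add_congr _ _ ih ih' => rw [den_add, den_add, ih, ih']
  | smul_congr r _ ih => rw [den_smul, den_smul, ih]
  | add_assoc => simp only [den_add]; rw [_root_.add_assoc]
  | add_comm => simp only [den_add]; rw [_root_.add_comm]
  | zero_add => exact _root_.zero_add _
  | zero_smul => exact _root_.zero_smul K _
  | one_smul => exact _root_.one_smul K _
  | mul_smul => exact SemigroupAction.mul_smul _ _ _
  | add_smul => exact _root_.add_smul _ _ _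
  | smul_add => exact _root_.smul_add _ _ _
  | id_comp => rw [den_comp _ _ h h h', den_id]
  | comp_id => rw [den_comp _ _ h h' h', den_id]
  | assoc => rfl
  | add_comp => exact map_add (den g s _ a b rfl h') _ _
  | smul_comp => exact map_smul (den g s _ a b rfl h') _ _
  | comp_add => rfl
  | comp_smul => rfl
  | id_tens_id m n =>
    obtain rfl : N = N' := by omega
    rw [den_tens _ _ rfl h h' (b' := n + b) (N₁ := N) (by omega) (by omega) (by omega) (by omega)]
    rfl
  | @tens_comp_tens m n p m' n' p' f f' t t' =>
    rw [den_comp _ _ h (N₁ := a + (n + n') + b) rfl h',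
      den_tens (b' := m' + b) (N₁ := a + n + (m' + b)) f t rfl h rfl (by omega) rfl (by omega)
        (by omega),
      den_tens (b' := n' + b) (N₁ := a + p + (n' + b)) f' t' rfl rfl h' (by omega) rfl (by omega)
        (by omega),
      den_tens (b' := m' + b) (N₁ := a + p + (m' + b)) _ _ rfl h h' (by omega) rfl (by omega)
        (by omega),
      den_comp f f' _ (N₁ := a + n + (m' + b)) (by omega),
      den_comp t t' _ (N₁ := a + p + (n' + b)) (by omega)]
    -- The middle-four interchange: `f'` and `t` sit on disjoint blocks.
    have e := hr.comm f' t
    exact congrArg _ (e _ _ _ _ _ _ _ _ (by omega) _).symm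
  | @add_tens m n m' n' f f' t =>
    exact map_add (den g s t (a + n) b (N := a + n + (m' + b)) (by omega) (by omega)) _ _
  | @smul_tens m n m' n' r f t =>
    exact map_smul (den g s t (a + n) b (N := a + n + (m' + b)) (by omega) (by omega)) r _
  | tens_add => rfl
  | tens_smul => rfl
  | @tens_assoc m n m' n' m'' n'' f t t' =>
    rw [den_comp _ _ h (N₁ := N') (by omega) h', den_comp _ _ h (N₁ := N) (by omega) h',
      den_ofEq, den_ofEq,
      den_tens _ _ rfl _ _ (b' := m'' + b) (N₁ := a + n + n' + m'' + b) (by omega) (by omega)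
        (by omega) (by omega),
      den_tens _ _ rfl _ _ (b' := m' + m'' + b) (N₁ := a + n + m' + m'' + b) (by omega) (by omega)
        (by omega) (by omega),
      den_tens _ _ rfl _ _ (b' := m' + m'' + b) (N₁ := a + n + m' + m'' + b) (by omega) (by omega)
        (by omega) (by omega),
      den_tens _ _ rfl _ _ (b' := m'' + b) (N₁ := a + n + n' + m'' + b) (by omega) (by omega)
        (by omega) (by omega)]
    exact Op.congr (den g s t') _ _ (by omega) _ _ _
  | id_zero_tens f =>
    rw [den_comp _ _ h (N₁ := N') (by omega) h', den_comp _ _ h (N₁ := N) (by omega) h',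
      den_ofEq, den_ofEq,
      den_tens _ _ rfl _ _ (N₁ := N) (b' := N - a) (by omega) (by omega) (by omega) (by omega)]
    exact Op.congr (den g s f) _ _ (by omega) _ _ _
  | tens_id_zero f =>
    rw [den_comp _ _ h (N₁ := N') (by omega) h', den_comp _ _ h (N₁ := N) (by omega) h',
      den_ofEq, den_ofEq,
      den_tens _ _ rfl _ _ (N₁ := N') (b' := b) (by omega) (by omega) (by omega) (by omega)]
    rfl
  | @tens_swap m n m' n' f t =>
    rw [den_comp _ _ h (N₁ := a + (n + n') + b) rfl h',
      den_comp _ _ h (N₁ := a + (m' + m) + b) (by omega) h',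
      den_tens (b' := m' + b) (N₁ := a + n + (m' + b)) f t rfl h rfl (by omega) rfl (by omega)
        (by omega),
      den_tens (b' := m + b) (N₁ := a + n' + (m + b)) t f rfl _ h' (by omega) rfl (by omega)
        (by omega)]
    -- `SwapNat` moves only the left member of a pair. For `f` it applies directly; for `t` it is
    -- applied after the inverse symmetry, which is then cancelled by `swap_swap`.
    have ce1 := hr.swapNat t
    have e1 := ce1 (k := n) (a := a) (b := b) (a' := a + n) (b' := n + b)
      (N := a + m' + n + b) (N₁ := a + (n' + n) + b) (N₂ := a + n + (m' + b))
      (N' := a + (n + n') + b) rfl (by omega) (by omega) (by omega) (by omega) (by omega)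
      (by omega) (by omega) (by omega)
      (s n m' a b (by omega) (by omega) (den g s f a (m' + b) (N := N) (N' := a + n + (m' + b))
        (by omega) rfl x))
    rw [hr.swap_swap] at e1
    have ce2 := hr.swapNat f
    have e2 := ce2 (k := m') (a := a) (b := b) (a' := a + m') (b' := m' + b)
      (N := N) (N₁ := a + n + (m' + b)) (N₂ := a + (m' + m) + b)
      (N' := a + m' + n + b) rfl (by omega) (by omega) (by omega) (by omega) (by omega)
      (by omega) (by omega) (by omega) x
    have c3 := hr.comm t f
    have e3 := c3 (a := a) (b := b) (a₁ := a + m') (a₂ := a + n') (b₁ := m + b)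
      (b₂ := n + b) (N := a + (m' + m) + b) (N₁ := a + n' + (m + b)) (N₂ := a + m' + n + b)
      (N' := N') (by omega) (by omega) (by omega) (by omega) (by omega)
      (by omega) (by omega) (by omega) (by omega)
      (s m m' a b (by omega) (by omega) x)
    simp only [den]
    rw [e3, ← e1, ← e2]
    obtain rfl : N' = a + (n' + n) + b := h'
    exact hr.swap_swap (m := n') (n := n) _ _ _
  | swap_swap m n =>
    obtain rfl : N = N' := by omega
    rw [den_comp _ _ h (N₁ := a + (n + m) + b) rfl h']
    exact hr.swap_swap _ _ _
  | swap_add m n p =>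
    have e1 : ∀ (x : V N), den g s (Term.tens (.swap m n) (.id p)) a b (N := N)
        (N' := N) (by omega) (by omega) x = s m n a (p + b) (by omega) (by omega) x := fun x =>
      den_tens _ _ rfl _ _ (N₁ := N) (b' := p + b) (by omega) (by omega) (by omega) (by omega) _
    have e2 : ∀ (x : V N), den g s (Term.tens (.id n) (.swap m p)) a b (N := N)
        (N' := N) (by omega) (by omega) x = s m p (a + n) b (by omega) (by omega) x := fun x =>
      den_tens _ _ rfl _ _ (N₁ := N) (b' := (m + p) + b) (by omega) (by omega) (by omega)
        (by omega) _
    obtain rfl : N = N' := by omega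
    rw [den_comp _ _ h (N₁ := N) (by omega) h', den_comp _ _ _ (N₁ := N) (by omega) h',
      den_comp _ _ _ (N₁ := N) (by omega) h', den_comp _ _ _ (N₁ := N) (by omega) h', den_ofEq,
      den_ofEq, den_ofEq, e1, e2]
    exact hr.swap_add rfl _ _ _ _ _ _ _

end IsRep

end Representation

/-! ### Symmetries acting on blocks: the mirror forms of naturality and of the hexagon -/

namespace PresentedPROP

variable {K : Type u} [CommRing K] {G : ℕ → ℕ → Type}
  {R : ∀ m n, Term K G m n → Term K G m n → Prop}

theorem pos_zero_left (b : ℕ) {m n : ℕ} (f : ob R m ⟶ ob R n) (h : m + b = 0 + m + b)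
    (h' : n + b = 0 + n + b) : pos 0 b f h h' = f ⊗ₘ 𝟙 (ob R b) :=
  eq_of_heq ((pos_heq' _ _ _ _ _).trans (id_tensor_heq (f ⊗ₘ 𝟙 (ob R b))))

theorem pos_zero_right (a : ℕ) {m n : ℕ} (f : ob R m ⟶ ob R n) (h : a + m = a + m + 0)
    (h' : a + n = a + n + 0) : pos a 0 f h h' = 𝟙 (ob R a) ⊗ₘ f :=
  eq_of_heq ((pos_heq _ _ _ _ _).trans (tensor_id_heq (𝟙 (ob R a) ⊗ₘ f)))

theorem pos_sw_sw {a b m n N N' : ℕ} (h : N = a + (m + n) + b) (h' : N' = a + (n + m) + b) :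
    pos a b (sw m n : ob R (m + n) ⟶ _) h h' ≫ pos a b (sw n m) h' h = 𝟙 _ := by
  rw [← pos_comp, sw_sw, pos_id, eqIso_refl, Iso.refl_hom]

/-- Naturality in the other variable: conjugate `pos_sw_natural` by the symmetries, which are
involutive. -/
theorem pos_sw_natural' {a b a' b' k m n N N₁ N₂ N' : ℕ} (f : ob R m ⟶ ob R n)
    (ha : a' = a + k) (hb : b' = k + b) (h1 : N = a' + m + b) (h1' : N₁ = a' + n + b)
    (h2 : N₁ = a + (k + n) + b) (h2' : N' = a + (n + k) + b) (k1 : N = a + (k + m) + b)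
    (k1' : N₂ = a + (m + k) + b) (k2 : N₂ = a + m + b') (k2' : N' = a + n + b') :
    pos a' b f h1 h1' ≫ pos a b (sw k n) h2 h2' = pos a b (sw k m) k1 k1' ≫ pos a b' f k2 k2' := by
  have e := pos_sw_natural f ha hb k2 k2' h2' h2 k1' k1 h1 h1'
  have e2 := congrArg (fun t => pos a b (sw k m : ob R (k + m) ⟶ _) k1 k1' ≫ t ≫
    pos a b (sw k n) h2 h2') e
  simp only [Category.assoc] at e2
  rw [pos_sw_sw h2' h2, Category.comp_id, ← Category.assoc, ← Category.assoc, pos_sw_sw k1 k1',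
    Category.id_comp] at e2
  exact e2.symm

/-- Both sides are inverse to the symmetry which `pos_sw_add` decomposes. -/
theorem pos_add_sw {a b a' b' m n p N N₁ N' : ℕ} (ha : a' = a + m) (hb : b' = n + b)
    (h : N = a + (m + n + p) + b) (h' : N' = a + (p + (m + n)) + b) (k : N = a' + (n + p) + b)
    (k' : N₁ = a' + (p + n) + b) (l : N₁ = a + (m + p) + b') (l' : N' = a + (p + m) + b') :
    pos a b (sw (m + n) p : ob R (m + n + p) ⟶ _) h h' =
      pos a' b (sw n p) k k' ≫ pos a b' (sw m p) l l' := by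
  have e := pos_sw_add (R := R) ha hb h' h l' l k' k
  have e1 : (pos a' b (sw n p : ob R (n + p) ⟶ _) k k' ≫ pos a b' (sw m p) l l') ≫
      pos a b (sw p (m + n)) h' h = 𝟙 _ := by
    rw [e, Category.assoc, ← Category.assoc (pos a b' (sw m p) l l'), pos_sw_sw l l',
      Category.id_comp, pos_sw_sw k k']
  have e2 := congrArg (fun t => t ≫ pos a b (sw (m + n) p : ob R (m + n + p) ⟶ _) h h') e1
  simp only [Category.assoc] at e2
  rw [pos_sw_sw h' h, Category.comp_id, Category.id_comp] at e2
  exact e2.symm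

theorem pos_sw_zero_left {a b p N : ℕ} (h : N = a + (0 + p) + b) (h' : N = a + (p + 0) + b) :
    pos a b (sw 0 p : ob R (0 + p) ⟶ _) h h' = 𝟙 _ := by
  rw [sw_zero_left, pos_eqIso, eqIso_refl, Iso.refl_hom]

end PresentedPROP

/-! ### Identities in the PROP of Lie algebras -/

section LieIdentities

open PresentedPROP

variable (K : Type u) [CommRing K]

/-- The bracket, as a morphism of the PROP of Lie algebras. -/
def lieBr : ob (LieRel K) 2 ⟶ ob (LieRel K) 1 := cls (LieRel K) (brLie K)

theorem sw_lieBr : (sw 1 1 : ob (LieRel K) 2 ⟶ ob (LieRel K) 2) ≫ lieBr K = -lieBr K :=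
  (cls_eq (Rel.of LieRel.antisymm)).trans (neg_one_smul K (lieBr K))

theorem pos_sw_pos_lieBr {a b N N' : ℕ} (h : N = a + 2 + b) (h' : N' = a + 1 + b) :
    pos a b (sw 1 1 : ob (LieRel K) 2 ⟶ ob (LieRel K) 2) h h ≫ pos a b (lieBr K) h h' =
      -pos a b (lieBr K) h h' := by
  rw [← pos_comp, sw_lieBr, pos_neg]

/-- The morphism `x ⊗ y ⊗ z ↦ [[x, y], z]`. -/
def lieBrBr : ob (LieRel K) 3 ⟶ ob (LieRel K) 1 := pos 0 1 (lieBr K) rfl rfl ≫ lieBr K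

/-- The morphism `x ⊗ y ⊗ z ↦ [x, [y, z]]`. -/
def lieBrBr' : ob (LieRel K) 3 ⟶ ob (LieRel K) 1 := pos 1 0 (lieBr K) rfl rfl ≫ lieBr K

/-- The morphism `x ⊗ y ⊗ z ↦ y ⊗ x ⊗ z`. -/
def swFst : ob (LieRel K) 3 ⟶ ob (LieRel K) 3 := pos 0 1 (sw 1 1) rfl rfl

/-- The morphism `x ⊗ y ⊗ z ↦ x ⊗ z ⊗ y`. -/
def swSnd : ob (LieRel K) 3 ⟶ ob (LieRel K) 3 := pos 1 0 (sw 1 1) rfl rfl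

theorem sw_one_two : (sw 1 2 : ob (LieRel K) 3 ⟶ ob (LieRel K) 3) = swFst K ≫ swSnd K := by
  have e := pos_sw_add (R := LieRel K) (a := 0) (b := 0) (m := 1) (n := 1) (p := 1) (N := 3)
    (N' := 3) (N₁ := 3) (a' := 1) (b' := 1) rfl rfl rfl rfl rfl rfl rfl rfl
  rw [pos_zero_zero] at e
  exact e

theorem sw_two_one : (sw 2 1 : ob (LieRel K) 3 ⟶ ob (LieRel K) 3) = swSnd K ≫ swFst K := by
  have e := pos_add_sw (R := LieRel K) (a := 0) (b := 0) (m := 1) (n := 1) (p := 1) (N := 3)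
    (N' := 3) (N₁ := 3) (a' := 1) (b' := 1) rfl rfl rfl rfl rfl rfl rfl rfl
  rw [pos_zero_zero] at e
  exact e

theorem swSnd_swSnd : swSnd K ≫ swSnd K = 𝟙 _ := pos_sw_sw rfl rfl

/-- The braid relation is naturality of the symmetry of `2` and `1` with respect to the
transposition of the two first factors. -/
theorem braid : swFst K ≫ swSnd K ≫ swFst K = swSnd K ≫ swFst K ≫ swSnd K := by
  have e := pos_sw_natural (R := LieRel K) (a := 0) (b := 0) (a' := 1) (b' := 1) (k := 1)
    (N := 3) (N₁ := 3) (N₂ := 3) (N' := 3) (sw 1 1 : ob (LieRel K) 2 ⟶ ob (LieRel K) 2)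
    rfl rfl rfl rfl rfl rfl rfl rfl rfl rfl
  rw [pos_zero_zero] at e
  have e2 := sw_two_one K
  change swFst K ≫ sw 2 1 = sw 2 1 ≫ swSnd K at e
  rwa [e2, Category.assoc] at e

theorem swFst_lieBrBr : swFst K ≫ lieBrBr K = -lieBrBr K := by
  rw [lieBrBr, swFst, ← Category.assoc]
  have e := pos_sw_pos_lieBr K (a := 0) (b := 1) (N := 3) (N' := 2) rfl rfl
  exact (congrArg (· ≫ lieBr K) e).trans (Preadditive.neg_comp _ _)

/-- This is `[x, [y, z]] = -[[y, z], x]`: naturality carries `x` past the inner bracket, then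
antisymmetry gives the sign. -/
theorem lieBrBr'_eq : lieBrBr' K = -(swFst K ≫ swSnd K ≫ lieBrBr K) := by
  have e := pos_sw_natural' (R := LieRel K) (a := 0) (b := 0) (a' := 1) (b' := 1) (k := 1)
    (N := 3) (N₁ := 2) (N₂ := 3) (N' := 2) (lieBr K) rfl rfl rfl rfl rfl rfl rfl rfl rfl rfl
  rw [pos_zero_zero, pos_zero_zero, sw_one_two] at e
  have e2 := congrArg (fun t => t ≫ lieBr K) e
  simp only [Category.assoc] at e2
  rw [sw_lieBr, Preadditive.comp_neg] at e2
  rw [lieBrBr', lieBrBr, ← e2, neg_neg]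

/-- The Jacobi identity with cyclic permutations replaced by transpositions, `[[x, y], z] - [[x, z],
y] + [[y, z], x] = 0`. The square of the cycle is shortened by the braid relation. -/
theorem lie_jacobi : lieBrBr K - swSnd K ≫ lieBrBr K + swFst K ≫ swSnd K ≫ lieBrBr K = 0 := by
  have hb : cls (LieRel K) (brBr K) = lieBrBr K := by
    rw [lieBrBr, pos_zero_left]; rfl
  have h : lieBrBr K + (sw 2 1 ≫ lieBrBr K + sw 2 1 ≫ sw 2 1 ≫ lieBrBr K) = 0 := by
    rw [← hb]
    exact cls_eq (Rel.of LieRel.jacobi)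
  have h2 : swSnd K ≫ swFst K ≫ swSnd K ≫ swFst K ≫ lieBrBr K =
      swFst K ≫ swSnd K ≫ lieBrBr K := by
    have := congrArg (fun t => swSnd K ≫ t ≫ lieBrBr K) (braid K)
    simp only [Category.assoc] at this
    rw [this, ← Category.assoc, swSnd_swSnd, Category.id_comp]
  rw [sw_two_one, Category.assoc, Category.assoc, h2, swFst_lieBrBr, Preadditive.comp_neg] at h
  rw [← h]; abel

/-- The Jacobi identity for the left action, `[[x, y], z] = [x, [y, z]] - [y, [x, z]]`. It is used
on the first leg of `c`. -/
theorem lieBrBr_eq : lieBrBr K = lieBrBr' K - swFst K ≫ lieBrBr' K := by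
  have h : swFst K ≫ swFst K = 𝟙 _ := pos_sw_sw rfl rfl
  rw [lieBrBr'_eq, Preadditive.comp_neg, ← Category.assoc (swFst K) (swFst K), h,
    Category.id_comp]
  have := lie_jacobi K
  rw [sub_neg_eq_add, ← sub_eq_zero, ← this]; abel

/-- The Jacobi identity for the right action, `[[x, y], z] - [[x, z], y] = [x, [y, z]]`. It is used
on the second leg of `c`. -/
theorem lieBrBr_sub : lieBrBr K - swSnd K ≫ lieBrBr K = lieBrBr' K := by
  rw [lieBrBr'_eq, ← sub_eq_zero, ← lie_jacobi K]; abel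

theorem pos_lieBrBr {a b N N₁ N' b' : ℕ} (h : N = a + 3 + b) (h' : N' = a + 1 + b)
    (k : N = a + 2 + b') (k' : N₁ = a + 1 + b') (l : N₁ = a + 2 + b) :
    pos a b (lieBrBr K) h h' = pos a b' (lieBr K) k k' ≫ pos a b (lieBr K) l h' := by
  rw [lieBrBr, pos_comp a b _ _ h l h', pos_pos _ _ _ _ _ _ _ _ _ (by omega) (by omega) k k']

theorem pos_lieBrBr' {a b N N₁ N' a' : ℕ} (ha : a' = a + 1) (h : N = a + 3 + b)
    (h' : N' = a + 1 + b) (k : N = a' + 2 + b) (k' : N₁ = a' + 1 + b) (l : N₁ = a + 2 + b) :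
    pos a b (lieBrBr' K) h h' = pos a' b (lieBr K) k k' ≫ pos a b (lieBr K) l h' := by
  rw [lieBrBr', pos_comp a b _ _ h l h', pos_pos _ _ _ _ _ _ _ _ _ (by omega) (by omega) k k']

theorem perm23_eq : perm23 K = pos 1 1 (sw 1 1) rfl rfl := by
  refine (eq_of_heq ((pos_heq' _ _ _ _ _).trans ?_)).symm
  rfl

theorem brId_eq : brId K = pos 0 2 (lieBr K) rfl rfl := (pos_zero_left 2 (lieBr K) rfl rfl).symm

theorem idBrId_eq : idBrId K = pos 1 1 (lieBr K) rfl rfl := by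
  refine (eq_of_heq ((pos_heq' _ _ _ _ _).trans ?_)).symm
  rfl

end LieIdentities

/-! ### Modules over the PROP of Lie algebras with an action of the Casimir element -/

open PresentedPROP LinMod

section PosOp

variable {K : Type u} [CommRing K] {G : ℕ → ℕ → Type}
  {R : ∀ m n, Term K G m n → Term K G m n → Prop} (A : LinMod K (PresentedPROP K G R))

/-- The value of a module at the object `n`. -/
abbrev val (n : ℕ) : Type u := A.obj (ob R n)

/-- The operation given by the action of a morphism. -/
def posOp {m n : ℕ} (f : ob R m ⟶ ob R n) : Op K (val A) m n :=
  fun a b _ _ h h' => A.act (pos a b f h h')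

theorem posOp_apply {m n : ℕ} (f : ob R m ⟶ ob R n) {a b N N' : ℕ} (h : N = a + m + b)
    (h' : N' = a + n + b) (x : val A N) : posOp A f a b h h' x = A.act (pos a b f h h') x := rfl

theorem posOp_comm {m n m' n' : ℕ} (f : ob R m ⟶ ob R n) (f' : ob R m' ⟶ ob R n') :
    Op.Comm (posOp A f) (posOp A f') := by
  intro a b a₁ a₂ b₁ b₂ N N₁ N₂ N' h1 h1' h2 h2' k1 k1' k2 k2' hle x
  simp only [posOp_apply, act_act]
  rw [pos_interchange f f' h1 h1' h2 h2' k1 k1' k2 k2' hle]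

theorem posOp_swapNat {m n : ℕ} (f : ob R m ⟶ ob R n) :
    Op.SwapNat (fun m n => posOp A (sw m n)) (posOp A f) := by
  intro k a b a' b' N N₁ N₂ N' ha h1 h1' h2 h2' k1 k1' k2 k2' x
  simp only [posOp_apply, act_act]
  rw [pos_sw_natural f ha (by omega) h1 h1' h2 h2' k1 k1' k2 k2']

theorem posOp_comp {m n p : ℕ} (f : ob R m ⟶ ob R n) (f' : ob R n ⟶ ob R p) {a b N N₁ N' : ℕ}
    (h : N = a + m + b) (k : N₁ = a + n + b) (h' : N' = a + p + b) (x : val A N) :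
    posOp A f' a b k h' (posOp A f a b h k x) = posOp A (f ≫ f') a b h h' x := by
  simp only [posOp_apply, act_act]
  rw [← pos_comp]

end PosOp

/-- A module over the PROP of Lie algebras with an operation `x ↦ x ⊗ c`, where `c` is a Casimir
element, and a generator. -/
structure CasimirModule (K : Type u) [CommRing K] where
  /-- the module -/
  A : LinMod K (CatLie K)
  /-- the operation `x ↦ x ⊗ c` -/
  mulc : ∀ N : ℕ, val A N →ₗ[K] val A (N + 2)
  mulc_act : ∀ {N N' : ℕ} (f : ob (LieRel K) N ⟶ ob (LieRel K) N') (x : val A N),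
    mulc N' (A.act f x) = A.act (f ⊗ₘ 𝟙 (ob (LieRel K) 2)) (mulc N x)
  symm : ∀ {N : ℕ} (x : val A N),
    posOp A (sw 1 1) N 0 (N := N + 2) (N' := N + 2) rfl rfl (mulc N x) = mulc N x
  comm : ∀ {N : ℕ} (x : val A N), posOp A (sw 2 2) N 0 (N := N + 2 + 2) (N' := N + 2 + 2) rfl rfl
    (mulc (N + 2) (mulc N x)) = mulc (N + 2) (mulc N x)
  relation : ∀ {N : ℕ} (x : val A N),
    posOp A (perm23 K ≫ brId K) N 0 (N := N + 2 + 2) (N' := N + 3) rfl rfl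
      (mulc (N + 2) (mulc N x)) =
    -posOp A (idBrId K) N 0 (N := N + 2 + 2) (N' := N + 3) rfl rfl (mulc (N + 2) (mulc N x))
  /-- the generator -/
  one : val A 0
  generated : ∀ S : ∀ N, Submodule K (val A N), one ∈ S 0 →
    (∀ {N N' : ℕ} (f : ob (LieRel K) N ⟶ ob (LieRel K) N') (x : val A N), x ∈ S N →
      A.act f x ∈ S N') →
    (∀ {N : ℕ} (x : val A N), x ∈ S N → mulc N x ∈ S (N + 2)) → ∀ {N : ℕ} (x : val A N), x ∈ S N

/-! ### Insertion of a Casimir element at an arbitrary position -/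

namespace CasimirModule

variable {K : Type u} [CommRing K] (M : CasimirModule K)

/-- The operation which inserts a Casimir element. -/
def ins : Op K (val M.A) 0 2 := fun a b N N' h h' =>
  (posOp M.A (sw b 2) a 0 (N := N + 2) (N' := N') (by omega) (by omega)).comp (M.mulc N)

/-- The operations of the symmetries. -/
def swOp (m n : ℕ) : Op K (val M.A) (m + n) (n + m) := posOp M.A (sw m n)

/-- The operation of the bracket. -/
def brOp : Op K (val M.A) 2 1 := posOp M.A (lieBr K)

/-- The operations of the generators. -/
def genOp : ∀ m n, LieCGen m n → Op K (val M.A) m n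
  | _, _, .br => M.brOp
  | _, _, .cas => M.ins

theorem ins_apply {a b N N' : ℕ} (h : N = a + 0 + b) (h' : N' = a + 2 + b) (x : val M.A N) :
    M.ins a b h h' x = posOp M.A (sw b 2) a 0 (N := N + 2) (N' := N') (by omega) (by omega)
      (M.mulc N x) := rfl

/-- Since `c` is appended on the right, only the right padding of `f` grows. -/
theorem mulc_posOp {m n : ℕ} (f : ob (LieRel K) m ⟶ ob (LieRel K) n) {a b N N' : ℕ}
    (h : N = a + m + b) (h' : N' = a + n + b) (x : val M.A N) :
    M.mulc N' (posOp M.A f a b h h' x) =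
      posOp M.A f a (b + 2) (N := N + 2) (N' := N' + 2) (by omega) (by omega) (M.mulc N x) := by
  rw [posOp_apply, posOp_apply, mulc_act, ← pos_zero_left 2 _ (by omega) (by omega),
    pos_pos _ _ _ _ _ _ _ _ _ (a' := a) (b' := b + 2) (by omega) (by omega)]

/-- On its way from the right end, `c` crosses the block on which `f` acts; naturality of the
symmetry lets it cross before or after `f`. -/
theorem ins_comm_posOp {m n : ℕ} (f : ob (LieRel K) m ⟶ ob (LieRel K) n) :
    Op.Comm M.ins (posOp M.A f) := by
  intro a b a₁ a₂ b₁ b₂ N N₁ N₂ N' h1 h1' h2 h2' k1 k1' k2 k2' hle x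
  obtain ⟨c, rfl⟩ := Nat.exists_eq_add_of_le hle
  obtain rfl : b₁ = c + m + b := by omega
  obtain rfl : b₂ = c + n + b := by omega
  rw [ins_apply, ins_apply, mulc_posOp]
  simp only [posOp_apply, act_act]
  have e := pos_sw_natural (pos c b f (N := c + m + b) (N' := c + n + b) rfl rfl) (k := 2) (a := a)
    (b := 0) (a' := a + 2) (b' := 2) (N := N + 2) (N₁ := N₂ + 2) (N₂ := N₁) (N' := N') rfl rfl
    (by omega) (by omega) (by omega) (by omega) (by omega) (by omega) (by omega) (by omega)
  rw [pos_pos a 2 c b f rfl rfl _ _ (a' := a + 0 + c) (b' := b + 2) (by omega) (by omega)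
      (by omega) (by omega),
    pos_pos (a + 2) 0 c b f rfl rfl _ _ (a' := a₂) (b' := b) (by omega) (by omega) h2 h2'] at e
  rw [e]

/-- Here `c` never crosses the block of `f`, so the plain interchange law suffices. -/
theorem posOp_comm_ins {m n : ℕ} (f : ob (LieRel K) m ⟶ ob (LieRel K) n) :
    Op.Comm (posOp M.A f) M.ins := by
  intro a b a₁ a₂ b₁ b₂ N N₁ N₂ N' h1 h1' h2 h2' k1 k1' k2 k2' hle x
  rw [ins_apply, ins_apply, mulc_posOp]
  exact posOp_comm M.A f (sw b 2) _ _ _ _ _ _ _ _ (by omega) _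

/-- Moving `c` left past `k + b` factors is moving it past `b` and then past `k`; the symmetry
undoes the last move. -/
theorem ins_swapNat : Op.SwapNat M.swOp M.ins := by
  intro k a b a' b' N N₁ N₂ N' ha h1 h1' h2 h2' k1 k1' k2 k2' x
  obtain rfl : N = N₂ := by omega
  obtain rfl : b' = k + b := by omega
  rw [ins_apply, ins_apply]
  simp only [swOp, posOp_apply]
  rw [pos_sw_zero_left, act_id, act_act,
    pos_add_sw (a' := a') (b' := b) (N₁ := N') (by omega) (by omega) _ _ (by omega) (by omega)
      (by omega) (by omega), Category.assoc, pos_sw_sw, Category.comp_id]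

/-- Two adjacent copies travel together: by the hexagon, `c ⊗ c` is appended and then moved as one
block of four factors. -/
theorem ins_ins {a b N N₁ N' : ℕ} (h : N = a + 0 + b) (k : N₁ = a + 2 + b)
    {a' : ℕ} (l : N₁ = a' + 0 + b) (h' : N' = a' + 2 + b) (x : val M.A N) :
    M.ins a' b l h' (M.ins a b h k x) =
      posOp M.A (sw b 4) a 0 (N := N + 2 + 2) (N' := N') (by omega) (by omega)
        (M.mulc (N + 2) (M.mulc N x)) := by
  obtain rfl : a' = a + 2 := by omega
  rw [ins_apply, ins_apply, mulc_posOp]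
  simp only [posOp_apply, act_act]
  rw [pos_sw_add (R := LieRel K) (m := b) (n := 2) (p := 2) (a := a) (b := 0) (a' := a + 2)
    (b' := 2) (N₁ := N₁ + 2) rfl rfl _ _ (by omega) (by omega) (by omega) (by omega)]

theorem ins_add {a b c a' b' N N' : ℕ} (ha : a' = a + c) (hb : b' = c + b) (h : N = a + 0 + b')
    (h' : N' = a + 2 + b') (k : N = a' + 0 + b) (k' : N' = a' + 2 + b) (x : val M.A N) :
    M.ins a b' h h' x = posOp M.A (sw c 2) a b (N := N') (N' := N') (by omega) (by omega)
      (M.ins a' b k k' x) := by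
  subst hb
  simp only [ins_apply, posOp_apply, act_act]
  rw [← pos_add_sw (R := LieRel K) (a := a) (b := 0) (a' := a') (b' := b) ha rfl]

/-- This is where `r_s` acts: inserting the second copy to the left or to the right of the first one
gives the same result, because the exchange of two copies of `c` acts trivially on the right end and
naturality transports this to any position. -/
theorem ins_ins_right {a b a' b' N N₁ N' : ℕ} (ha : a' = a + 2) (hb : b' = 2 + b)
    (h : N = a + 0 + b) (k : N₁ = a + 2 + b) (l : N₁ = a' + 0 + b) (h' : N' = a' + 2 + b)
    (l₂ : N₁ = a + 0 + b') (h₂ : N' = a + 2 + b') (x : val M.A N) :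
    M.ins a b' l₂ h₂ (M.ins a b h k x) = M.ins a' b l h' (M.ins a b h k x) := by
  rw [M.ins_add ha hb l₂ h₂ l h', ins_ins]
  conv_rhs => rw [← M.comm x]
  simp only [posOp_apply, act_act]
  congr 2
  exact (pos_sw_natural' (R := LieRel K) (a := a) (b := 0) (a' := N) (b' := b) (k := b)
    (sw 2 2 : ob (LieRel K) 4 ⟶ ob (LieRel K) 4) (by omega) (by omega) (by omega) (by omega)
    (by omega) (by omega) (by omega) (by omega) (by omega) (by omega)).symm

/-- Reduction to adjacent copies: the left insertion is replaced by an insertion next to the right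
one, followed by a symmetry across the `c` factors of the gap (`ins_add`). -/
theorem ins_comm_ins : Op.Comm M.ins M.ins := by
  intro a b a₁ a₂ b₁ b₂ N N₁ N₂ N' h1 h1' h2 h2' k1 k1' k2 k2' hle x
  obtain ⟨c, rfl⟩ := Nat.exists_eq_add_of_le hle
  have e1 := M.ins_add (a := a) (b := 2 + b) (c := c) (a' := a + 0 + c) (b' := b₂) rfl (by omega)
    k2 k2' (by omega) (by omega) (M.ins (a + 0 + c) b k1 k1' x)
  have e2 := M.posOp_comm_ins (sw c 2) (a := a) (b := b) (a₁ := a + c + 2) (a₂ := a₂)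
    (b₁ := b) (b₂ := 2 + b) (N := N₂) (N₁ := N₁) (N₂ := N') (N' := N') (by omega) (by omega)
    (by omega) (by omega) (by omega) (by omega) (by omega) (by omega) (by omega)
    (M.ins (a + 0 + c) b k1 k1' x)
  rw [e1, M.ins_ins_right (a' := a + c + 2) (by omega) rfl k1 k1' (by omega) (by omega), ← e2,
    M.ins_add (a := a) (b := b) (c := c) (a' := a + 0 + c) (b' := b₁) rfl (by omega) h1 (by omega)
      k1 (by omega)]
  obtain rfl : N₁ = N₂ := by omega
  rfl

theorem swOp_ins {a b N N' : ℕ} (h : N = a + 0 + b) (h' : N' = a + 2 + b) (x : val M.A N) :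
    M.swOp 1 1 a b h' h' (M.ins a b h h' x) = M.ins a b h h' x := by
  rw [ins_apply]
  conv_rhs => rw [← M.symm x]
  simp only [posOp_apply, act_act, swOp]
  congr 2
  exact (pos_sw_natural' (R := LieRel K) (a := a) (b := 0) (a' := N) (b' := b) (k := b)
    (sw 1 1 : ob (LieRel K) 2 ⟶ ob (LieRel K) 2) (by omega) (by omega) (by omega) (by omega)
    (by omega) (by omega) (by omega) (by omega) (by omega) (by omega)).symm

theorem isRep : IsRep M.genOp M.swOp where
  comm_gen_gen := by
    rintro _ _ _ _ ⟨⟩ ⟨⟩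
    · exact posOp_comm _ _ _
    · exact M.posOp_comm_ins _
    · exact M.ins_comm_posOp _
    · exact M.ins_comm_ins
  comm_gen_swap := by
    rintro _ _ ⟨⟩ p q
    · exact posOp_comm _ _ _
    · exact M.ins_comm_posOp _
  comm_swap_gen := by
    rintro _ _ ⟨⟩ p q
    · exact posOp_comm _ _ _
    · exact M.posOp_comm_ins _
  comm_swap_swap _ _ _ _ := posOp_comm _ _ _
  swapNat_gen := by
    rintro _ _ ⟨⟩
    · exact posOp_swapNat _ _
    · exact M.ins_swapNat
  swapNat_swap _ _ := posOp_swapNat _ _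
  swap_swap h h' x := by
    simp only [swOp, posOp_apply, act_act]
    rw [pos_sw_sw, act_id]
  swap_add ha h h' k k' l l' x := by
    simp only [swOp, posOp_apply, act_act]
    rw [pos_sw_add ha (by omega) h h' k k' l l']

/-- The operation of an expression in the generators of a Casimir Lie algebra. -/
def op {m n : ℕ} (t : Term K LieCGen m n) : Op K (val M.A) m n := den M.genOp M.swOp t

/-- On expressions without Casimir elements the new action is the old one; in particular the Lie
relations are respected. -/
theorem op_map {m n : ℕ} (t : Term K LieGen m n) {a b N N' : ℕ} (h : N = a + m + b)
    (h' : N' = a + n + b) (x : val M.A N) :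
    M.op (t.map lieGenIncl) a b h h' x = posOp M.A (cls (LieRel K) t) a b h h' x := by
  induction t generalizing a b N N' with
  | gen g => cases g; rfl
  | id n =>
    obtain rfl : N = N' := by omega
    rw [posOp_apply]
    have e := pos_id (R := LieRel K) a b n h h'
    rw [eqIso_refl] at e
    exact ((congrArg (fun t => M.A.act t x) e).trans (act_id _ _ _)).symm
  | comp t t' ih ih' =>
    have e := den_comp (g := M.genOp) (s := M.swOp) (t.map lieGenIncl) (t'.map lieGenIncl)
      h rfl h' x
    refine e.trans ((ih' rfl h' _).trans ((congrArg _ (ih h rfl x)).trans ?_))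
    exact posOp_comp M.A (cls (LieRel K) t) (cls (LieRel K) t') h rfl h' x
  | @tens m n m' n' t t' ih ih' =>
    have e := den_tens (g := M.genOp) (s := M.swOp) (t.map lieGenIncl) (t'.map lieGenIncl)
      (b' := m' + b) (N₁ := a + n + (m' + b)) rfl h h' (by omega) rfl (by omega) (by omega) x
    refine e.trans ((ih' _ _ _).trans ((congrArg _ (ih _ _ x)).trans ?_))
    simp only [posOp_apply, act_act]
    have e2 := pos_tens (R := LieRel K) a b (cls (LieRel K) t) (cls (LieRel K) t') (b' := m' + b)
      (N'' := a + n + (m' + b)) rfl rfl h h' (by omega) rfl (by omega) (by omega)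
    rw [← e2]; rfl
  | swap => rfl
  | zero m n =>
    have e : (cls (LieRel K) (Term.zero m n)) = (0 : K) • (cls (LieRel K) (Term.zero m n)) :=
      (cls_eq (Rel.zero_smul _)).symm
    rw [e, posOp_apply, pos_smul, act_smul, zero_smul]
    rfl
  | add t t' ih ih' =>
    have e := pos_add (R := LieRel K) a b (cls (LieRel K) t) (cls (LieRel K) t') h h'
    have e2 := congrArg (fun f => M.A.act f x) e
    refine Eq.trans ?_ e2.symm
    refine Eq.trans ?_ (act_add _ _ _ _).symm
    exact congrArg₂ (· + ·) (ih h h' x) (ih' h h' x)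
  | smul r t ih =>
    have e := pos_smul (R := LieRel K) a b r (cls (LieRel K) t) h h'
    have e2 := congrArg (fun f => M.A.act f x) e
    refine Eq.trans ?_ e2.symm
    refine Eq.trans ?_ (act_smul _ _ _ _).symm
    exact congrArg (r • ·) (ih h h' x)

end CasimirModule

/-! ### Invariance of the Casimir element against every factor of every element -/

namespace CasimirModule

section Invariance

variable (K : Type u) [CommRing K]

/-- The expression `x ↦ ∑ [x, a] ⊗ b`. -/
def invLeft : Term K LieCGen 1 2 :=
  .comp (.tens (.id 1) (casLieC K) : Term K LieCGen 1 3)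
    (.tens (brLieC K) (.id 1) : Term K LieCGen 3 2)

/-- The expression `x ↦ ∑ a ⊗ [b, x]`. -/
def invRight : Term K LieCGen 1 2 :=
  .comp (.tens (casLieC K) (.id 1) : Term K LieCGen 1 3)
    (.tens (.id 1) (brLieC K) : Term K LieCGen 3 2)

end Invariance

variable {K : Type u} [CommRing K] (M : CasimirModule K)

theorem op_invLeft {a b a' b' N N₁ N' : ℕ} (ha : a' = a + 1) (h : N = a + 1 + b)
    (h' : N' = a + 2 + b) (k : N = a' + 0 + b) (k' : N₁ = a' + 2 + b) (l : N₁ = a + 2 + b')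
    (l' : N' = a + 1 + b') (x : val M.A N) :
    M.op (invLeft K) a b h h' x = M.brOp a b' l l' (M.ins a' b k k' x) := by
  subst ha
  obtain rfl : b' = 1 + b := by omega
  have e1 := den_comp (g := M.genOp) (s := M.swOp)
    (.tens (.id 1) (casLieC K) : Term K LieCGen 1 3)
    (.tens (brLieC K) (.id 1) : Term K LieCGen 3 2) h (N₁ := N₁) (by omega) h' x
  refine e1.trans ?_
  have e2 := den_tens (g := M.genOp) (s := M.swOp) (.id 1) (casLieC K) (a := a) (b := b)
    (a' := a + 1) (b' := b) (N := N) (N' := N₁) (N₁ := N) rfl (by omega) (by omega) (by omega)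
    (by omega) (by omega) (by omega) x
  have e3 := den_tens (g := M.genOp) (s := M.swOp) (brLieC K) (.id 1) (a := a) (b := b)
    (a' := a + 1) (b' := 1 + b) (N := N₁) (N' := N') (N₁ := N') rfl (by omega) (by omega)
    (by omega) (by omega) (by omega) (by omega) (M.ins (a + 1) b k k' x)
  exact (congrArg _ e2).trans e3

theorem op_invRight {a b a' b' N N₁ N' : ℕ} (ha : a' = a + 1) (h : N = a + 1 + b)
    (h' : N' = a + 2 + b) (k : N = a + 0 + b') (k' : N₁ = a + 2 + b') (l : N₁ = a' + 2 + b)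
    (l' : N' = a' + 1 + b) (x : val M.A N) :
    M.op (invRight K) a b h h' x = M.brOp a' b l l' (M.ins a b' k k' x) := by
  subst ha
  obtain rfl : b' = 1 + b := by omega
  have e1 := den_comp (g := M.genOp) (s := M.swOp)
    (.tens (casLieC K) (.id 1) : Term K LieCGen 1 3)
    (.tens (.id 1) (brLieC K) : Term K LieCGen 3 2) h (N₁ := N₁) (by omega) h' x
  refine e1.trans ?_
  have e2 := den_tens (g := M.genOp) (s := M.swOp) (casLieC K) (.id 1) (a := a) (b := b)
    (a' := a + 2) (b' := 1 + b) (N := N) (N' := N₁) (N₁ := N₁) rfl (by omega) (by omega) (by omega)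
    (by omega) (by omega) (by omega) x
  have e3 := den_tens (g := M.genOp) (s := M.swOp) (.id 1) (brLieC K) (a := a) (b := b)
    (a' := a + 1) (b' := 2 + b) (N := N₁) (N' := N') (N₁ := N₁) rfl (by omega) (by omega)
    (by omega) (by omega) (by omega) (by omega) (M.ins a (1 + b) k k' x)
  exact (congrArg _ e2).trans e3

/-- The Casimir element is invariant under the factor of `x` in position `a`. -/
def InvAt {N : ℕ} (x : val M.A N) (a b : ℕ) : Prop :=
  ∀ (h : N = a + 1 + b) (h' : N + 1 = a + 2 + b),
    M.op (invLeft K) a b h h' x = M.op (invRight K) a b h h' x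

/-- The Casimir element is invariant under every factor of `x`. -/
def Inv {N : ℕ} (x : val M.A N) : Prop := ∀ a b : ℕ, M.InvAt x a b

variable {M}

theorem Inv.eq {N : ℕ} {x : val M.A N} (hx : M.Inv x) {a b N' : ℕ} (h : N = a + 1 + b)
    (h' : N' = a + 2 + b) :
    M.op (invLeft K) a b h h' x = M.op (invRight K) a b h h' x := by
  obtain rfl : N' = N + 1 := by omega
  exact hx a b h h'

/-- Invariance against a factor outside the block of `t` commutes with `t` and is known for `x`.
Only the factors produced by `t` need an argument. -/
theorem Inv.op_of_block {N : ℕ} {x : val M.A N} (hx : M.Inv x) {m n p q N' : ℕ}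
    (t : Term K LieCGen m n) (h : N = p + m + q) (h' : N' = p + n + q)
    (hi : ∀ i j : ℕ, n = i + 1 + j → M.InvAt (M.op t p q h h' x) (p + i) (j + q)) :
    M.Inv (M.op t p q h h' x) := by
  intro a b k k'
  -- The factor lies to the left of the block, to its right, or inside it; the hypothesis `hi` is
  -- for the last case.
  by_cases h1 : a + 1 ≤ p
  · have e1 := M.isRep.comm (invLeft K) t
    have e2 := M.isRep.comm (invRight K) t
    have e1 := e1 (a := a) (b := q) (a₁ := p) (a₂ := p + 1) (b₁ := N - (a + 1)) (b₂ := b) (N := N)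
      (N₁ := N + 1) (N₂ := N') (N' := N' + 1) (by omega) (by omega) (by omega) (by omega) h h' k k'
      h1 x
    have e2 := e2 (a := a) (b := q) (a₁ := p) (a₂ := p + 1) (b₁ := N - (a + 1)) (b₂ := b) (N := N)
      (N₁ := N + 1) (N₂ := N') (N' := N' + 1) (by omega) (by omega) (by omega) (by omega) h h' k k'
      h1 x
    refine e1.symm.trans (Eq.trans ?_ e2)
    exact congrArg _ (hx.eq _ _)
  by_cases h2 : p + n ≤ a
  · have e1 := M.isRep.comm t (invLeft K)
    have e2 := M.isRep.comm t (invRight K)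
    have e1 := e1 (a := p) (b := b) (a₁ := p + m + (a - (p + n))) (a₂ := a) (b₁ := q)
      (b₂ := q + 1) (N := N)
      (N₁ := N') (N₂ := N + 1) (N' := N' + 1) h h' k k' (by omega) (by omega) (by omega) (by omega)
      (by omega) x
    have e2 := e2 (a := p) (b := b) (a₁ := p + m + (a - (p + n))) (a₂ := a) (b₁ := q)
      (b₂ := q + 1) (N := N)
      (N₁ := N') (N₂ := N + 1) (N' := N' + 1) h h' k k' (by omega) (by omega) (by omega) (by omega)
      (by omega) x
    refine e1.trans (Eq.trans ?_ e2.symm)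
    exact congrArg _ (hx.eq _ _)
  obtain ⟨i, rfl⟩ := Nat.exists_eq_add_of_le (show p ≤ a by omega)
  have e := hi i (n - 1 - i) (by omega)
  obtain rfl : b = n - 1 - i + q := by omega
  exact e k k'

theorem op_pad {m n : ℕ} (t : Term K LieCGen m n) {i j a b N N' : ℕ} (h : N = a + (i + m + j) + b)
    (h' : N' = a + (i + n + j) + b) (k : N = a + i + m + (j + b)) (k' : N' = a + i + n + (j + b))
    (x : val M.A N) :
    M.op (.tens (.tens (.id i) t) (.id j)) a b h h' x = M.op t (a + i) (j + b) k k' x := by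
  have e1 := den_tens (g := M.genOp) (s := M.swOp) (.tens (.id i) t) (.id j)
    (b' := j + b) (N₁ := N') rfl h h' (by omega) (by omega) (by omega) (by omega) x
  have e2 := den_tens (g := M.genOp) (s := M.swOp) (.id i) t (N := N) (N' := N') (a := a)
    (b := j + b) (b' := m + (j + b)) (N₁ := N) rfl (by omega) (by omega) (by omega) (by omega)
    (by omega) (by omega) x
  exact e1.trans e2

/-- A permutation only relocates factors: by naturality of the symmetry, invariance against a moved
factor is invariance against the same factor in its old place. -/
theorem Inv.swOp {N : ℕ} {x : val M.A N} (hx : M.Inv x) {m n p q N' : ℕ}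
    (h : N = p + (m + n) + q) (h' : N' = p + (n + m) + q) : M.Inv (M.swOp m n p q h h' x) := by
  refine hx.op_of_block (.swap m n) h h' fun i j hij k k' => ?_
  by_cases hi : i < n
  -- The factor was in the second block of `x`. Naturality is available for the symmetry going back,
  -- so both sides are compared after undoing the exchange, and the exchange is reapplied at the
  -- end.
  · obtain ⟨j', rfl⟩ : ∃ j', n = i + 1 + j' := ⟨n - (i + 1), by omega⟩
    obtain rfl : j = j' + m := by omega
    have key : ∀ t : Term K LieCGen 1 2,
        M.swOp (i + 2 + j') m p q (N := N' + 1) (N' := N + 1) (by omega) (by omega)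
          (M.op t (p + i) (j' + m + q) k k' (M.swOp m (i + 1 + j') p q h h' x)) =
        M.op t (p + m + i) (j' + q) (by omega) (by omega) x := by
      intro t
      have e := M.isRep.swapNat (.tens (.tens (.id i) t) (.id j'))
      have e := e (k := m) (a := p) (b := q) (a' := p + m) (b' := m + q) (N := N') (N₁ := N' + 1)
        (N₂ := N) (N' := N + 1) rfl (by omega) (by omega) (by omega) (by omega) (by omega)
        (by omega) (by omega) (by omega) (M.swOp m (i + 1 + j') p q h h' x)
      rw [M.isRep.swap_swap] at e
      have e1 := op_pad t (i := i) (j := j') (a := p) (b := m + q) (N := N') (N' := N' + 1)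
        (by omega) (by omega) (by omega) (by omega) (M.swOp m (i + 1 + j') p q h h' x)
      have e2 := op_pad t (i := i) (j := j') (a := p + m) (b := q) (N := N) (N' := N + 1)
        (by omega) (by omega) (by omega) (by omega) x
      refine Eq.trans (congrArg _ ?_) (e.trans e2)
      refine Eq.trans ?_ e1.symm
      exact Op.congr (M.op t) _ _ rfl _ _ _
    have e1 := (key (invLeft K)).trans ((hx.eq _ _).trans (key (invRight K)).symm)
    have e2 := congrArg (M.swOp m (i + 2 + j') p q (N := N + 1) (N' := N' + 1) (by omega)
      (by omega)) e1
    rwa [M.isRep.swap_swap, M.isRep.swap_swap] at e2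
  -- The factor was in the first block of `x`, at position `i'`, and naturality applies directly.
  · obtain ⟨i', rfl⟩ := Nat.exists_eq_add_of_le (show n ≤ i by omega)
    obtain rfl : m = i' + 1 + j := by omega
    have key : ∀ t : Term K LieCGen 1 2,
        M.op t (p + (n + i')) (j + q) k k' (M.swOp (i' + 1 + j) n p q h h' x) =
        M.swOp (i' + 2 + j) n p q (N := N + 1) (N' := N' + 1) (by omega) (by omega)
          (M.op t (p + i') (j + (n + q)) (by omega) (by omega) x) := by
      intro t
      have e := M.isRep.swapNat (.tens (.tens (.id i') t) (.id j))
      have e := e (k := n) (a := p) (b := q) (a' := p + n) (b' := n + q) (N := N) (N₁ := N + 1)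
        (N₂ := N') (N' := N' + 1) rfl (by omega) (by omega) (by omega) (by omega) (by omega)
        (by omega) (by omega) (by omega) x
      have e1 := op_pad t (i := i') (j := j) (a := p) (b := n + q) (N := N) (N' := N + 1)
        (by omega) (by omega) (by omega) (by omega) x
      have e2 := op_pad t (i := i') (j := j) (a := p + n) (b := q) (N := N') (N' := N' + 1)
        (by omega) (by omega) (by omega) (by omega) (M.swOp (i' + 1 + j) n p q h h' x)
      refine Eq.trans ?_ (e2.symm.trans (e.symm.trans (congrArg _ e1)))
      exact Op.congr (M.op t) _ _ (by omega) _ _ _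
    exact (key _).trans ((congrArg _ (hx.eq _ _)).trans (key _).symm)

/-- With `c = ∑ a ⊗ b` and `x`, `y` the two factors, this is `∑ [x, [y, a]] ⊗ b = ∑ [x, a] ⊗ [b, y]
= ∑ a ⊗ [[b, x], y]`: invariance against `y` and then against `x`, the brackets on the two legs
being independent. -/
theorem Inv.bracket_bracket {N : ℕ} {x : val M.A N} (hx : M.Inv x) {p q N₁ N' : ℕ}
    (h : N = p + 2 + q) (k : N = (p + 2) + 0 + q) (k' : N₁ = (p + 2) + 2 + q)
    (l : N₁ = p + 3 + (1 + q)) (l' : N' = p + 1 + (1 + q)) (c : N = p + 0 + (2 + q))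
    (c' : N₁ = p + 2 + (2 + q)) (d : N₁ = (p + 1) + 3 + q) (d' : N' = (p + 1) + 1 + q) :
    posOp M.A (lieBrBr' K) p (1 + q) l l' (M.ins (p + 2) q k k' x) =
      posOp M.A (lieBrBr K) (p + 1) q d d' (M.ins p (2 + q) c c' x) := by
  have e1 := hx.eq (a := p + 1) (b := q) (N' := N + 1) (by omega) (by omega)
  rw [op_invLeft (a' := p + 2) (b' := 1 + q) (N₁ := N₁) M rfl _ _ k k' (by omega) (by omega),
    op_invRight (a' := p + 2) (b' := 1 + q) (N₁ := N₁) M rfl _ _ (by omega) (by omega) (by omega)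
      (by omega)] at e1
  have e2 := hx.eq (a := p) (b := 1 + q) (N' := N + 1) (by omega) (by omega)
  rw [op_invLeft (a' := p + 1) (b' := 2 + q) (N₁ := N₁) M rfl _ _ (by omega) (by omega) (by omega)
      (by omega),
    op_invRight (a' := p + 1) (b' := 2 + q) (N₁ := N₁) M rfl _ _ (by omega) (by omega) (by omega)
      (by omega)] at e2
  have e3 := posOp_comm M.A (lieBr K) (lieBr K) (a := p) (b := q) (a₁ := p + 2) (a₂ := p + 1)
    (b₁ := 2 + q) (b₂ := 1 + q) (N := N₁) (N₁ := N + 1) (N₂ := N + 1) (N' := N') (by omega)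
    (by omega) (by omega) (by omega) (by omega) (by omega) (by omega) (by omega) (by omega)
    (M.ins (p + 1) (1 + q) (N := N) (N' := N₁) (by omega) (by omega) x)
  have f1 : ∀ y, posOp M.A (lieBrBr' K) p (1 + q) l l' y =
      posOp M.A (lieBr K) p (1 + q) (N := N + 1) (by omega) (by omega)
        (posOp M.A (lieBr K) (p + 1) (1 + q) (N := N₁) (N' := N + 1) (by omega) (by omega) y) := by
    intro y
    simp only [posOp_apply, act_act]
    rw [pos_lieBrBr' K (N₁ := N + 1) rfl l l' (by omega) (by omega) (by omega)]
  have f2 : ∀ y, posOp M.A (lieBrBr K) (p + 1) q d d' y =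
      posOp M.A (lieBr K) (p + 1) q (N := N + 1) (by omega) (by omega)
        (posOp M.A (lieBr K) (p + 1) (1 + q) (N := N₁) (N' := N + 1) (by omega) (by omega) y) := by
    intro y
    simp only [posOp_apply, act_act]
    rw [pos_lieBrBr K (N₁ := N + 1) (b' := 1 + q) d d' (by omega) (by omega) (by omega)]
  rw [f1, f2]
  exact (congrArg _ e1).trans (e3.symm.trans (congrArg _ e2))

theorem act_neg' {P : Type} [Category.{u} P] [Preadditive P] [Linear K P] (A : LinMod K P) {X Y : P} (f : X ⟶ Y) (x : A.obj X) :
    A.act (-f) x = -A.act f x := by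
  rw [← neg_one_smul K f, act_smul, neg_one_smul]

theorem posOp_sub {m n : ℕ} (f g : ob (LieRel K) m ⟶ ob (LieRel K) n) {a b N N' : ℕ}
    (h : N = a + m + b) (h' : N' = a + n + b) (x : val M.A N) :
    posOp M.A (f - g) a b h h' x = posOp M.A f a b h h' x - posOp M.A g a b h h' x := by
  rw [sub_eq_add_neg, posOp_apply, pos_add, pos_neg, act_add, act_neg', ← sub_eq_add_neg]
  rfl

/-- Elements against which `c` is invariant are closed under brackets. By the Jacobi identity `[[x,
y], a]` is a difference of double brackets; `bracket_bracket` moves each of them to the second leg,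
and the Jacobi identity there reassembles `[b, [x, y]]`. -/
theorem Inv.brOp {N : ℕ} {x : val M.A N} (hx : M.Inv x) {p q N' : ℕ}
    (h : N = p + 2 + q) (h' : N' = p + 1 + q) : M.Inv (M.brOp p q h h' x) := by
  refine hx.op_of_block (.gen .br) h h' fun i j hij k k' => ?_
  obtain rfl : i = 0 := by omega
  obtain rfl : j = 0 := by omega
  change M.op _ p (0 + q) k k' (M.brOp p q h h' x) = M.op _ p (0 + q) k k' (M.brOp p q h h' x)
  -- It does not matter whether `c` is inserted before or after `x` and `y` are bracketed; `c1` is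
  -- for `c` on the right of them and `c2` for `c` on the left.
  have c1 := M.posOp_comm_ins (lieBr K) (a := p) (b := q) (a₁ := p + 2) (a₂ := p + 1) (b₁ := q)
    (b₂ := 2 + q) (N := N) (N₁ := N') (N₂ := N + 2) (N' := N + 1) (by omega)
    (by omega) (by omega) (by omega) (by omega) (by omega) (by omega) (by omega) (by omega) x
  have c2 := M.ins_comm_posOp (lieBr K) (a := p) (b := q) (a₁ := p) (a₂ := p + 2) (b₁ := 2 + q)
    (b₂ := 1 + q) (N := N) (N₁ := N + 2) (N₂ := N') (N' := N + 1) (by omega)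
    (by omega) (by omega) (by omega) (by omega) (by omega) (by omega) (by omega) (by omega) x
  have d1 := hx.bracket_bracket (p := p) (q := q) (N₁ := N + 2) (N' := N' + 1) h (by omega)
    (by omega) (by omega) (by omega) (by omega) (by omega) (by omega) (by omega)
  -- Exchanging `x` and `y` beforehand gives the second term of the Jacobi identity, `∑ [y, [x, a]]
  -- ⊗ b = ∑ a ⊗ [[b, y], x]`; `s1` and `s2` move the exchange past the insertion.
  have hx' := hx.swOp (m := 1) (n := 1) h h
  have d2 := hx'.bracket_bracket (p := p) (q := q) (N₁ := N + 2) (N' := N' + 1) h (by omega)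
    (by omega) (by omega) (by omega) (by omega) (by omega) (by omega) (by omega)
  have s1 := M.posOp_comm_ins (sw 1 1) (a := p) (b := q) (a₁ := p + 2) (a₂ := p + 2) (b₁ := q)
    (b₂ := 2 + q) (N := N) (N₁ := N) (N₂ := N + 2) (N' := N + 2) (by omega)
    (by omega) (by omega) (by omega) (by omega) (by omega) (by omega) (by omega) (by omega) x
  have s2 := M.ins_comm_posOp (sw 1 1) (a := p) (b := q) (a₁ := p) (a₂ := p + 2) (b₁ := 2 + q)
    (b₂ := 2 + q) (N := N) (N₁ := N + 2) (N₂ := N) (N' := N + 2) (by omega)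
    (by omega) (by omega) (by omega) (by omega) (by omega) (by omega) (by omega) (by omega) x
  rw [CasimirModule.swOp, s1, ← s2] at d2
  rw [op_invLeft (a' := p + 1) (b' := 1 + q) (N₁ := N + 1) M rfl _ _ (by omega) (by omega)
      (by omega) (by omega),
    op_invRight (a' := p + 1) (b' := 1 + q) (N₁ := N + 1) M rfl _ _ (by omega) (by omega)
      (by omega) (by omega)]
  have c1' : M.ins (p + 1) (0 + q) (N := N') (N' := N + 1) (by omega) (by omega)
      (M.brOp p q h h' x) = _ := (Op.congr M.ins _ _ rfl (by omega) (by omega) _).trans c1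
  rw [c1', CasimirModule.brOp, ← c2]
  have f1 := congrArg (fun f => M.A.act f (M.ins (p + 2) q (N := N) (N' := N + 2) (by omega)
    (by omega) x)) (pos_lieBrBr K (a := p) (b := 1 + q) (N := N + 2) (N₁ := N + 1) (N' := N' + 1)
      (b' := 2 + q) (by omega) (by omega) (by omega) (by omega) (by omega))
  have f2 := congrArg (fun f => M.A.act f (M.ins p (2 + q) (N := N) (N' := N + 2) (by omega)
    (by omega) x)) (pos_lieBrBr' K (a := p + 1) (b := q) (N := N + 2) (N₁ := N + 1) (N' := N' + 1)
      (a' := p + 2) rfl (by omega) (by omega) (by omega) (by omega) (by omega))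
  rw [act_comp] at f1 f2
  refine f1.symm.trans (Eq.trans ?_ (f2.trans (Op.congr M.brOp _ _ rfl (by omega) (by omega) _)))
  have g1 : ∀ y, posOp M.A (swFst K) p (1 + q) (N := N + 2) (N' := N + 2) (by omega) (by omega) y =
      posOp M.A (sw 1 1) p (2 + q) (N := N + 2) (N' := N + 2) (by omega) (by omega) y := fun y => by
    rw [swFst, posOp_apply, posOp_apply,
      pos_pos _ _ _ _ _ _ _ _ _ (a' := p) (b' := 2 + q) (by omega) (by omega)]
  have g2 : ∀ y, posOp M.A (swSnd K) (p + 1) q (N := N + 2) (N' := N + 2) (by omega) (by omega) y =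
      posOp M.A (sw 1 1) (p + 2) q (N := N + 2) (N' := N + 2) (by omega) (by omega) y := fun y => by
    rw [swSnd, posOp_apply, posOp_apply,
      pos_pos _ _ _ _ _ _ _ _ _ (a' := p + 2) (b' := q) (by omega) (by omega)]
  rw [← posOp_apply, ← posOp_apply, ← lieBrBr_sub, posOp_sub, ← d1]
  conv_lhs => rw [lieBrBr_eq, posOp_sub]
  rw [← posOp_comp M.A _ _ _ (N₁ := N + 2) (by omega), g1, d2,
    ← posOp_comp M.A _ _ _ (N₁ := N + 2) (by omega), g2]

/-- Invariance of one copy of `c` against the factors of another. For the first factor this is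
`r_c`; for the second one it follows from the first by the symmetry of `c`. -/
theorem Inv.ins {N : ℕ} {x : val M.A N} (hx : M.Inv x) {p q N' : ℕ}
    (h : N = p + 0 + q) (h' : N' = p + 2 + q) : M.Inv (M.ins p q h h' x) := by
  have h0 : M.InvAt (M.ins p q h h' x) p (1 + q) := by
    intro k k'
    -- Inserting the new copy after the first leg of the old one is inserting it before that leg and
    -- applying the symmetry of `2` and `1`. Both sides thus become morphisms applied to two
    -- adjacent copies `c ⊗ c`.
    have e1 := M.ins_swapNat (k := 1) (a := p) (b := 1 + q) (a' := p + 1) (b' := 2 + q) (N := N')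
      (N₁ := N' + 2) (N₂ := N') (N' := N' + 2) rfl (by omega) (by omega) (by omega) (by omega)
      (by omega) (by omega) (by omega) (by omega) (M.ins p q h h' x)
    rw [CasimirModule.swOp, CasimirModule.swOp, posOp_apply, posOp_apply, pos_sw_zero_left, act_id,
      M.ins_ins_right (a' := p + 2) rfl rfl h h' (by omega) (by omega), ins_ins] at e1
    rw [op_invLeft (a' := p + 1) (b' := 2 + q) (N₁ := N' + 2) M rfl _ _ (by omega) (by omega)
        (by omega) (by omega),
      op_invRight (a' := p + 1) (b' := 2 + q) (N₁ := N' + 2) M rfl _ _ (by omega) (by omega)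
        (by omega) (by omega),
      M.ins_ins_right (a' := p + 2) rfl rfl h h' (by omega) (by omega), ins_ins, ← e1]
    simp only [CasimirModule.brOp, posOp_apply, act_act]
    -- The relation is known on the last four factors. It is carried to position `p`, past the `q`
    -- factors on the right, by naturality of the symmetry.
    have r := congrArg (posOp M.A (sw q 3) p 0 (N := N + 3) (N' := N' + 1) (by omega) (by omega))
      (M.relation x)
    rw [map_neg] at r
    simp only [posOp_apply, act_act] at r
    rw [pos_sw_natural' (R := LieRel K) (a := p) (b := 0) (a' := N) (b' := q) (k := q)
        (N := N + 2 + 2) (N₁ := N + 3) (N₂ := N' + 2) (N' := N' + 1)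
        (idBrId K) (by omega) (by omega) (by omega) (by omega)
        (by omega) (by omega) (by omega) (by omega) (by omega) (by omega),
      pos_sw_natural' (R := LieRel K) (a := p) (b := 0) (a' := N) (b' := q) (k := q)
        (N := N + 2 + 2) (N₁ := N + 3) (N₂ := N' + 2) (N' := N' + 1)
        (perm23 K ≫ brId K) (by omega) (by omega) (by omega) (by omega)
        (by omega) (by omega) (by omega) (by omega) (by omega) (by omega),
      pos_comp p q (perm23 K) (brId K) (N' := N' + 2) (by omega) (by omega) (by omega),
      perm23_eq, brId_eq, idBrId_eq,
      pos_pos p q 1 1 _ _ _ _ _ (a' := p + 1) (b' := 1 + q) rfl rfl (by omega) (by omega),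
      pos_pos p q 0 2 _ _ _ _ _ (a' := p) (b' := 2 + q) rfl rfl (by omega) (by omega),
      pos_pos p q 1 1 _ _ _ _ _ (a' := p + 1) (b' := 1 + q) rfl rfl (by omega) (by omega)] at r
    rw [← neg_eq_iff_eq_neg] at r
    refine Eq.trans ?_ r
    -- The symmetry is the permutation `(23)` of `r_c` followed by the exchange of the two arguments
    -- of the bracket. Antisymmetry turns the latter into the sign that matches `r_c`.
    rw [pos_add_sw (R := LieRel K) (m := 1) (n := 1) (p := 1) (a := p) (b := 1 + q) (a' := p + 1)
      (b' := 2 + q) (N₁ := N' + 2) rfl (by omega) _ _ (by omega) (by omega) (by omega) (by omega),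
      Category.assoc, Category.assoc, pos_sw_pos_lieBr]
    simp only [Preadditive.comp_neg, act_neg']
  refine hx.op_of_block (.gen .cas) h h' fun i j hij => ?_
  obtain rfl | ⟨rfl, rfl⟩ : i = 0 ∨ i = 1 ∧ j = 0 := by omega
  · obtain rfl : j = 1 := by omega
    exact h0
  · intro k k'
    -- Exchanging the legs of `c` changes nothing, so an operation on the second leg is the same
    -- operation on the first leg, followed by a symmetry.
    have key : ∀ t : Term K LieCGen 1 2, M.swOp 2 1 p q (N := N' + 1) (N' := N' + 1) (by omega)
        (by omega) (M.op t p (1 + q) (N := N') (N' := N' + 1) (by omega) (by omega)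
          (M.ins p q h h' x)) = M.op t (p + 1) q (N := N') (N' := N' + 1) (by omega) (by omega)
          (M.ins p q h h' x) := by
      intro t
      have e := M.isRep.swapNat t
      have e := e (k := 1) (a := p) (b := q) (a' := p + 1) (b' := 1 + q) (N := N')
        (N₁ := N' + 1) (N₂ := N') (N' := N' + 1) rfl (by omega) (by omega) (by omega) (by omega)
        (by omega) (by omega) (by omega) (by omega) (M.ins p q h h' x)
      rw [M.swOp_ins] at e
      exact e
    have e := (key (invLeft K)).symm.trans ((congrArg _ (h0 _ _)).trans (key (invRight K)))
    refine Eq.trans ?_ (e.trans ?_)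
    · exact Op.congr (M.op (invLeft K)) k k' rfl _ _ _
    · exact Op.congr (M.op (invRight K)) _ _ rfl _ _ _

theorem Inv.add {N : ℕ} {x y : val M.A N} (hx : M.Inv x) (hy : M.Inv y) : M.Inv (x + y) := by
  intro a b h h'
  rw [map_add, map_add, hx, hy]

theorem Inv.smul {N : ℕ} {x : val M.A N} (r : K) (hx : M.Inv x) : M.Inv (r • x) := by
  intro a b h h'
  rw [map_smul, map_smul, hx]

theorem Inv.zero {N : ℕ} : M.Inv (0 : val M.A N) := by
  intro a b h h'
  rw [map_zero, map_zero]

theorem Inv.op {m n : ℕ} (t : Term K LieCGen m n) {N : ℕ} {x : val M.A N} (hx : M.Inv x)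
    {p q N' : ℕ} (h : N = p + m + q) (h' : N' = p + n + q) : M.Inv (M.op t p q h h' x) := by
  induction t generalizing N p q N' with
  | gen g =>
    cases g
    · exact hx.brOp h h'
    · exact hx.ins h h'
  | id n => subst h h'; exact hx
  | swap m n => exact hx.swOp h h'
  | comp t t' ih ih' => exact ih' (ih hx h rfl) rfl h'
  | tens t t' ih ih' => exact ih' (ih hx (by omega) rfl) (by omega) (by omega)
  | zero => exact Inv.zero
  | add t t' ih ih' => exact (ih hx h h').add (ih' hx h h')
  | smul r t ih => exact (ih hx h h').smul r

theorem mulc_eq_ins {N : ℕ} (x : val M.A N) : M.mulc N x = M.ins N 0 rfl rfl x := by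
  rw [ins_apply, posOp_apply, pos_sw_zero_left, act_id]
  rfl

variable (M) in
-- The elements with this property form a submodule stable under the Lie action and under `mulc`,
-- and contain the generator; hence they are everything.
theorem inv {N : ℕ} (x : val M.A N) : M.Inv x := by
  refine M.generated (fun N =>
    { carrier := {x | M.Inv x}
      add_mem' := Inv.add
      zero_mem' := Inv.zero
      smul_mem' := fun r _ hx => hx.smul r }) ?_ ?_ ?_ x
  -- The generator has arity `0`, so there is no factor to test: `0 = a + 1 + b` is impossible.
  · intro a b h
    omega
  · intro N N' f x hx
    obtain ⟨t, rfl⟩ := exists_cls f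
    have e := M.op_map t (a := 0) (b := 0) (N := N) (N' := N') (Nat.zero_add N).symm
      (Nat.zero_add N').symm x
    rw [posOp_apply, pos_zero_zero] at e
    change M.Inv (M.A.act (cls (LieRel K) t) x)
    rw [← e]
    exact Inv.op _ hx _ _
  · intro N x hx
    change M.Inv (M.mulc N x)
    rw [mulc_eq_ins]
    exact Inv.ins hx _ _

/-- Congruent expressions define the same operation. -/
theorem op_eq {m n : ℕ} {t t' : Term K LieCGen m n} (ht : Rel (LieCRel K) t t') {a b N N' : ℕ}
    (h : N = a + m + b) (h' : N' = a + n + b) (x : val M.A N) :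
    M.op t a b h h' x = M.op t' a b h h' x := by
  refine M.isRep.den_eq ?_ ht h h' x
  rintro _ _ _ _ (⟨hR⟩ | _ | _) a b N N' h h' x
  · refine (M.op_map _ h h' x).trans (Eq.trans ?_ (M.op_map _ h h' x).symm)
    rw [cls_eq (Rel.of (by assumption))]
  · have e := den_comp (g := M.genOp) (s := M.swOp) (casLieC K) (.swap 1 1 : Term K LieCGen 2 2)
      h h' h' x
    exact e.trans (M.swOp_ins h h' x)
  -- Invariance is the one relation which is not imposed on a `CasimirModule` but derived.
  · exact (M.inv x).eq h h'

end CasimirModule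

/-! ### The universal property of the tensor algebra -/

section Powers

universe v w

variable {C : Type w} [Category.{v} C] [MonoidalCategory C]

/-- The morphism from a tensor power of `X` to an algebra `A` given by a morphism `X ⟶ A`. -/
def tpowLift {X A : C} [MonObj A] (i : X ⟶ A) : ∀ d : ℕ, tpow X d ⟶ A
  | 0 => MonObj.one
  | d + 1 => (tpowLift i d ⊗ₘ i) ≫ MonObj.mul

/-- Multiplicativity of the extension, on each pair of tensor powers. Induction on the second
exponent, the inductive step being associativity of `A`. -/
theorem tpowMul_tpowLift {X A : C} [MonObj A] (i : X ⟶ A) (a b : ℕ) :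
    tpowMul X a b ≫ tpowLift i (a + b) = (tpowLift i a ⊗ₘ tpowLift i b) ≫ MonObj.mul := by
  induction b with
  | zero =>
    change (ρ_ (tpow X a)).hom ≫ tpowLift i a = (tpowLift i a ⊗ₘ MonObj.one) ≫ MonObj.mul
    rw [MonoidalCategory.tensorHom_def, Category.assoc, MonObj.mul_one, rightUnitor_naturality]
  | succ b ih =>
    change ((α_ (tpow X a) (tpow X b) X).inv ≫ tpowMul X a b ▷ X) ≫
      (tpowLift i (a + b) ⊗ₘ i) ≫ MonObj.mul =
      (tpowLift i a ⊗ₘ ((tpowLift i b ⊗ₘ i) ≫ MonObj.mul)) ≫ MonObj.mul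
    have e1 : tpowMul X a b ▷ X ≫ (tpowLift i (a + b) ⊗ₘ i) =
        ((tpowLift i a ⊗ₘ tpowLift i b) ⊗ₘ i) ≫ (MonObj.mul ▷ A) := by
      rw [← tensorHom_id, ← tensorHom_id, tensorHom_comp_tensorHom, tensorHom_comp_tensorHom, ih,
        Category.id_comp, Category.comp_id]
    have e2 : (tpowLift i a ⊗ₘ ((tpowLift i b ⊗ₘ i) ≫ MonObj.mul)) =
        (tpowLift i a ⊗ₘ (tpowLift i b ⊗ₘ i)) ≫ (A ◁ MonObj.mul) := by
      rw [← id_tensorHom, tensorHom_comp_tensorHom, Category.comp_id]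
    rw [Category.assoc, ← Category.assoc (_ ▷ X), e1, e2, Category.assoc, Category.assoc,
      MonObj.mul_assoc, associator_naturality_assoc, Iso.inv_hom_id_assoc]

end Powers

namespace LinMod

/-! ### Quotients and direct sums of modules -/

section QuotientsSums

variable {K : Type u} [CommRing K] {P : Type} [Category.{u} P] [Preadditive P] [Linear K P]

/-- The quotient of a module by a family of subspaces stable under the action. -/
def quot (M : LinMod K P) (S : ∀ X, Submodule K (M.obj X))
    (hS : ∀ {X Y : P} (f : X ⟶ Y), ∀ x ∈ S X, M.act f x ∈ S Y) : LinMod K P where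
  functor :=
    { obj X := ModuleCat.of K (M.obj X ⧸ S X)
      map f := ModuleCat.ofHom ((S _).mapQ (S _) (M.act f) (hS f))
      map_id X := modLinExt fun x => by
        obtain ⟨x, rfl⟩ := (S X).mkQ_surjective x
        exact congrArg (S X).mkQ (M.act_id X x)
      map_comp f g := modLinExt fun x => by
        obtain ⟨x, rfl⟩ := (S _).mkQ_surjective x
        exact congrArg (S _).mkQ (M.act_comp f g x) }
  additive := ⟨modLinExt fun x => by
    obtain ⟨x, rfl⟩ := (S _).mkQ_surjective x
    exact congrArg (S _).mkQ (M.act_add _ _ x)⟩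
  linear := ⟨fun f a => modLinExt fun x => by
    obtain ⟨x, rfl⟩ := (S _).mkQ_surjective x
    exact congrArg (S _).mkQ (M.act_smul a f x)⟩

variable (M : LinMod K P) (S : ∀ X, Submodule K (M.obj X))
  (hS : ∀ {X Y : P} (f : X ⟶ Y), ∀ x ∈ S X, M.act f x ∈ S Y)

/-- The projection to a quotient. -/
def quotMk : M ⟶ M.quot S hS := mkHom (fun Z => (S Z).mkQ) fun _ _ => rfl

theorem quotMk_surjective (Z : P) : Function.Surjective (ap (quotMk M S hS) Z) :=
  (S Z).mkQ_surjective

theorem quotMk_eq_zero {Z : P} {x : M.obj Z} : ap (quotMk M S hS) Z x = 0 ↔ x ∈ S Z :=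
  Submodule.Quotient.mk_eq_zero _

/-- The linear map out of a quotient. -/
def quotLift {Z : P} {W : Type u} [AddCommGroup W] [Module K W] (φ : M.obj Z →ₗ[K] W)
    (h : ∀ x ∈ S Z, φ x = 0) : (M.quot S hS).obj Z →ₗ[K] W := (S Z).liftQ φ h

/-- The morphism out of a direct sum given by its restrictions to the summands. -/
def dsumHom {M : ℕ → LinMod K P} {Q : LinMod K P} (φ : ∀ d, M d ⟶ Q) : dsum M ⟶ Q :=
  mkHom (fun Z => dsumLift fun d => ap (φ d) Z) fun {X Y} f x => LinearMap.congr_fun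
    (f := (dsumLift fun d => ap (φ d) Y).comp ((dsum M).act f))
    (g := (Q.act f).comp (dsumLift fun d => ap (φ d) X))
    (dsum_linear_ext fun d x => by
      rw [LinearMap.comp_apply, LinearMap.comp_apply, ← ap_act, dsumLift_incl, dsumLift_incl,
        ap_act]) x

theorem incl_dsumHom {M : ℕ → LinMod K P} {Q : LinMod K P} (φ : ∀ d, M d ⟶ Q) (d : ℕ) :
    incl M d ≫ dsumHom φ = φ d :=
  hom_ext fun Z x => dsumLift_incl (fun d => ap (φ d) Z) d x

end QuotientsSums

/-! ### The algebra morphism out of the tensor algebra -/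

section Algebra

variable {K : Type u} [CommRing K] {P : Type} [Category.{u} P] [Preadditive P] [Linear K P]
  [MonoidalCategory P] [MonoidalPreadditive P] [MonoidalLinear K P]

section Lift

variable {X : LinMod K P} (A : LinMod K P) [MonObj A] (i : X ⟶ A)

/-- The morphism from the tensor algebra on `X` which extends a morphism from `X` to an algebra. -/
def tensorAlgDesc : tensorAlgObj X ⟶ A := dsumHom (tpowLift i)

theorem tincl_tensorAlgDesc (d : ℕ) : tincl X d ≫ tensorAlgDesc A i = tpowLift i d :=
  incl_dsumHom _ d

/-- Morphisms out of a Day convolution of direct sums are determined on pairs of summands, where the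
claim is `tpowMul_tpowLift`. -/
theorem tensorAlgMul_tensorAlgDesc : tensorAlgMul X ≫ tensorAlgDesc A i =
    (tensorAlgDesc A i ⊗ₘ tensorAlgDesc A i) ≫ MonObj.mul := by
  refine day_dsum_ext_right fun b => day_dsum_ext_left fun a => ?_
  have e : ∀ χ : tensorAlgObj X ⊗ tensorAlgObj X ⟶ A,
      incl (tpow X) a ▷ tpow X b ≫ tensorAlgObj X ◁ incl (tpow X) b ≫ χ =
        (tincl X a ⊗ₘ tincl X b) ≫ χ := fun χ => by
    rw [MonoidalCategory.tensorHom_def, Category.assoc]; rfl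
  refine (e _).trans (Eq.trans ?_ (e _).symm)
  rw [← Category.assoc, tincl_mul, Category.assoc, tincl_tensorAlgDesc, tpowMul_tpowLift,
    ← Category.assoc, tensorHom_comp_tensorHom, tincl_tensorAlgDesc, tincl_tensorAlgDesc]

end Lift

/-- The morphism of algebras from the tensor algebra on `X` which extends a morphism `X ⟶ A`. -/
def tensorAlgLift {X : LinMod K P} (A : Mon (LinMod K P)) (i : X ⟶ A.X) : tensorAlg X ⟶ A where
  hom := tensorAlgDesc A.X i
  isMonHom_hom :=
    { one_hom := tincl_tensorAlgDesc A.X i 0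
      mul_hom := tensorAlgMul_tensorAlgDesc A.X i }

theorem ofTpow_tensorAlgLift {X : LinMod K P} (A : Mon (LinMod K P)) (i : X ⟶ A.X) (d : ℕ) :
    ofTpow X d ≫ (tensorAlgLift A i).hom = tpowLift i d := tincl_tensorAlgDesc A.X i d

theorem ofGen_tensorAlgLift {X : LinMod K P} (A : Mon (LinMod K P)) (i : X ⟶ A.X) :
    ofGen X ≫ (tensorAlgLift A i).hom = i := by
  refine (Category.assoc _ _ _).trans
    ((congrArg (fun f => (λ_ X).inv ≫ f) (ofTpow_tensorAlgLift A i 1)).trans ?_)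
  change (λ_ X).inv ≫ (MonObj.one ⊗ₘ i) ≫ MonObj.mul = i
  rw [MonoidalCategory.tensorHom_def', Category.assoc, MonObj.one_mul, leftUnitor_naturality,
    Iso.inv_hom_id_assoc]

/-! ### Multiplication along a morphism -/

section MulAlong

variable (A : Mon (LinMod K P)) {X Y Z : P}

/-- The linear map `x ↦ mulAlong A h x y`. -/
def mulAlongL (h : X ⊗ Y ⟶ Z) (y : A.X.obj Y) : A.X.obj X →ₗ[K] A.X.obj Z :=
  (ap (MonObj.mul (X := A.X)) Z).comp (dmkL h y)

/-- The linear map `y ↦ mulAlong A h x y`. -/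
def mulAlongR (h : X ⊗ Y ⟶ Z) (x : A.X.obj X) : A.X.obj Y →ₗ[K] A.X.obj Z :=
  (ap (MonObj.mul (X := A.X)) Z).comp (dmkR h x)

theorem mulAlongL_apply (h : X ⊗ Y ⟶ Z) (x : A.X.obj X) (y : A.X.obj Y) :
    mulAlongL A h y x = mulAlong A h x y := rfl

theorem mulAlongR_apply (h : X ⊗ Y ⟶ Z) (x : A.X.obj X) (y : A.X.obj Y) :
    mulAlongR A h x y = mulAlong A h x y := rfl

theorem act_mulAlong {Z' : P} (k : Z ⟶ Z') (h : X ⊗ Y ⟶ Z) (x : A.X.obj X) (y : A.X.obj Y) :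
    A.X.act k (mulAlong A h x y) = mulAlong A (h ≫ k) x y := by
  rw [mulAlong, ← ap_act]
  exact congrArg _ (act_dmk k h x y)

theorem mulAlong_act_left {X' : P} (f : X ⟶ X') (h : X' ⊗ Y ⟶ Z) (x : A.X.obj X)
    (y : A.X.obj Y) : mulAlong A h (A.X.act f x) y = mulAlong A (f ▷ Y ≫ h) x y := by
  rw [mulAlong, dmk_act_left]; rfl

theorem mulAlong_act_right {Y' : P} (f : Y ⟶ Y') (h : X ⊗ Y' ⟶ Z) (x : A.X.obj X)
    (y : A.X.obj Y) : mulAlong A h x (A.X.act f y) = mulAlong A (X ◁ f ≫ h) x y := by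
  rw [mulAlong, dmk_act_right]; rfl

/-- The associativity axiom evaluated on `h ⊗ (g ⊗ x ⊗ y) ⊗ z`; the associator absorbs `g` into the
outer morphism. -/
theorem mulAlong_assoc {X Y B E Z : P} (h : E ⊗ B ⟶ Z) (g : X ⊗ Y ⟶ E) (x : A.X.obj X)
    (y : A.X.obj Y) (z : A.X.obj B) :
    mulAlong A h (mulAlong A g x y) z =
      mulAlong A ((α_ X Y B).inv ≫ g ▷ B ≫ h) x (mulAlong A (𝟙 (Y ⊗ B)) y z) := by
  have e := congrArg (fun f => ap f Z (dmk h (dmk g x y) z)) (MonObj.mul_assoc A.X)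
  change ap MonObj.mul Z (ap (dayTensor MonObj.mul (𝟙 A.X)) Z (dmk h (dmk g x y) z)) =
    ap MonObj.mul Z (ap (dayTensor (𝟙 A.X) MonObj.mul) Z (ap (assocHom A.X A.X A.X) Z
      (dmk h (dmk g x y) z))) at e
  rw [dayTensor_dmk, assocHom_dmk, dayTensor_dmk] at e
  exact e

theorem ap_mulAlong {A B : Mon (LinMod K P)} (φ : A ⟶ B) (h : X ⊗ Y ⟶ Z) (x : A.X.obj X)
    (y : A.X.obj Y) :
    ap φ.hom Z (mulAlong A h x y) = mulAlong B h (ap φ.hom X x) (ap φ.hom Y y) := by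
  have e := congrArg (fun f => ap f Z (dmk h x y)) (IsMonHom.mul_hom φ.hom)
  change ap φ.hom Z (ap MonObj.mul Z _) = ap MonObj.mul Z (ap (dayTensor φ.hom φ.hom) Z _) at e
  rw [dayTensor_dmk] at e
  exact e

end MulAlong

/-! ### The grading of the tensor algebra -/

section TensorAlgebra

variable (X : LinMod K P)

theorem mulAlong_ofTpow (i j : ℕ) {A B Z : P} (h : A ⊗ B ⟶ Z) (x : (tpow X i).obj A)
    (y : (tpow X j).obj B) :
    mulAlong (tensorAlg X) h (ap (ofTpow X i) A x) (ap (ofTpow X j) B y) =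
      ap (ofTpow X (i + j)) Z (ap (tpowMul X i j) Z (dmk h x y)) :=
  dsumDesc_dmk _ h x y

/-- The first tensor power is `𝟙_ ⊗ X`, not `X`, so a generator enters through a unitor. That unitor
cancels against the associator and right unitor in `tpowMul X d 1`. -/
theorem mulAlong_ofTpow_ofGen (d : ℕ) {A B Z : P} (h : A ⊗ B ⟶ Z) (x : (tpow X d).obj A)
    (y : X.obj B) :
    mulAlong (tensorAlg X) h (ap (ofTpow X d) A x) (ap (ofGen X) B y) =
      ap (ofTpow X (d + 1)) Z (dmk (M := tpow X d) (N := X) h x y) := by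
  have e : ap (tpowMul X d 1) Z (dmk h x (ap (λ_ X).inv B y)) =
      dmk (M := tpow X d) (N := X) h x y := by
    have e1 : (tpow X d) ◁ (λ_ X).inv ≫ tpowMul X d 1 = 𝟙 (tpow X d ⊗ X) := by
      change (tpow X d) ◁ (λ_ X).inv ≫ (α_ _ (𝟙_ _) X).inv ≫ (ρ_ (tpow X d)).hom ▷ X = _
      simp
    have e2 := congrArg (fun f => ap f Z (dmk (M := tpow X d) (N := X) h x y)) e1
    change ap (tpowMul X d 1) Z (ap (dayTensor (𝟙 _) (λ_ X).inv) Z _) = _ at e2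
    rw [dayTensor_dmk] at e2
    exact e2
  exact (mulAlong_ofTpow X d 1 h x (ap (λ_ X).inv B y)).trans (congrArg _ e)

theorem ofTpow_tensorTriple {A B Z : P} (f : A ⊗ B ⟶ Z) (x : X.obj A) (y : X.obj B) :
    ap (ofTpow X 2) Z (tensorTriple f x y) =
      mulAlong (tensorAlg X) f (ap (ofGen X) A x) (ap (ofGen X) B y) :=
  (mulAlong_ofTpow_ofGen X 1 f _ y).symm

theorem tensorAlg_induction {Z : P} {p : (tensorAlg X).X.obj Z → Prop}
    (t : (tensorAlg X).X.obj Z) (zero : p 0) (ofTpow : ∀ d x, p (ap (ofTpow X d) Z x))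
    (add : ∀ s t, p s → p t → p (s + t)) : p t :=
  dsum_induction t zero ofTpow add

/-- Degree `d + 1` is spanned by the products of an element of degree `d` and a generator. This is
the inductive step of every argument on the degree. -/
theorem ofTpow_succ_mem {d : ℕ} {Z : P} (S : Submodule K ((tensorAlg X).X.obj Z))
    (hS : ∀ (A B : P) (h : A ⊗ B ⟶ Z) (x : (tpow X d).obj A) (y : X.obj B),
      mulAlong (tensorAlg X) h (ap (ofTpow X d) A x) (ap (ofGen X) B y) ∈ S)
    (x : (tpow X (d + 1)).obj Z) : ap (ofTpow X (d + 1)) Z x ∈ S := by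
  let φ : (day (tpow X d) X).obj Z →ₗ[K] (tensorAlg X).X.obj Z := ap (ofTpow X (d + 1)) Z
  change φ x ∈ S
  induction x using dinduction with
  | zero => exact (map_zero φ).symm ▸ S.zero_mem
  | add s t hs ht => exact (map_add φ s t).symm ▸ S.add_mem hs ht
  | mk A B h x y => exact mulAlong_ofTpow_ofGen X d h x y ▸ hS A B h x y

theorem isGrading_tensorAlg : IsGrading (tensorAlg X) (tensorAlgDeg X) where
  act_mem := by
    rintro d Z Z' f _ ⟨x, rfl⟩
    exact ⟨(tpow X d).act f x, ap_act _ _ _⟩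
  one_mem Z g := ⟨g, rfl⟩
  mul_mem := by
    rintro d e A B Z h _ ⟨x, rfl⟩ _ ⟨y, rfl⟩
    exact ⟨_, (mulAlong_ofTpow X d e h x y).symm⟩
  isInternal Z := by
    refine DirectSum.isInternal_submodule_of_iSupIndep_of_iSup_eq_top ?_ ?_
    · intro d
      rw [Submodule.disjoint_def]
      rintro _ ⟨x, rfl⟩ hx
      -- The projection to the summand of index `d` kills all the other summands and is injective on
      -- this one.
      have hle : ⨆ e, ⨆ _ : e ≠ d, tensorAlgDeg X e Z ≤
          LinearMap.ker (DirectSum.component K ℕ (fun d => (tpow X d).obj Z) d) := by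
        refine iSup₂_le fun e he => ?_
        rintro _ ⟨y, rfl⟩
        exact (DirectSum.component.of (R := K) (M := fun d => (tpow X d).obj Z) d e y).trans
          (dif_neg he)
      have h0 : x = 0 := by
        refine Eq.trans ?_ (hle hx)
        exact (DirectSum.component.lof_self (R := K) (M := fun d => (tpow X d).obj Z) d x).symm
      rw [h0, map_zero]
    · rw [eq_top_iff]
      intro t _
      induction t using tensorAlg_induction with
      | zero => exact zero_mem _
      | ofTpow d x => exact Submodule.mem_iSup_of_mem d ⟨x, rfl⟩
      | add s t hs ht => exact add_mem (hs trivial) (ht trivial)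

end TensorAlgebra

/-! ### Ideals -/

section Ideal

variable (A : Mon (LinMod K P))

/-- The ideal is defined object by object as an infimum of values of ideals. This form lets one
ideal serve for all objects at once. -/
theorem mem_idealSpan {S : Set (Σ Z : P, A.X.obj Z)} {Z : P} {x : A.X.obj Z} :
    x ∈ idealSpan A S Z ↔ ∀ I : ∀ Z : P, Submodule K (A.X.obj Z), IsTwoSidedIdeal A I →
      (∀ s ∈ S, s.2 ∈ I s.1) → x ∈ I Z := by
  simp only [idealSpan, Submodule.mem_sInf, Set.mem_ofPred_eq]
  constructor
  · intro h I hI hS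
    exact h _ ⟨I, hI, hS, rfl⟩
  · rintro h _ ⟨I, hI, hS, rfl⟩
    exact h I hI hS

theorem isTwoSidedIdeal_idealSpan (S : Set (Σ Z : P, A.X.obj Z)) :
    IsTwoSidedIdeal A (idealSpan A S) where
  act_mem f x hx := (mem_idealSpan A).2 fun I hI hS =>
    hI.act_mem f x ((mem_idealSpan A).1 hx I hI hS)
  mul_mem_left h a x hx := (mem_idealSpan A).2 fun I hI hS =>
    hI.mul_mem_left h a x ((mem_idealSpan A).1 hx I hI hS)
  mul_mem_right h x hx a := (mem_idealSpan A).2 fun I hI hS =>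
    hI.mul_mem_right h x ((mem_idealSpan A).1 hx I hI hS) a

theorem subset_idealSpan {S : Set (Σ Z : P, A.X.obj Z)} {s : Σ Z : P, A.X.obj Z} (hs : s ∈ S) :
    s.2 ∈ idealSpan A S s.1 :=
  (mem_idealSpan A).2 fun _ _ hS => hS s hs

theorem isTwoSidedIdeal_ker {A B : Mon (LinMod K P)} (φ : A ⟶ B) :
    IsTwoSidedIdeal A fun Z => LinearMap.ker (ap φ.hom Z) where
  act_mem f x hx := by
    rw [LinearMap.mem_ker] at hx ⊢
    rw [ap_act, hx, map_zero]
  mul_mem_left h a x hx := by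
    rw [LinearMap.mem_ker] at hx ⊢
    rw [ap_mulAlong, hx, ← mulAlongR_apply, map_zero]
  mul_mem_right h x hx a := by
    rw [LinearMap.mem_ker] at hx ⊢
    rw [ap_mulAlong, hx, ← mulAlongL_apply, map_zero]

end Ideal

end Algebra

end LinMod

/-! ### Weights in presented PROPs -/

section Scale

variable {K : Type u} [CommRing K] {G : ℕ → ℕ → Type} (w : ∀ m n, G m n → ℕ) (u : K)

/-- Multiply each generator by the power of `u` given by its weight. -/
def Term.scale : ∀ {m n : ℕ}, Term K G m n → Term K G m n
  | _, _, gen g => smul (u ^ w _ _ g) (gen g)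
  | _, _, id n => id n
  | _, _, comp f g => comp (scale f) (scale g)
  | _, _, tens f g => tens (scale f) (scale g)
  | _, _, swap m n => swap m n
  | _, _, zero m n => zero m n
  | _, _, add f g => add (scale f) (scale g)
  | _, _, smul a f => smul a (scale f)

theorem Term.scale_ofEq {m n : ℕ} (h : m = n) :
    Term.scale w u (Term.ofEq h : Term K G m n) = Term.ofEq h := by
  subst h; rfl

variable {R : ∀ m n, Term K G m n → Term K G m n → Prop} {w u}

/-- The congruence axioms are stable under rescaling the generators, so only the defining relations
have to be checked. -/
theorem rel_scale (hR : ∀ m n f g, R m n f g → Rel R (f.scale w u) (g.scale w u)) {m n : ℕ}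
    {f g : Term K G m n} (h : Rel R f g) : Rel R (f.scale w u) (g.scale w u) := by
  induction h with
  | of h => exact hR _ _ _ _ h
  | symm _ ih => exact ih.symm
  | trans _ _ ih ih' => exact ih.trans ih'
  | comp_congr _ _ ih ih' => exact Rel.comp_congr ih ih'
  | tens_congr _ _ ih ih' => exact Rel.tens_congr ih ih'
  | add_congr _ _ ih ih' => exact Rel.add_congr ih ih'
  | smul_congr a _ ih => exact Rel.smul_congr a ih
  | tens_assoc => simp only [Term.scale, Term.scale_ofEq]; apply Rel.tens_assoc
  | id_zero_tens => simp only [Term.scale, Term.scale_ofEq]; apply Rel.id_zero_tens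
  | tens_id_zero => simp only [Term.scale, Term.scale_ofEq]; apply Rel.tens_id_zero
  | swap_add => simp only [Term.scale, Term.scale_ofEq]; apply Rel.swap_add
  | refl => exact Rel.refl ..
  | add_assoc => exact Rel.add_assoc ..
  | add_comm => exact Rel.add_comm ..
  | zero_add => exact Rel.zero_add ..
  | zero_smul => exact Rel.zero_smul ..
  | one_smul => exact Rel.one_smul ..
  | mul_smul => exact Rel.mul_smul ..
  | add_smul => exact Rel.add_smul ..
  | smul_add => exact Rel.smul_add ..
  | id_comp => exact Rel.id_comp ..
  | comp_id => exact Rel.comp_id ..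
  | assoc => exact Rel.assoc ..
  | add_comp => exact Rel.add_comp ..
  | smul_comp => exact Rel.smul_comp ..
  | comp_add => exact Rel.comp_add ..
  | comp_smul => exact Rel.comp_smul ..
  | id_tens_id => exact Rel.id_tens_id ..
  | tens_comp_tens => exact Rel.tens_comp_tens ..
  | add_tens => exact Rel.add_tens ..
  | smul_tens => exact Rel.smul_tens ..
  | tens_add => exact Rel.tens_add ..
  | tens_smul => exact Rel.tens_smul ..
  | tens_swap => exact Rel.tens_swap ..
  | swap_swap => exact Rel.swap_swap ..

/-- Generators of weight `0` are multiplied by `u ^ 0 = 1`. This covers relations that are sums,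
such as the Jacobi identity. -/
theorem rel_scale_map {H : ℕ → ℕ → Type} (φ : ∀ m n, H m n → G m n)
    (hφ : ∀ m n g, w m n (φ m n g) = 0) {m n : ℕ} (t : Term K H m n) :
    Rel R ((t.map φ).scale w u) (t.map φ) := by
  induction t with
  | gen g =>
    have e : u ^ w _ _ (φ _ _ g) = 1 := by rw [hφ, pow_zero]
    simp only [Term.map, Term.scale, e]
    exact Rel.one_smul _
  | comp _ _ ih ih' => exact Rel.comp_congr ih ih'
  | tens _ _ ih ih' => exact Rel.tens_congr ih ih'
  | add _ _ ih ih' => exact Rel.add_congr ih ih'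
  | smul a _ ih => exact Rel.smul_congr a ih
  | _ => exact Rel.refl _

/-- Composition and tensor product are bilinear, so the scalars come out and their exponents add up
to the weight. -/
theorem rel_scale_of_isMonomial {d m n : ℕ} {t : Term K G m n} (ht : t.IsMonomial w d) :
    Rel R (t.scale w u) (Term.smul (u ^ d) t) := by
  induction ht with
  | gen g => exact Rel.refl _
  | id | swap => exact (pow_zero u).symm ▸ (Rel.one_smul _).symm
  | @comp d e _ _ _ f g _ _ ih ih' =>
    refine (Rel.comp_congr ih ih').trans ((Rel.smul_comp _ _ _).trans
      ((Rel.smul_congr _ (Rel.comp_smul _ _ _)).trans ?_))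
    rw [pow_add]
    exact (Rel.mul_smul _ _ _).symm
  | @tens d e _ _ _ _ f g _ _ ih ih' =>
    refine (Rel.tens_congr ih ih').trans ((Rel.smul_tens _ _ _).trans
      ((Rel.smul_congr _ (Rel.tens_smul _ _ _)).trans ?_))
    rw [pow_add]
    exact (Rel.mul_smul _ _ _).symm

end Scale

/-! ### The weight decomposition of hom-spaces -/

namespace PresentedPROP

section Homog

variable {K : Type u} [CommRing K] {G : ℕ → ℕ → Type}
  {R : ∀ m n, Term K G m n → Term K G m n → Prop} {w : ∀ m n, G m n → ℕ}

theorem comp_mem_iSup_homog {X Y Z : PresentedPROP K G R} {f : X ⟶ Y} {g : Y ⟶ Z}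
    (hf : f ∈ ⨆ d, homog R w d X Y) (hg : g ∈ ⨆ d, homog R w d Y Z) :
    f ≫ g ∈ ⨆ d, homog R w d X Z := by
  induction hf using Submodule.iSup_induction' with
  | mem d x hx =>
    induction hg using Submodule.iSup_induction' with
    | mem e y hy => exact Submodule.mem_iSup_of_mem (d + e) (comp_mem_homog hx hy)
    | zero => rw [Limits.comp_zero]; exact zero_mem _
    | add _ _ _ _ h h' => rw [Preadditive.comp_add]; exact add_mem h h'
  | zero => rw [Limits.zero_comp]; exact zero_mem _
  | add _ _ _ _ h h' => rw [Preadditive.add_comp]; exact add_mem h h'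

theorem tensHom_mem_iSup_homog {X Y X' Y' : PresentedPROP K G R} {f : X ⟶ Y} {g : X' ⟶ Y'}
    (hf : f ∈ ⨆ d, homog R w d X Y) (hg : g ∈ ⨆ d, homog R w d X' Y') :
    f ⊗ₘ g ∈ ⨆ d, homog R w d (X ⊗ X') (Y ⊗ Y') := by
  induction hf using Submodule.iSup_induction' with
  | mem d x hx =>
    induction hg using Submodule.iSup_induction' with
    | mem e y hy => exact Submodule.mem_iSup_of_mem (d + e) (tensHom_mem_homog hx hy)
    | zero => rw [MonoidalPreadditive.tensor_zero]; exact zero_mem _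
    | add _ _ _ _ h h' => rw [MonoidalPreadditive.tensor_add]; exact add_mem h h'
  | zero => rw [MonoidalPreadditive.zero_tensor]; exact zero_mem _
  | add _ _ _ _ h h' => rw [MonoidalPreadditive.add_tensor]; exact add_mem h h'

/-- By induction on expressions, every morphism is a sum of homogeneous ones; composition and tensor
product expand bilinearly. -/
theorem iSup_homog (X Y : PresentedPROP K G R) : ⨆ d, homog R w d X Y = ⊤ := by
  have key : ∀ {m n : ℕ} (t : Term K G m n), cls R t ∈ ⨆ d, homog R w d (ob R m) (ob R n) := by
    intro m n t
    induction t with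
    | gen g =>
      exact Submodule.mem_iSup_of_mem _ (Submodule.subset_span ⟨_, Term.IsMonomial.gen g, rfl⟩)
    | id n => exact Submodule.mem_iSup_of_mem 0 (Submodule.subset_span ⟨_, .id n, rfl⟩)
    | swap m n => exact Submodule.mem_iSup_of_mem 0 (Submodule.subset_span ⟨_, .swap m n, rfl⟩)
    | zero m n => exact (⨆ d, homog R w d (ob R m) (ob R n)).zero_mem
    | add f g ih ih' => exact (⨆ d, homog R w d (ob R _) (ob R _)).add_mem ih ih'
    | smul a f ih => exact (⨆ d, homog R w d (ob R _) (ob R _)).smul_mem a ih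
    | @comp m n p f g ih ih' =>
      exact comp_mem_iSup_homog (f := cls R f) (g := cls R g) ih ih'
    | @tens m n m' n' f g ih ih' =>
      exact tensHom_mem_iSup_homog (f := cls R f) (g := cls R g) ih ih'
  rw [eq_top_iff]
  intro f _
  obtain ⟨t, rfl⟩ := exists_cls f
  exact key t

/-- The endomorphism of a hom-space which multiplies each generator by the power of `u` given by
its weight. -/
def scaleHom {u : K} (hR : ∀ m n f g, R m n f g → Rel R (f.scale w u) (g.scale w u))
    (X Y : PresentedPROP K G R) : Module.End K (X ⟶ Y) where
  toFun := Quotient.map (Term.scale w u) fun _ _ h => rel_scale hR h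
  map_add' := by rintro ⟨f⟩ ⟨g⟩; rfl
  map_smul' := by rintro a ⟨f⟩; rfl

end Homog

/-- The part of weight `d` lies in the eigenspace of `scaleHom` for `u ^ d`, and eigenspaces of
distinct eigenvalues are independent. -/
theorem iSupIndep_homog {K : Type u} [Field K] {G : ℕ → ℕ → Type}
    {R : ∀ m n, Term K G m n → Term K G m n → Prop} {w : ∀ m n, G m n → ℕ} {u : K}
    (hu : Function.Injective fun d : ℕ => u ^ d)
    (hR : ∀ m n f g, R m n f g → Rel R (f.scale w u) (g.scale w u)) (X Y : PresentedPROP K G R) :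
    iSupIndep fun d => homog R w d X Y := by
  refine ((Module.End.eigenspaces_iSupIndep (scaleHom hR X Y)).comp hu).mono fun d => ?_
  rw [homog, Submodule.span_le]
  rintro _ ⟨t, ht, rfl⟩
  exact Module.End.mem_eigenspace_iff.2 (cls_eq (rel_scale_of_isMonomial ht))

end PresentedPROP

/-! ### Homogeneity of the relations of a Casimir Lie algebra -/

section

variable (K : Type u) [CommRing K]

theorem casWeight_lieGenIncl (m n : ℕ) (g : LieGen m n) : casWeight m n (lieGenIncl m n g) = 0 := by
  cases g; rfl

/-- Symmetry and invariance equate two monomials of weight `1`, so both sides are multiplied by the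
same power of `u`. The Lie relations have weight `0` and are unchanged. -/
theorem rel_scale_lieCRel (u : K) {m n : ℕ} {f g : Term K LieCGen m n} (h : LieCRel K m n f g) :
    Rel (LieCRel K) (f.scale casWeight u) (g.scale casWeight u) := by
  have key : ∀ {d m n : ℕ} {f g : Term K LieCGen m n}, LieCRel K m n f g →
      f.IsMonomial casWeight d → g.IsMonomial casWeight d →
      Rel (LieCRel K) (f.scale casWeight u) (g.scale casWeight u) := fun h hf hg =>
    (rel_scale_of_isMonomial hf).trans
      ((Rel.smul_congr _ (Rel.of h)).trans (rel_scale_of_isMonomial hg).symm)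
  cases h with
  | of_lie h =>
    exact (rel_scale_map _ casWeight_lieGenIncl _).trans ((Rel.of (LieCRel.of_lie h)).trans
      (rel_scale_map _ casWeight_lieGenIncl _).symm)
  | symm => exact key .symm ((Term.IsMonomial.gen LieCGen.cas).comp (.swap 1 1)) (.gen LieCGen.cas)
  | invariant =>
    have hb : (brLieC K).IsMonomial casWeight 0 := .gen LieCGen.br
    have hc : (casLieC K).IsMonomial casWeight 1 := .gen LieCGen.cas
    exact key .invariant (((Term.IsMonomial.id 1).tens hc).comp (hb.tens (.id 1)))
      ((hc.tens (.id 1)).comp ((Term.IsMonomial.id 1).tens hb))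

/-! ### Morphisms from `0` in the PROP of Casimir Lie algebras -/

/-- The image of a morphism under the canonical functor. -/
def lieMap {m n : ℕ} (f : ob (LieRel K) m ⟶ ob (LieRel K) n) :
    ob (LieCRel K) m ⟶ ob (LieCRel K) n := (lieIncl K).map f

variable {K}

theorem lieMap_id (n : ℕ) : lieMap K (𝟙 (ob (LieRel K) n)) = 𝟙 _ := rfl

theorem lieMap_comp {m n p : ℕ} (f : ob (LieRel K) m ⟶ ob (LieRel K) n)
    (g : ob (LieRel K) n ⟶ ob (LieRel K) p) : lieMap K (f ≫ g) = lieMap K f ≫ lieMap K g :=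
  (lieIncl K).map_comp f g

theorem lieMap_tensor {m n m' n' : ℕ} (f : ob (LieRel K) m ⟶ ob (LieRel K) n)
    (g : ob (LieRel K) m' ⟶ ob (LieRel K) n') :
    lieMap K (m := m + m') (n := n + n') (f ⊗ₘ g) = lieMap K f ⊗ₘ lieMap K g := by
  obtain ⟨s, rfl⟩ := exists_cls f
  obtain ⟨t, rfl⟩ := exists_cls g
  rfl

theorem lieMap_eqIso {m n : ℕ} (h : m = n) :
    lieMap K (eqIso h : ob (LieRel K) m ≅ _).hom = (eqIso h).hom := by
  subst h; rfl

theorem lieMap_pos {a b m n N N' : ℕ} (f : ob (LieRel K) m ⟶ ob (LieRel K) n)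
    (h : N = a + m + b) (h' : N' = a + n + b) :
    lieMap K (pos a b f h h') = pos a b (lieMap K f) h h' := by
  have e : lieMap K (m := a + m + b) (n := a + n + b)
      ((𝟙 (ob (LieRel K) a) ⊗ₘ f) ⊗ₘ 𝟙 (ob (LieRel K) b)) =
      ((𝟙 (ob (LieCRel K) a) ⊗ₘ lieMap K f) ⊗ₘ 𝟙 (ob (LieCRel K) b)) :=
    (lieMap_tensor (m := a + m) (n := a + n) _ _).trans
      (congrArg (· ⊗ₘ 𝟙 (ob (LieCRel K) b)) (lieMap_tensor (𝟙 (ob (LieRel K) a)) f))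
  refine (lieMap_comp _ _).trans ?_
  refine congrArg₂ (· ≫ ·) (lieMap_eqIso h) ((lieMap_comp _ _).trans ?_)
  exact congrArg₂ (· ≫ ·) e (lieMap_eqIso h'.symm)

/-- The morphism `y ⊗ c`. -/
def mulCas {n : ℕ} (y : ob (LieCRel K) 0 ⟶ ob (LieCRel K) n) :
    ob (LieCRel K) 0 ⟶ ob (LieCRel K) (n + 2) := tensHom y (cls (LieCRel K) (casLieC K))

/-- The interchange law lets `y` be created first and `c` be inserted afterwards. -/
theorem mulCas_eq {n : ℕ} (y : ob (LieCRel K) 0 ⟶ ob (LieCRel K) n) :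
    mulCas y = y ≫ pos n 0 (cls (LieCRel K) (casLieC K)) rfl rfl := by
  have e1 : (pos n 0 (cls (LieCRel K) (casLieC K)) rfl rfl : ob (LieCRel K) (n + 0) ⟶ _) =
      𝟙 (ob (LieCRel K) n) ⊗ₘ cls (LieCRel K) (casLieC K) := pos_zero_right n _ rfl rfl
  have e2 : (y ⊗ₘ 𝟙 (ob (LieCRel K) 0) : ob (LieCRel K) 0 ⟶ ob (LieCRel K) n) = y :=
    eq_of_heq (tensor_id_heq y)
  have e3 : (y ⊗ₘ 𝟙 (ob (LieCRel K) 0)) ≫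
      (𝟙 (ob (LieCRel K) n) ⊗ₘ cls (LieCRel K) (casLieC K)) =
      y ⊗ₘ cls (LieCRel K) (casLieC K) := by
    rw [tensorHom_comp_tensorHom, Category.comp_id, Category.id_comp]
  exact e3.symm.trans (congrArg₂ (· ≫ ·) e2 e1.symm)

theorem mulCas_comp {m n : ℕ} (y : ob (LieCRel K) 0 ⟶ ob (LieCRel K) m)
    (f : ob (LieRel K) m ⟶ ob (LieRel K) n) :
    mulCas (y ≫ lieMap K f) = mulCas y ≫ lieMap K (m := m + 2) (n := n + 2)
      (f ⊗ₘ 𝟙 (ob (LieRel K) 2)) := by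
  have e : (y ≫ lieMap K f) ⊗ₘ cls (LieCRel K) (casLieC K) =
      (y ⊗ₘ cls (LieCRel K) (casLieC K)) ≫ (lieMap K f ⊗ₘ 𝟙 (ob (LieCRel K) 2)) := by
    rw [tensorHom_comp_tensorHom, Category.comp_id]
  exact e.trans (congrArg (fun t => mulCas y ≫ t) (lieMap_tensor f (𝟙 (ob (LieRel K) 2))).symm)

variable (K) in
/-- The morphism `c ⊗ ⋯ ⊗ c`. -/
def casPow : ∀ d : ℕ, ob (LieCRel K) 0 ⟶ ob (LieCRel K) (2 * d)
  | 0 => 𝟙 _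
  | d + 1 => mulCas (casPow d)

/-- The normal form: all Casimir elements can be created first. For the induction to go through
composites and tensor products, the monomial acts on a block, after a morphism that already has this
form with `e` copies. -/
theorem exists_casPow_comp_pos {d m n : ℕ} {t : Term K LieCGen m n} (ht : t.IsMonomial casWeight d)
    {a b N N' e : ℕ} (h : N = a + m + b) (h' : N' = a + n + b)
    (f : ob (LieRel K) (2 * e) ⟶ ob (LieRel K) N) :
    ∃ g : ob (LieRel K) (2 * (e + d)) ⟶ ob (LieRel K) N',
      (casPow K e ≫ lieMap K f) ≫ pos a b (cls (LieCRel K) t) h h' =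
        casPow K (e + d) ≫ lieMap K g := by
  have lie : ∀ {a b m n N N' e : ℕ} (h : N = a + m + b) (h' : N' = a + n + b)
      (f : ob (LieRel K) (2 * e) ⟶ ob (LieRel K) N) (k : ob (LieRel K) m ⟶ ob (LieRel K) n),
      ∃ g : ob (LieRel K) (2 * e) ⟶ ob (LieRel K) N',
        (casPow K e ≫ lieMap K f) ≫ pos a b (lieMap K k) h h' = casPow K e ≫ lieMap K g := by
    intro a b m n N N' e h h' f k
    refine ⟨f ≫ pos a b k h h', ?_⟩
    rw [lieMap_comp, lieMap_pos, Category.assoc]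
  induction ht generalizing a b N N' e with
  | gen g =>
    cases g with
    | br => exact lie h h' f (cls (LieRel K) (brLie K))
    | cas =>
      -- The new copy is the last factor of `casPow K (e + 1)`. It waits while `f` acts and is then
      -- moved left past the `b` factors on its right.
      refine ⟨(f ⊗ₘ 𝟙 (ob (LieRel K) 2)) ≫ pos a 0 (sw b 2) (N := N + 2) (N' := N') (by omega)
        (by omega), ?_⟩
      have e1 := pos_sw_natural' (R := LieCRel K) (a := a) (b := 0) (a' := N) (b' := b) (k := b)
        (N := N) (N₁ := N + 2) (N₂ := N) (N' := N')
        (cls (LieCRel K) (casLieC K)) (by omega) (by omega) (by omega) (by omega)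
        (by omega) (by omega) (by omega) (by omega) (by omega) (by omega)
      have e2 : pos a 0 (sw b 0 : ob (LieCRel K) (b + 0) ⟶ _) (N := N) (N' := N) (by omega)
          (by omega) = 𝟙 _ := by
        rw [sw_zero_right, pos_eqIso, eqIso_refl, Iso.refl_hom]
      rw [e2, Category.id_comp] at e1
      have e3 : casPow K (e + 1) ≫ lieMap K (m := 2 * e + 2) (n := N + 2)
          (f ⊗ₘ 𝟙 (ob (LieRel K) 2)) = mulCas (casPow K e ≫ lieMap K f) := (mulCas_comp _ _).symm
      refine (congrArg _ e1.symm).trans ?_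
      rw [← Category.assoc]
      refine (congrArg (· ≫ _) ((mulCas_eq _).symm.trans e3.symm)).trans ?_
      refine (Category.assoc _ _ _).trans (congrArg _ ?_)
      refine Eq.trans ?_ (lieMap_comp _ _).symm
      exact congrArg _ (lieMap_pos (sw b 2) _ _).symm
  | id n => exact lie h h' f (𝟙 _)
  | swap m n => exact lie h h' f (sw m n)
  | @comp d₁ d₂ m n p t t' _ _ ih ih' =>
    obtain ⟨g, hg⟩ := ih h rfl f
    obtain ⟨g', hg'⟩ := ih' rfl h' g
    have e1 := pos_comp a b (cls (LieCRel K) t) (cls (LieCRel K) t') h rfl h'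
    rw [← Nat.add_assoc]
    refine ⟨g', ?_⟩
    rw [← hg', ← hg, Category.assoc, Category.assoc, Category.assoc]
    exact congrArg (fun k => casPow K e ≫ lieMap K f ≫ k) e1
  | @tens d₁ d₂ m n m' n' t t' _ _ ih ih' =>
    obtain ⟨g, hg⟩ := ih (b := m' + b) (N' := a + n + (m' + b)) (by omega) rfl f
    obtain ⟨g', hg'⟩ := ih' (a := a + n) (b := b) (N' := N') (by omega) (by omega) g
    have e1 := pos_tens a b (cls (LieCRel K) t) (cls (LieCRel K) t') (a' := a + n) (b' := m' + b)
      (N'' := a + n + (m' + b)) rfl rfl h h' (by omega) rfl (by omega) (by omega)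
    rw [← Nat.add_assoc]
    refine ⟨g', ?_⟩
    rw [← hg', ← hg, Category.assoc, Category.assoc, Category.assoc]
    exact congrArg (fun k => casPow K e ≫ lieMap K f ≫ k) e1

theorem exists_casPow_comp_of_mem_homog {d n : ℕ} {y : ob (LieCRel K) 0 ⟶ ob (LieCRel K) n}
    (hy : y ∈ homog (LieCRel K) casWeight d (ob (LieCRel K) 0) (ob (LieCRel K) n)) :
    ∃ g : ob (LieRel K) (2 * d) ⟶ ob (LieRel K) n, y = casPow K d ≫ lieMap K g := by
  induction hy using Submodule.span_induction with
  | mem y hy =>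
    obtain ⟨t, ht, rfl⟩ := hy
    -- The start is the empty product of Casimir elements, the identity of `0`, with no padding.
    have key := exists_casPow_comp_pos ht (a := 0) (b := 0) (N := 0) (N' := n) (e := 0)
      (by simp) (by simp) (𝟙 _)
    rw [Nat.zero_add] at key
    obtain ⟨g, hg⟩ := key
    refine ⟨g, Eq.trans ?_ hg⟩
    rw [pos_zero_zero, lieMap_id, casPow, Category.comp_id, Category.id_comp]
  | zero => exact ⟨0, ((congrArg _ ((lieIncl K).map_zero _ _)).trans Limits.comp_zero).symm⟩
  | add _ _ _ _ h h' =>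
    obtain ⟨g, rfl⟩ := h
    obtain ⟨g', rfl⟩ := h'
    exact ⟨g + g', (Preadditive.comp_add _ _ _ _ _ _).symm.trans
      (congrArg _ ((lieIncl K).map_add).symm)⟩
  | smul r _ _ h =>
    obtain ⟨g, rfl⟩ := h
    exact ⟨r • g, (Linear.comp_smul _ _ _ _ _ _).symm.trans
      (congrArg _ ((lieIncl K).map_smul _ _).symm)⟩

end

/-! ### The algebra `C` -/

section AlgC

variable (K : Type u) [CommRing K]

/-- An element of `C` at `n` is a morphism from `0` to `n`. -/
def ofC {n : ℕ} : (algC K).X.obj (ob (LieRel K) n) →ₗ[K] (ob (LieCRel K) 0 ⟶ ob (LieCRel K) n) :=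
  LinearMap.id

variable {K}

/-- A morphism from `0` to `n`, as an element of `C`. -/
abbrev inC {n : ℕ} (y : ob (LieCRel K) 0 ⟶ ob (LieCRel K) n) :
    (algC K).X.obj (ob (LieRel K) n) := toC K (Z := ob (LieRel K) n) y

theorem one_algC {n : ℕ} (g : ob (LieRel K) 0 ⟶ ob (LieRel K) n) :
    ap (MonObj.one (X := (algC K).X)) (ob (LieRel K) n) (ofHom (K := K) g) = inC (lieMap K g) := by
  have e : (𝟙 (ob (LieCRel K) 0)) ≫ lieMap K g = lieMap K g := Category.id_comp _
  exact congrArg inC e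

/-- The multiplication of `C` is the restricted left unitor after the tensor constraint of the
restriction functor. Unwound, and with the unitor of the unit equal to the identity, it sends `h ⊗ y
⊗ z` to `h (y ⊗ z)`. -/
theorem mulAlong_inC {m n p : ℕ} (h : ob (LieRel K) (m + n) ⟶ ob (LieRel K) p)
    (y : ob (LieCRel K) 0 ⟶ ob (LieCRel K) m) (z : ob (LieCRel K) 0 ⟶ ob (LieCRel K) n) :
    mulAlong (algC K) (X := ob (LieRel K) m) (Y := ob (LieRel K) n) h (inC y) (inC z) =
      inC ((tensHom y z : ob (LieCRel K) 0 ⟶ ob (LieCRel K) (m + n)) ≫ lieMap K h) := by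
  have e1 : mulAlong (algC K) (X := ob (LieRel K) m) (Y := ob (LieRel K) n) h (inC y) (inC z) =
      toRes (M := corep K (𝟙_ (CatLieC K))) (lieIncl K) (ap (leftUnitHom (corep K (𝟙_ _)))
        ((lieIncl K).obj (ob (LieRel K) p))
        (dmk (M := corep K (𝟙_ (CatLieC K))) (N := corep K (𝟙_ (CatLieC K)))
          (Functor.LaxMonoidal.μ (lieIncl K) (ob (LieRel K) m) (ob (LieRel K) n) ≫
            (lieIncl K).map h) (ofHom y) (ofHom z))) :=
    congrArg (ap (resMap (lieIncl K) (leftUnitHom (corep K (𝟙_ (CatLieC K)))))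
      (ob (LieRel K) p)) (resTensor_dmk (lieIncl K) (corep K (𝟙_ (CatLieC K)))
        (corep K (𝟙_ (CatLieC K))) (X := ob (LieRel K) m) (Y := ob (LieRel K) n) h
        (ofHom y) (ofHom z))
  rw [e1, leftUnitHom_dmk]
  have e2 : z ≫ (λ_ (ob (LieCRel K) n)).inv ≫ (y ▷ ob (LieCRel K) n) ≫ 𝟙 _ ≫ lieMap K h =
      (λ_ (𝟙_ (CatLieC K))).inv ≫ (y ⊗ₘ z) ≫ lieMap K h := by
    rw [leftUnitor_inv_naturality_assoc, Category.id_comp, MonoidalCategory.tensorHom_def',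
      Category.assoc]
    rfl
  have e3 : (λ_ (𝟙_ (CatLieC K))).inv = 𝟙 _ := by
    have := eqIso_refl (R := LieCRel K) 0
    exact congrArg Iso.inv this
  rw [e3] at e2
  exact congrArg inC (e2.trans (Category.id_comp _))

theorem degC_eq (d n : ℕ) : degC K d (ob (LieRel K) n) =
    homog (LieCRel K) casWeight d (ob (LieCRel K) 0) (ob (LieCRel K) n) :=
  Submodule.map_id _

theorem inC_mem_degC {d n : ℕ} {y : ob (LieCRel K) 0 ⟶ ob (LieCRel K) n} :
    inC y ∈ degC K d (ob (LieRel K) n) ↔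
      y ∈ homog (LieCRel K) casWeight d (ob (LieCRel K) 0) (ob (LieCRel K) n) := by
  rw [degC_eq]; rfl

theorem lieMap_mem_homog {m n : ℕ} (f : ob (LieRel K) m ⟶ ob (LieRel K) n) :
    lieMap K f ∈ homog (LieCRel K) casWeight 0 (ob (LieCRel K) m) (ob (LieCRel K) n) := by
  obtain ⟨t, rfl⟩ := exists_cls f
  exact cls_mem_homog_zero lieGenIncl casWeight_lieGenIncl t

theorem isGrading_algC (K : Type u) [Field K] [CharZero K] : IsGrading (algC K) (degC K) where
  act_mem _ _ _ f := degC_act K f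
  one_mem := by
    rintro ⟨n⟩ g
    exact (one_algC g).symm ▸ inC_mem_degC.2 (lieMap_mem_homog g)
  mul_mem := by
    rintro d e ⟨l⟩ ⟨m⟩ ⟨n⟩ h x hx y hy
    have h1 := tensHom_mem_homog (inC_mem_degC.1 hx) (inC_mem_degC.1 hy)
    have h2 := comp_mem_homog h1 (lieMap_mem_homog h)
    exact (mulAlong_inC h (ofC K x) (ofC K y)).symm ▸ inC_mem_degC.2 h2
  isInternal := by
    rintro ⟨n⟩
    -- Characteristic `0` enters here: the powers of `2` are distinct eigenvalues.
    have h2 : Function.Injective fun d : ℕ => (2 : K) ^ d := fun a b hab => by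
      have h : ((2 ^ a : ℕ) : K) = ((2 ^ b : ℕ) : K) := by push_cast; exact hab
      exact Nat.pow_right_injective le_rfl (Nat.cast_injective h)
    refine DirectSum.isInternal_submodule_of_iSupIndep_of_iSup_eq_top ?_ ?_
    · have h := iSupIndep_homog (w := casWeight) h2
        (fun _ _ _ _ h => rel_scale_lieCRel K 2 h) (ob (LieCRel K) 0) (ob (LieCRel K) n)
      exact (funext fun d => degC_eq d n : (fun d => degC K d (ob (LieRel K) n)) = _) ▸ h
    · have h := iSup_homog (w := casWeight) (ob (LieCRel K) 0) (ob (LieCRel K) n)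
      exact (iSup_congr fun d => degC_eq d n).trans h

/-! ### The canonical morphism from the tensor algebra on `C₁` to `C` -/

variable (K) in
/-- The morphism of algebras which extends the inclusion of `C₁`. -/
def tensorToC : tensorAlg (modC₁ K) ⟶ algC K := tensorAlgLift (algC K) (inclC₁ K)

theorem ofGen_tensorToC : ofGen (modC₁ K) ≫ (tensorToC K).hom = inclC₁ K :=
  ofGen_tensorAlgLift _ _

variable (K) in
/-- The Casimir element, as an element of the tensor algebra. -/
def casT : (tensorAlg (modC₁ K)).X.obj (ob (LieRel K) 2) := ap (ofGen (modC₁ K)) _ (casimir K)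

variable (K) in
/-- The right multiplication by the Casimir element in the tensor algebra. -/
def mulCasT (n : ℕ) : (tensorAlg (modC₁ K)).X.obj (ob (LieRel K) n) →ₗ[K]
    (tensorAlg (modC₁ K)).X.obj (ob (LieRel K) (n + 2)) :=
  mulAlongL (tensorAlg (modC₁ K)) (X := ob (LieRel K) n) (Y := ob (LieRel K) 2)
    (𝟙 (ob (LieRel K) (n + 2))) (casT K)

variable (K) in
/-- The unit of the tensor algebra. -/
def oneT : (tensorAlg (modC₁ K)).X.obj (ob (LieRel K) 0) :=
  ap (ofTpow (modC₁ K) 0) (ob (LieRel K) 0) (ofHom (K := K) (𝟙 (ob (LieRel K) 0)))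

theorem mulCasT_apply {n : ℕ} (x : (tensorAlg (modC₁ K)).X.obj (ob (LieRel K) n)) :
    mulCasT K n x = mulAlong (tensorAlg (modC₁ K)) (X := ob (LieRel K) n) (Y := ob (LieRel K) 2)
      (𝟙 (ob (LieRel K) (n + 2))) x (casT K) := rfl

theorem tensorToC_casT :
    ap (tensorToC K).hom _ (casT K) = inC (cls (LieCRel K) (casLieC K)) :=
  congrArg (fun f => ap f (ob (LieRel K) 2) (casimir K)) (ofGen_tensorToC (K := K))

theorem tensorToC_oneT : ap (tensorToC K).hom _ (oneT K) = inC (𝟙 (ob (LieCRel K) 0)) := by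
  have e := congrArg (fun f => ap f (ob (LieRel K) 0) (ofHom (K := K) (𝟙 (ob (LieRel K) 0))))
    (ofTpow_tensorAlgLift (algC K) (inclC₁ K) 0)
  exact e.trans (one_algC (𝟙 (ob (LieRel K) 0)))

theorem tensorToC_mulCasT {n : ℕ} {x : (tensorAlg (modC₁ K)).X.obj (ob (LieRel K) n)}
    {y : ob (LieCRel K) 0 ⟶ ob (LieCRel K) n} (h : ap (tensorToC K).hom _ x = inC y) :
    ap (tensorToC K).hom _ (mulCasT K n x) = inC (mulCas y) := by
  rw [mulCasT_apply, ap_mulAlong, h, tensorToC_casT, mulAlong_inC, lieMap_id, Category.comp_id]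
  rfl

theorem tensorToC_mulAlong_casT {n : ℕ} (h : ob (LieRel K) 4 ⟶ ob (LieRel K) n) :
    ap (tensorToC K).hom _ (mulAlong (tensorAlg (modC₁ K)) (X := ob (LieRel K) 2)
      (Y := ob (LieRel K) 2) h (casT K) (casT K)) =
        inC (mulCas (cls (LieCRel K) (casLieC K)) ≫ lieMap K h) := by
  rw [ap_mulAlong, tensorToC_casT]
  exact mulAlong_inC (m := 2) (n := 2) h _ _

theorem tensorToC_mem_degC {L : Type u} [Field L] [CharZero L] (d : ℕ) (Z : CatLie L)
    (x : (tensorAlg (modC₁ L)).X.obj Z) (hx : x ∈ tensorAlgDeg (modC₁ L) d Z) :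
    ap (tensorToC L).hom Z x ∈ degC L d Z := by
  obtain ⟨x, rfl⟩ := hx
  induction d generalizing Z with
  | zero =>
    have e := congrArg (fun f => ap f Z x) (ofTpow_tensorAlgLift (algC L) (inclC₁ L) 0)
    exact e.symm ▸ (isGrading_algC L).one_mem Z x
  | succ d ih =>
    refine ofTpow_succ_mem (modC₁ L) ((degC L (d + 1) Z).comap (ap (tensorToC L).hom Z))
      (fun A B h x y => ?_) x
    rw [Submodule.mem_comap, ap_mulAlong]
    refine (isGrading_algC L).mul_mem d 1 h _ (ih A x) _ ?_
    have e : ap (tensorToC L).hom B (ap (ofGen (modC₁ L)) B y) = y.1 :=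
      congrArg (fun f => ap f B y) (ofGen_tensorToC (K := L))
    exact e.symm ▸ y.2

/-- The normal form with a single Casimir element: `C₁` is a cyclic module generated by `c`. -/
theorem exists_act_casimir {n : ℕ} (y : (modC₁ K).obj (ob (LieRel K) n)) :
    ∃ g : ob (LieRel K) 2 ⟶ ob (LieRel K) n, y = (modC₁ K).act g (casimir K) := by
  obtain ⟨y, hy⟩ := y
  obtain ⟨g, hg⟩ := exists_casPow_comp_of_mem_homog (y := ofC K y) (inC_mem_degC.1 hy)
  refine ⟨g, Subtype.ext ?_⟩
  have e : casPow K 1 = cls (LieCRel K) (casLieC K) := eq_of_heq (id_tensor_heq _)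
  rw [e] at hg
  exact congrArg inC hg

theorem mulAlong_casT {m n p : ℕ} (h : ob (LieRel K) (m + n) ⟶ ob (LieRel K) p)
    (x : (tensorAlg (modC₁ K)).X.obj (ob (LieRel K) m)) (g : ob (LieRel K) 2 ⟶ ob (LieRel K) n) :
    mulAlong (tensorAlg (modC₁ K)) (X := ob (LieRel K) m) (Y := ob (LieRel K) n) h x
        ((tensorAlg (modC₁ K)).X.act g (casT K)) =
      (tensorAlg (modC₁ K)).X.act
        ((ob (LieRel K) m ◁ g : ob (LieRel K) (m + 2) ⟶ ob (LieRel K) (m + n)) ≫ h)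
        (mulCasT K m x) := by
  rw [mulAlong_act_right, mulCasT_apply, act_mulAlong]
  exact congrArg (fun k => mulAlong (tensorAlg (modC₁ K)) k x (casT K)) (Category.id_comp _).symm

/-- The induction principle for the tensor algebra. Degree `d + 1` is spanned by products of degree
`d` with elements `g c`, and such a product is a Lie morphism applied to a right multiple by `c`. -/
theorem tensorAlgC₁_generated
    (S : ∀ n, Submodule K ((tensorAlg (modC₁ K)).X.obj (ob (LieRel K) n))) (one : oneT K ∈ S 0)
    (act : ∀ {m n : ℕ} (f : ob (LieRel K) m ⟶ ob (LieRel K) n), ∀ x ∈ S m,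
      (tensorAlg (modC₁ K)).X.act f x ∈ S n)
    (mul : ∀ {n : ℕ}, ∀ x ∈ S n, mulCasT K n x ∈ S (n + 2)) {n : ℕ}
    (x : (tensorAlg (modC₁ K)).X.obj (ob (LieRel K) n)) : x ∈ S n := by
  induction x using tensorAlg_induction with
  | zero => exact zero_mem _
  | add s t hs ht => exact add_mem hs ht
  | ofTpow d x =>
    induction d generalizing n with
    | zero =>
      have e : ap (ofTpow (modC₁ K) 0) (ob (LieRel K) n)
          ((corep K (𝟙_ (CatLie K))).act (toHom x) (ofHom (𝟙 (𝟙_ (CatLie K))))) =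
          (tensorAlg (modC₁ K)).X.act (toHom x) (oneT K) := ap_act _ _ _
      have e2 : (corep K (𝟙_ (CatLie K))).act (toHom x) (ofHom (𝟙 (𝟙_ (CatLie K)))) = x := by
        rw [act_ofHom, Category.id_comp]; rfl
      exact e2 ▸ e.symm ▸ act _ _ one
    | succ d ih =>
      refine ofTpow_succ_mem (modC₁ K) (S n) (fun X Y h x y => ?_) x
      obtain ⟨l⟩ := X
      obtain ⟨m⟩ := Y
      obtain ⟨g, rfl⟩ := exists_act_casimir y
      rw [ap_act]
      exact (mulAlong_casT h _ g).symm ▸ act _ _ (mul _ (ih x))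

/-- The powers `c ⊗ ⋯ ⊗ c` are images of powers in the tensor algebra, and by the normal form each
homogeneous element of `C` is obtained from one of them by a Lie morphism. -/
theorem tensorToC_surjective (Z : CatLie K) : Function.Surjective (ap (tensorToC K).hom Z) := by
  obtain ⟨n⟩ := Z
  have key : ∀ d, ∃ x, ap (tensorToC K).hom (ob (LieRel K) (2 * d)) x = inC (casPow K d) := by
    intro d
    induction d with
    | zero => exact ⟨_, tensorToC_oneT⟩
    | succ d ih =>
      obtain ⟨x, hx⟩ := ih
      exact ⟨_, tensorToC_mulCasT hx⟩
  have hle : ∀ d, homog (LieCRel K) casWeight d (ob (LieCRel K) 0) (ob (LieCRel K) n) ≤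
      LinearMap.range ((ofC K).comp (ap (tensorToC K).hom (ob (LieRel K) n))) := by
    intro d y hy
    obtain ⟨g, rfl⟩ := exists_casPow_comp_of_mem_homog hy
    obtain ⟨x, hx⟩ := key d
    refine ⟨(tensorAlg (modC₁ K)).X.act g x, ?_⟩
    rw [LinearMap.comp_apply, ap_act, hx]
    rfl
  have htop := iSup_le hle
  rw [iSup_homog, top_le_iff, LinearMap.range_eq_top] at htop
  exact htop

end AlgC

section Relations

variable (K : Type u) [CommRing K]

/-! ### The relations hold in `C` -/

/-- The Casimir element, as a morphism. -/
abbrev casC : ob (LieCRel K) 0 ⟶ ob (LieCRel K) 2 := cls (LieCRel K) (casLieC K)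

theorem casC_sw : casC K ≫ (sw 1 1 : ob (LieCRel K) 2 ⟶ ob (LieCRel K) 2) = casC K :=
  cls_eq (Rel.of LieCRel.symm)

theorem casC_invariant : pos 1 0 (casC K) (N := 1) (N' := 3) rfl rfl ≫
      pos 0 1 (lieMap K (lieBr K)) (N := 3) (N' := 2) rfl rfl =
    pos 0 1 (casC K) (N := 1) (N' := 3) rfl rfl ≫
      pos 1 0 (lieMap K (lieBr K)) (N := 3) (N' := 2) rfl rfl := by
  have e1 : (pos 1 0 (casC K) rfl rfl : ob (LieCRel K) 1 ⟶ ob (LieCRel K) 3) = _ :=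
    pos_zero_right 1 _ rfl rfl
  have e2 : (pos 0 1 (casC K) rfl rfl : ob (LieCRel K) 1 ⟶ ob (LieCRel K) 3) = _ :=
    pos_zero_left 1 _ rfl rfl
  have e3 : (pos 0 1 (lieMap K (lieBr K)) rfl rfl : ob (LieCRel K) 3 ⟶ ob (LieCRel K) 2) = _ :=
    pos_zero_left 1 _ rfl rfl
  have e4 : (pos 1 0 (lieMap K (lieBr K)) rfl rfl : ob (LieCRel K) 3 ⟶ ob (LieCRel K) 2) = _ :=
    pos_zero_right 1 _ rfl rfl
  rw [e1, e2, e3, e4]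
  exact cls_eq (Rel.of LieCRel.invariant)

/-- The relation `r_s` in `C`. Naturality turns the exchange of the two copies into the symmetry of
`0` with `0`, which is the identity; no property of `c` is needed. -/
theorem mulCas_casC_sw : mulCas (casC K) ≫ (sw 2 2 : ob (LieCRel K) 4 ⟶ ob (LieCRel K) 4) =
    mulCas (casC K) := by
  have e : mulCas (casC K) ≫ (sw 2 2 : ob (LieCRel K) 4 ⟶ ob (LieCRel K) 4) =
      (sw 0 0 : ob (LieCRel K) 0 ⟶ ob (LieCRel K) 0) ≫ mulCas (casC K) :=
    cls_eq (Rel.tens_swap (casLieC K) (casLieC K))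
  have e2 : (sw 0 0 : ob (LieCRel K) 0 ⟶ ob (LieCRel K) 0) = 𝟙 _ := by
    rw [sw_zero_right, eqIso_refl]; rfl
  rw [e, e2, Category.id_comp]

/-- The second copy of `c` is regarded as created first and the other one as inserted in front of
it, so that the inserted copy can be tested for invariance against the first leg of the other. -/
theorem mulCas_casC : mulCas (casC K) = casC K ≫ pos 0 2 (casC K) (N := 2) (N' := 4) rfl rfl := by
  have e1 : (pos 0 2 (casC K) rfl rfl : ob (LieCRel K) 2 ⟶ ob (LieCRel K) 4) =
      casC K ⊗ₘ 𝟙 (ob (LieCRel K) 2) := pos_zero_left 2 _ rfl rfl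
  have e2 : (𝟙 (ob (LieCRel K) 0) ⊗ₘ casC K : ob (LieCRel K) 0 ⟶ ob (LieCRel K) 2) = casC K :=
    eq_of_heq (id_tensor_heq (casC K))
  have e3 : (𝟙 (ob (LieCRel K) 0) ⊗ₘ casC K) ≫ (casC K ⊗ₘ 𝟙 (ob (LieCRel K) 2)) =
      casC K ⊗ₘ casC K := by
    rw [tensorHom_comp_tensorHom, Category.comp_id, Category.id_comp]
  exact e3.symm.trans (congrArg₂ (· ≫ ·) e2 e1.symm)

/-- With `c = ∑ a ⊗ b` and factors `y`, `z`, both sides produce `a ⊗ y ⊗ b ⊗ z`: from `a ⊗ b ⊗ y ⊗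
z` by exchanging `b` and `y`, and from `y ⊗ a ⊗ b ⊗ z` by exchanging `y` and `a`. -/
theorem casC_pos_perm : (pos 0 2 (casC K) rfl rfl : ob (LieCRel K) 2 ⟶ ob (LieCRel K) 4) ≫
      pos 1 1 (sw 1 1) rfl rfl =
    (pos 1 1 (casC K) rfl rfl : ob (LieCRel K) 2 ⟶ ob (LieCRel K) 4) ≫
      pos 0 2 (sw 1 1) rfl rfl := by
  have e := pos_sw_natural' (R := LieCRel K) (a := 0) (b := 1) (a' := 1) (b' := 2) (k := 1)
    (N := 2) (N₁ := 4) (N₂ := 2) (N' := 4) (casC K) rfl rfl rfl rfl rfl rfl rfl rfl rfl rfl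
  have e2 : pos 0 1 (sw 1 0 : ob (LieCRel K) (1 + 0) ⟶ _) (N := 2) (N' := 2) rfl rfl = 𝟙 _ := by
    rw [sw_zero_right, pos_eqIso, eqIso_refl, Iso.refl_hom]
  rw [e2, Category.id_comp, pos_sw_add (R := LieCRel K) (m := 1) (n := 1) (p := 1) (a := 0)
    (b := 1) (a' := 1) (b' := 2) (N := 4) (N₁ := 4) (N' := 4) rfl rfl rfl rfl rfl rfl rfl rfl] at e
  rw [← e, Category.assoc, Category.assoc]
  have e3 := pos_sw_sw (R := LieCRel K) (a := 1) (b := 1) (m := 1) (n := 1) (N := 4) (N' := 4)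
    rfl rfl
  exact congrArg _ ((congrArg _ e3).trans (Category.comp_id _))

theorem sw_lieMap_lieBr : (pos 0 2 (sw 1 1) rfl rfl : ob (LieCRel K) 4 ⟶ ob (LieCRel K) 4) ≫
    pos 0 2 (lieMap K (lieBr K)) (N' := 3) rfl rfl = -pos 0 2 (lieMap K (lieBr K)) rfl rfl := by
  have e : (sw 1 1 : ob (LieCRel K) 2 ⟶ ob (LieCRel K) 2) ≫ lieMap K (lieBr K) =
      -lieMap K (lieBr K) :=
    (lieMap_comp (sw 1 1) (lieBr K)).symm.trans
      ((congrArg (lieMap K) (sw_lieBr K)).trans ((lieIncl K).map_neg))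
  rw [← pos_neg, ← e]
  exact (pos_comp 0 2 (sw 1 1) (lieMap K (lieBr K)) rfl rfl rfl).symm

/-- The relation `r_c` in `C`. Writing the second copy as `∑ y ⊗ z`, one has `[a, y] ⊗ b ⊗ z = -[y,
a] ⊗ b ⊗ z = -a ⊗ [b, y] ⊗ z` after summation, by antisymmetry and invariance. -/
theorem mulCas_casC_relation : mulCas (casC K) ≫ lieMap K (perm23 K ≫ brId K) =
    -(mulCas (casC K) ≫ lieMap K (idBrId K)) := by
  have e1 : lieMap K (perm23 K ≫ brId K) = pos 1 1 (sw 1 1) (N := 4) (N' := 4) rfl rfl ≫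
      pos 0 2 (lieMap K (lieBr K)) (N := 4) (N' := 3) rfl rfl := by
    rw [perm23_eq, brId_eq]
    exact (lieMap_comp _ _).trans (congrArg₂ (· ≫ ·) (lieMap_pos _ _ _) (lieMap_pos _ _ _))
  have e2 : lieMap K (idBrId K) = pos 1 1 (lieMap K (lieBr K)) (N := 4) (N' := 3) rfl rfl := by
    rw [idBrId_eq]; exact lieMap_pos _ _ _
  have e3 : (pos 1 1 (casC K) rfl rfl : ob (LieCRel K) 2 ⟶ ob (LieCRel K) 4) ≫
      pos 0 2 (lieMap K (lieBr K)) (N := 4) (N' := 3) rfl rfl =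
      (pos 0 2 (casC K) rfl rfl : ob (LieCRel K) 2 ⟶ ob (LieCRel K) 4) ≫
      pos 1 1 (lieMap K (lieBr K)) (N := 4) (N' := 3) rfl rfl := by
    have e := congrArg (fun f => pos 0 1 f (N := 2) (N' := 3) rfl rfl) (casC_invariant K)
    have p1 := pos_comp (R := LieCRel K) 0 1 (pos 1 0 (casC K) (N := 1) (N' := 3) rfl rfl)
      (pos 0 1 (lieMap K (lieBr K)) (N := 3) (N' := 2) rfl rfl) (N := 2) (N' := 4) (N'' := 3)
      rfl rfl rfl
    have p2 := pos_comp (R := LieCRel K) 0 1 (pos 0 1 (casC K) (N := 1) (N' := 3) rfl rfl)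
      (pos 1 0 (lieMap K (lieBr K)) (N := 3) (N' := 2) rfl rfl) (N := 2) (N' := 4) (N'' := 3)
      rfl rfl rfl
    rw [pos_pos 0 1 1 0 _ rfl rfl _ _ (a' := 1) (b' := 1) rfl rfl rfl rfl,
      pos_pos 0 1 0 1 _ rfl rfl _ _ (a' := 0) (b' := 2) rfl rfl rfl rfl] at p1
    rw [pos_pos 0 1 0 1 _ rfl rfl _ _ (a' := 0) (b' := 2) rfl rfl rfl rfl,
      pos_pos 0 1 1 0 _ rfl rfl _ _ (a' := 1) (b' := 1) rfl rfl rfl rfl] at p2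
    exact p1.symm.trans (e.trans p2)
  rw [e1, e2, mulCas_casC, Category.assoc, Category.assoc, ← e3,
    ← Category.assoc (pos 0 2 (casC K) rfl rfl), casC_pos_perm, Category.assoc, sw_lieMap_lieBr,
    Preadditive.comp_neg, Preadditive.comp_neg]

/-! ### The quotient of the tensor algebra -/

/-- The two-sided ideal generated by the relations. -/
abbrev relIdeal (Z : CatLie K) : Submodule K ((tensorAlg (modC₁ K)).X.obj Z) :=
  idealSpan (tensorAlg (modC₁ K)) (relSet K) Z

theorem isTwoSidedIdeal_relIdeal : IsTwoSidedIdeal (tensorAlg (modC₁ K)) (relIdeal K) :=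
  isTwoSidedIdeal_idealSpan _ _

/-- The element `f ⊗ c ⊗ c` of the tensor algebra. -/
def casCasT {n : ℕ} (f : ob (LieRel K) 4 ⟶ ob (LieRel K) n) :
    (tensorAlg (modC₁ K)).X.obj (ob (LieRel K) n) :=
  mulAlong (tensorAlg (modC₁ K)) (X := ob (LieRel K) 2) (Y := ob (LieRel K) 2) f (casT K) (casT K)

theorem ofTpow_casCas {n : ℕ} (f : ob (LieRel K) 4 ⟶ ob (LieRel K) n) :
    ap (ofTpow (modC₁ K) 2) _ (casCas K f) = casCasT K f :=
  ofTpow_tensorTriple (modC₁ K) (A := ob (LieRel K) 2) (B := ob (LieRel K) 2) f _ _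

theorem ofTpow_relS : ap (ofTpow (modC₁ K) 2) _ (relS K) =
    casCasT K (𝟙 (ob (LieRel K) 4)) - casCasT K (perm1324 K) :=
  (map_sub _ _ _).trans (congrArg₂ _ (ofTpow_casCas K _) (ofTpow_casCas K _))

theorem ofTpow_relC : ap (ofTpow (modC₁ K) 2) _ (relC K) =
    casCasT K (perm23 K ≫ brId K) + casCasT K (idBrId K) :=
  (map_add _ _ _).trans (congrArg₂ _ (ofTpow_casCas K _) (ofTpow_casCas K _))

theorem relS_mem : casCasT K (𝟙 (ob (LieRel K) 4)) - casCasT K (perm1324 K) ∈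
    relIdeal K (ob (LieRel K) 4) :=
  ofTpow_relS K ▸ subset_idealSpan (tensorAlg (modC₁ K)) (S := relSet K) (Set.mem_insert _ _)

theorem relC_mem : casCasT K (perm23 K ≫ brId K) + casCasT K (idBrId K) ∈
    relIdeal K (ob (LieRel K) 3) :=
  ofTpow_relC K ▸ subset_idealSpan (tensorAlg (modC₁ K)) (S := relSet K)
    (Set.mem_insert_of_mem _ (Set.mem_singleton _))

/-- The kernel is a two-sided ideal, so it is enough that it contains the two generators. -/
theorem relIdeal_le_ker (Z : CatLie K) :
    relIdeal K Z ≤ LinearMap.ker (ap (tensorToC K).hom Z) := by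
  have e : ∀ {n : ℕ} (f : ob (LieRel K) 4 ⟶ ob (LieRel K) n),
      ap (tensorToC K).hom _ (casCasT K f) = inC (mulCas (casC K) ≫ lieMap K f) :=
    fun f => tensorToC_mulAlong_casT f
  intro x hx
  refine (mem_idealSpan _).1 hx _ (isTwoSidedIdeal_ker (tensorToC K)) ?_
  rintro _ (rfl | rfl)
  · refine LinearMap.mem_ker.2 ((congrArg _ (ofTpow_relS K)).trans ?_)
    rw [map_sub, e, e, sub_eq_zero]
    refine congrArg inC ?_
    rw [lieMap_id, Category.comp_id]
    exact (mulCas_casC_sw K).symm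
  · refine LinearMap.mem_ker.2 ((congrArg _ (ofTpow_relC K)).trans ?_)
    rw [map_add, e, e, mulCas_casC_relation]
    exact (congrArg (· + _) (map_neg (toC K) _)).trans (neg_add_cancel _)

theorem act_mem_relIdeal {X Y : CatLie K} (f : X ⟶ Y) (x : (tensorAlg (modC₁ K)).X.obj X)
    (hx : x ∈ relIdeal K X) : (tensorAlg (modC₁ K)).X.act f x ∈ relIdeal K Y :=
  (isTwoSidedIdeal_relIdeal K).act_mem f x hx

/-- The quotient of the tensor algebra on `C₁` by the relations. -/
def tensorQuot : LinMod K (CatLie K) :=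
  (tensorAlg (modC₁ K)).X.quot (relIdeal K) (act_mem_relIdeal K)

/-- The projection to the quotient. -/
def toQuot : (tensorAlg (modC₁ K)).X ⟶ tensorQuot K :=
  quotMk (tensorAlg (modC₁ K)).X (relIdeal K) (act_mem_relIdeal K)

theorem toQuot_surjective (Z : CatLie K) : Function.Surjective (ap (toQuot K) Z) :=
  quotMk_surjective (tensorAlg (modC₁ K)).X (relIdeal K) (act_mem_relIdeal K) Z

theorem toQuot_eq_zero {Z : CatLie K} {x : (tensorAlg (modC₁ K)).X.obj Z} :
    ap (toQuot K) Z x = 0 ↔ x ∈ relIdeal K Z :=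
  quotMk_eq_zero (tensorAlg (modC₁ K)).X (relIdeal K) (act_mem_relIdeal K)

theorem mulCasT_mem {n : ℕ} (x : (tensorAlg (modC₁ K)).X.obj (ob (LieRel K) n))
    (hx : x ∈ relIdeal K _) : mulCasT K n x ∈ relIdeal K (ob (LieRel K) (n + 2)) :=
  (isTwoSidedIdeal_relIdeal K).mul_mem_right (X := ob (LieRel K) n) (Y := ob (LieRel K) 2) _ x hx _

/-- The right multiplication by the Casimir element in the quotient. -/
def mulCasQ (n : ℕ) : val (tensorQuot K) n →ₗ[K] val (tensorQuot K) (n + 2) :=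
  quotLift (tensorAlg (modC₁ K)).X (relIdeal K) (act_mem_relIdeal K) ((ap (toQuot K) (ob (LieRel K) (n + 2))).comp (mulCasT K n))
    fun x hx => (toQuot_eq_zero K).2 (mulCasT_mem K x hx)

theorem mulCasQ_toQuot {n : ℕ} (x : (tensorAlg (modC₁ K)).X.obj (ob (LieRel K) n)) :
    mulCasQ K n (ap (toQuot K) _ x) = ap (toQuot K) _ (mulCasT K n x) := rfl

theorem mulCasT_act {m n : ℕ} (f : ob (LieRel K) m ⟶ ob (LieRel K) n)
    (x : (tensorAlg (modC₁ K)).X.obj (ob (LieRel K) m)) :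
    mulCasT K n ((tensorAlg (modC₁ K)).X.act f x) =
      (tensorAlg (modC₁ K)).X.act (X := ob (LieRel K) (m + 2)) (Y := ob (LieRel K) (n + 2))
        (f ⊗ₘ 𝟙 (ob (LieRel K) 2)) (mulCasT K m x) := by
  rw [mulCasT_apply, mulCasT_apply, mulAlong_act_left, act_mulAlong]
  exact congrArg (fun k => mulAlong (tensorAlg (modC₁ K)) k x (casT K))
    ((Category.comp_id _).trans (Category.id_comp _).symm)

/-- The symmetry of `c` already holds in `C₁`, whose elements are morphisms of the Casimir PROP.
This is why it does not appear among the quadratic relations. -/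
theorem act_sw_casT : (tensorAlg (modC₁ K)).X.act
    (sw 1 1 : ob (LieRel K) 2 ⟶ ob (LieRel K) 2) (casT K) = casT K := by
  rw [casT, ← ap_act]
  exact congrArg _ (Subtype.ext (congrArg inC (casC_sw K)))

theorem act_pos_mulAlong {m n n' : ℕ} (f : ob (LieRel K) n ⟶ ob (LieRel K) n')
    (x : (tensorAlg (modC₁ K)).X.obj (ob (LieRel K) m))
    (y : (tensorAlg (modC₁ K)).X.obj (ob (LieRel K) n)) :
    (tensorAlg (modC₁ K)).X.act (pos m 0 f (N := m + n) (N' := m + n') rfl rfl)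
      (mulAlong (tensorAlg (modC₁ K)) (X := ob (LieRel K) m) (Y := ob (LieRel K) n)
        (𝟙 (ob (LieRel K) (m + n))) x y) =
    mulAlong (tensorAlg (modC₁ K)) (X := ob (LieRel K) m) (Y := ob (LieRel K) n')
      (𝟙 (ob (LieRel K) (m + n'))) x ((tensorAlg (modC₁ K)).X.act f y) := by
  rw [act_mulAlong, mulAlong_act_right, pos_zero_right]
  exact congrArg (fun k => mulAlong (tensorAlg (modC₁ K)) k x y)
    ((Category.id_comp _).trans (Category.comp_id _).symm)

theorem act_casCasT {n : ℕ} (f : ob (LieRel K) 4 ⟶ ob (LieRel K) n) :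
    (tensorAlg (modC₁ K)).X.act f (casCasT K (𝟙 (ob (LieRel K) 4))) = casCasT K f := by
  rw [casCasT, act_mulAlong]
  exact congrArg (fun k => mulAlong (tensorAlg (modC₁ K)) k (casT K) (casT K)) (Category.id_comp f)

/-- Associativity, `(x c) c = x (c c)`: a relation between two copies of `c` can then be multiplied
on the left by `x` inside the ideal. -/
theorem mulCasT_mulCasT {n : ℕ} (x : (tensorAlg (modC₁ K)).X.obj (ob (LieRel K) n)) :
    mulCasT K (n + 2) (mulCasT K n x) =
      mulAlong (tensorAlg (modC₁ K)) (X := ob (LieRel K) n) (Y := ob (LieRel K) 4)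
        (𝟙 (ob (LieRel K) (n + 4))) x (casCasT K (𝟙 (ob (LieRel K) 4))) := by
  rw [mulCasT_apply, mulCasT_apply, mulAlong_assoc]
  refine congrArg (fun k : ob (LieRel K) (n + 4) ⟶ ob (LieRel K) (n + 4) =>
    mulAlong (tensorAlg (modC₁ K)) (X := ob (LieRel K) n) (Y := ob (LieRel K) 4)
      k x (casCasT K (𝟙 (ob (LieRel K) 4)))) ?_
  have e1 : (α_ (ob (LieRel K) n) (ob (LieRel K) 2) (ob (LieRel K) 2)).inv =
      𝟙 (ob (LieRel K) (n + 4)) := congrArg Iso.inv (eqIso_refl (R := LieRel K) (n + 4))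
  have e2 : 𝟙 (ob (LieRel K) (n + 2)) ▷ ob (LieRel K) 2 = 𝟙 (ob (LieRel K) (n + 4)) :=
    id_whiskerRight _ _
  refine (congrArg₂ (· ≫ ·) e1 (congrArg (· ≫ _) e2)).trans ?_
  exact (Category.id_comp _).trans (Category.id_comp _)

theorem act_pos_mulCasT_mulCasT {n p : ℕ} (f : ob (LieRel K) 4 ⟶ ob (LieRel K) p)
    (x : (tensorAlg (modC₁ K)).X.obj (ob (LieRel K) n)) :
    (tensorAlg (modC₁ K)).X.act (pos n 0 f (N := n + 2 + 2) (N' := n + p) rfl rfl)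
      (mulCasT K (n + 2) (mulCasT K n x)) =
    mulAlong (tensorAlg (modC₁ K)) (X := ob (LieRel K) n) (Y := ob (LieRel K) p)
      (𝟙 (ob (LieRel K) (n + p))) x (casCasT K f) := by
  rw [mulCasT_mulCasT, ← act_casCasT K f]
  exact act_pos_mulAlong K f x _

/-- The quotient of the tensor algebra on `C₁`, with the right multiplication by the Casimir
element. -/
def quotCasimirModule : CasimirModule K where
  A := tensorQuot K
  mulc := mulCasQ K
  mulc_act f x := by
    obtain ⟨x, rfl⟩ := toQuot_surjective K _ x
    rw [← ap_act, mulCasQ_toQuot, mulCasQ_toQuot, mulCasT_act, ap_act]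
  symm {n} x := by
    obtain ⟨x, rfl⟩ := toQuot_surjective K _ x
    rw [mulCasQ_toQuot, posOp_apply, ← ap_act]
    refine congrArg _ ((act_pos_mulAlong K (n := 2) (n' := 2) (sw 1 1) x (casT K)).trans ?_)
    rw [act_sw_casT]
    rfl
  comm {n} x := by
    obtain ⟨x, rfl⟩ := toQuot_surjective K _ x
    rw [mulCasQ_toQuot, mulCasQ_toQuot, posOp_apply, ← ap_act, eq_comm, ← sub_eq_zero, ← map_sub,
      toQuot_eq_zero]
    have e := act_pos_mulCasT_mulCasT K (n := n) (sw 2 2) x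
    -- The difference of the two sides is the product of `x` and `r_s`, hence in the ideal.
    have h := (isTwoSidedIdeal_relIdeal K).mul_mem_left (X := ob (LieRel K) n)
      (𝟙 (ob (LieRel K) (n + 4))) x _ (relS_mem K)
    rw [← mulAlongR_apply, map_sub] at h
    exact congrArg₂ (· - ·) (mulCasT_mulCasT K x) e ▸ h
  relation {n} x := by
    obtain ⟨x, rfl⟩ := toQuot_surjective K _ x
    rw [mulCasQ_toQuot, mulCasQ_toQuot, posOp_apply, posOp_apply, ← ap_act, ← ap_act,
      eq_neg_iff_add_eq_zero, ← map_add, toQuot_eq_zero]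
    -- The sum is the product of `x` and `r_c`, hence in the ideal.
    have h := (isTwoSidedIdeal_relIdeal K).mul_mem_left (X := ob (LieRel K) n)
      (𝟙 (ob (LieRel K) (n + 3))) x _ (relC_mem K)
    rw [← mulAlongR_apply, map_add] at h
    exact congrArg₂ (· + ·) (act_pos_mulCasT_mulCasT K (n := n) (perm23 K ≫ brId K) x)
      (act_pos_mulCasT_mulCasT K (n := n) (idBrId K) x) ▸ h
  one := ap (toQuot K) _ (oneT K)
  generated S one act mul {n} x := by
    obtain ⟨x, rfl⟩ := toQuot_surjective K _ x
    refine tensorAlgC₁_generated (fun n => (S n).comap (ap (toQuot K) (ob (LieRel K) n))) one ?_ ?_ x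
    · intro m n f x hx
      rw [Submodule.mem_comap, ap_act]
      exact act f _ hx
    · intro n x hx
      exact mul _ hx

end Relations

/-! ### The kernel of the canonical morphism -/

namespace CasimirModule

variable {K : Type u} [CommRing K] (M : CasimirModule K)

/-- The morphism from `C` to a module generated by the powers of the Casimir element. -/
def ofCasC (n : ℕ) : (ob (LieCRel K) 0 ⟶ ob (LieCRel K) n) →ₗ[K] val M.A n where
  toFun := Quotient.lift (fun t : Term K LieCGen 0 n => M.op t 0 0 rfl (by omega) M.one)
    fun _ _ h => M.op_eq h _ _ _
  map_add' := by rintro ⟨s⟩ ⟨t⟩; rfl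
  map_smul' := by rintro a ⟨t⟩; rfl

theorem ofCasC_id : M.ofCasC 0 (𝟙 _) = M.one := rfl

theorem ofCasC_comp {m n : ℕ} (y : ob (LieCRel K) 0 ⟶ ob (LieCRel K) m)
    (f : ob (LieRel K) m ⟶ ob (LieRel K) n) :
    M.ofCasC n (y ≫ lieMap K f) = M.A.act f (M.ofCasC m y) := by
  obtain ⟨s, rfl⟩ := exists_cls y
  obtain ⟨t, rfl⟩ := exists_cls f
  have e := den_comp (g := M.genOp) (s := M.swOp) s (t.map lieGenIncl) (a := 0) (b := 0) (N := 0)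
    (N₁ := m) (N' := n) rfl (Nat.zero_add m).symm (Nat.zero_add n).symm M.one
  refine e.trans ((M.op_map t _ _ _).trans ?_)
  rw [posOp_apply, pos_zero_zero]
  rfl

theorem ofCasC_mulCas {n : ℕ} (y : ob (LieCRel K) 0 ⟶ ob (LieCRel K) n) :
    M.ofCasC (n + 2) (mulCas y) = M.mulc n (M.ofCasC n y) := by
  obtain ⟨t, rfl⟩ := exists_cls y
  have e := den_tens (g := M.genOp) (s := M.swOp) t (casLieC K) (a := 0) (b := 0) (a' := n)
    (b' := 0) (N := 0) (N₁ := n) (N' := n + 2) (Nat.zero_add n).symm rfl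
    (Nat.zero_add (n + 2)).symm rfl (Nat.zero_add n).symm rfl rfl M.one
  exact e.trans (M.mulc_eq_ins _).symm

end CasimirModule

section Kernel

variable (K : Type u) [CommRing K]

/-- Both maps send the unit to the unit and commute with the Lie action and with right
multiplication by `c`; by the induction principle for the tensor algebra they agree. -/
theorem ofCasC_tensorToC {n : ℕ} (x : (tensorAlg (modC₁ K)).X.obj (ob (LieRel K) n)) :
    (quotCasimirModule K).ofCasC n (ofC K (ap (tensorToC K).hom _ x)) = ap (toQuot K) _ x := by
  refine tensorAlgC₁_generated (fun n => LinearMap.eqLocus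
    (((quotCasimirModule K).ofCasC n).comp ((ofC K).comp (ap (tensorToC K).hom _)))
    (ap (toQuot K) (ob (LieRel K) n))) ?_ ?_ ?_ x
  · refine (congrArg (fun y => (quotCasimirModule K).ofCasC 0 (ofC K y)) tensorToC_oneT).trans ?_
    exact (quotCasimirModule K).ofCasC_id
  · intro m n f x hx
    change (quotCasimirModule K).ofCasC n (ofC K (ap (tensorToC K).hom _
      ((tensorAlg (modC₁ K)).X.act f x))) = ap (toQuot K) _ ((tensorAlg (modC₁ K)).X.act f x)
    refine (congrArg (fun y => (quotCasimirModule K).ofCasC n (ofC K y))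
      (ap_act (tensorToC K).hom f x)).trans ?_
    refine ((quotCasimirModule K).ofCasC_comp _ f).trans ?_
    exact (congrArg _ hx).trans (ap_act (toQuot K) f x).symm
  · intro n x hx
    refine (congrArg (fun y => (quotCasimirModule K).ofCasC (n + 2) (ofC K y))
      (tensorToC_mulCasT (y := ofC K (ap (tensorToC K).hom _ x)) rfl)).trans ?_
    refine ((quotCasimirModule K).ofCasC_mulCas _).trans ?_
    exact congrArg (mulCasQ K n) hx

/-- Since the projection to the quotient factors through `tensorToC`, an element killed by
`tensorToC` is zero in the quotient. -/
theorem ker_tensorToC (Z : CatLie K) :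
    LinearMap.ker (ap (tensorToC K).hom Z) = idealSpan (tensorAlg (modC₁ K)) (relSet K) Z := by
  refine le_antisymm ?_ (relIdeal_le_ker K Z)
  obtain ⟨n⟩ := Z
  intro x hx
  refine (toQuot_eq_zero K).1 ((ofCasC_tensorToC K x).symm.trans ?_)
  rw [LinearMap.mem_ker.1 hx, map_zero, map_zero]
  rfl

end Kernel

end CasimirLie

end

theorem mainTheorem3 (K : Type u) [Field K] [CharZero K] :
    IsGrading (algC K) (degC K) ∧
    IsGrading (tensorAlg (modC₁ K)) (tensorAlgDeg (modC₁ K)) ∧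
    (∃ φ : tensorAlg (modC₁ K) ⟶ algC K,
      ofGen (modC₁ K) ≫ φ.hom = inclC₁ K ∧
      (∀ (d : ℕ) (Z : CatLie K), ∀ x ∈ tensorAlgDeg (modC₁ K) d Z, ap φ.hom Z x ∈ degC K d Z) ∧
      (∀ Z : CatLie K, Function.Surjective (ap φ.hom Z)) ∧
      ∀ Z : CatLie K,
        LinearMap.ker (ap φ.hom Z) = idealSpan (tensorAlg (modC₁ K)) (relSet K) Z) ∧
    IsQuadratic (algC K) (inclC₁ K) := by
  refine ⟨isGrading_algC K, isGrading_tensorAlg _, ⟨tensorToC K, ofGen_tensorToC,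
    tensorToC_mem_degC, tensorToC_surjective, ker_tensorToC K⟩, tensorToC K, ofGen_tensorToC,
    tensorToC_surjective, relSet K, ?_, ker_tensorToC K⟩
  rintro _ (rfl | rfl)
  · exact ⟨_, rfl⟩
  · exact ⟨_, rfl⟩
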